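/- Let $\mathcal H$ be a complex Hilbert space and $H\subset\mathcal H$ a standard subspace, i.e. a closed real linear subspace with $\overline{H+iH}=\mathcal H$ and $H\cap iH=\{0\}$. Let $S_H:h+ik\mapsto h-ik$ ($h,k\in H$) be its Tomita operator, a closed, densely defined antilinear operator on $H+iH$, let $\Delta_H=S_H^*S_H$ be the modular operator (so $S_H=J_H\Delta_H^{1/2}$ is the polar decomposition), and let $\log\Delta_H$ be the modular Hamiltonian. Let $A$ be a selfadjoint operator on $\mathcal H$ with $e^{isA}H=H$ for all $s\in\mathbb R$, and assume $A\neq 0$ or $\log\Delta_H=0$. A selfadjoint operator $B$ on a Hilbert space is called active with respect to a closed real linear subspace $K$ if $(\xi,B\xi)\ge 0$ for all $\xi\in D(B)\cap K$. For $n\ge 1$, $A$ is called $n$-active with respect to $H$ if the selfadjoint generator of the one-parameter unitary group $t\mapsto e^{itA}\otimes\cdots\otimes e^{itA}$ on the $n$-fold Hilbert space tensor product $\mathcal H\otimes\cdots\otimes\mathcal H$ is active with respect to $H\otimes\cdots\otimes H$, the closed real linear span of the monomials $h_1\otimes\cdots\otimes h_n$, $h_i\in H$. $A$ is called completely active with respect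 to $H$ if it is $n$-active for every $n\ge 1$. Then $A$ is completely active with respect to $H$ if and only if there is a real number $\lambda\le 0$ such that $\log\Delta_H=\lambda A$ (equality of selfadjoint operators, where for $\lambda=0$ the operator $\lambda A$ is understood as its closure, i.e. the zero operator on all of $\mathcal H$). -/

import Mathlib

open Filter Topology MeasureTheory TensorProduct
open scoped ComplexInnerProductSpace

noncomputable section

universe u

/-! ### One-parameter unitary groups and their generators -/

section UnitaryGroup

variable {E : Type u} [NormedAddCommGroup E] [InnerProductSpace ℂ E]

/-- The graph of the generator of `t ↦ V t`: the pairs `(x, y)` such that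
`(V t x - x) / (i t) → y` as `t → 0`. -/
def generatorGraph (V : ℝ → E →L[ℂ] E) : Submodule ℂ (E × E) where
  carrier := {p | Tendsto (fun t : ℝ => (Complex.I * (t : ℂ))⁻¹ • (V t p.1 - p.1))
    (𝓝[≠] 0) (𝓝 p.2)}
  zero_mem' := by simp
  add_mem' := by
    intro p q hp hq
    refine (Tendsto.add hp hq).congr fun t => ?_
    rw [← smul_add, Prod.fst_add, map_add]
    congr 1
    abel
  smul_mem' := by
    intro c p hp
    refine (Tendsto.const_smul hp c).congr fun t => ?_
    rw [smul_comm, Prod.smul_fst, map_smul, smul_sub c]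

/-- The (selfadjoint) generator of a one-parameter unitary group `V`, normalised so that
`V t = e^{itA}` has generator `A`. Its domain consists of all `x` for which
`(V t x - x) / (i t)` converges in norm as `t → 0`. -/
def groupGenerator (V : ℝ → E →L[ℂ] E) : E →ₗ.[ℂ] E :=
  (generatorGraph V).toLinearPMap

/-- The relation `generatorGraph V` is single-valued, hence it is the graph of the generator. -/
theorem graph_groupGenerator (V : ℝ → E →L[ℂ] E) :
    (groupGenerator V).graph = generatorGraph V := by
  refine Submodule.toLinearPMap_graph_eq _ ?_
  rintro ⟨x, y⟩ hx (rfl : x = 0)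
  have h : Tendsto (fun t : ℝ => (Complex.I * (t : ℂ))⁻¹ • (V t (0 : E) - 0)) (𝓝[≠] 0) (𝓝 y) := hx
  simp only [map_zero, sub_zero, smul_zero] at h
  exact tendsto_nhds_unique h tendsto_const_nhds

variable [CompleteSpace E]

/-- Strongly continuous one-parameter groups of unitary operators. -/
structure IsUnitaryGroup (V : ℝ → E →L[ℂ] E) : Prop where
  unitary_mem : ∀ t, V t ∈ unitary (E →L[ℂ] E)
  map_zero : V 0 = 1
  map_add : ∀ s t, V (s + t) = V s * V t
  continuous_apply : ∀ x, Continuous fun t => V t x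

open Classical in
/-- The unitary group `t ↦ e^{itA}` of a selfadjoint operator `A`: the unique strongly continuous
one-parameter unitary group whose generator is `A`. (The value `1` is only taken when there is no
such group, which never happens for selfadjoint `A`.) -/
def unitaryExp (A : E →ₗ.[ℂ] E) : ℝ → E →L[ℂ] E :=
  if h : ∃ V : ℝ → E →L[ℂ] E, IsUnitaryGroup V ∧ groupGenerator V = A then h.choose
  else fun _ => 1

end UnitaryGroup

/-! ### Spectral measures and the Borel functional calculus -/

section Spectral

variable (E : Type u) [NormedAddCommGroup E] [InnerProductSpace ℂ E] [CompleteSpace E]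

/-- Projection-valued measures on the Borel sets of `ℝ`. (The values of `proj` on non-measurable
sets are irrelevant.) -/
structure ProjectionValuedMeasure where
  proj : Set ℝ → E →L[ℂ] E
  isStarProjection : ∀ B, MeasurableSet B → IsStarProjection (proj B)
  proj_univ : proj Set.univ = 1
  hasSum_iUnion : ∀ B : ℕ → Set ℝ, (∀ i, MeasurableSet (B i)) →
    Pairwise (Function.onFun Disjoint B) → ∀ x, HasSum (fun i => proj (B i) x) (proj (⋃ i, B i) x)

namespace ProjectionValuedMeasure

variable {E}

theorem proj_empty (P : ProjectionValuedMeasure E) : P.proj ∅ = 0 := by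
  ext x
  have h := P.hasSum_iUnion (fun _ => ∅) (fun _ => MeasurableSet.empty)
    (fun _ _ _ => by simp [Function.onFun]) x
  have h0 := h.summable.tendsto_atTop_zero
  simpa using tendsto_nhds_unique tendsto_const_nhds h0

theorem inner_proj_self (P : ProjectionValuedMeasure E) (x : E) {B : Set ℝ}
    (hB : MeasurableSet B) : ⟪x, P.proj B x⟫ = ((‖P.proj B x‖ ^ 2 : ℝ) : ℂ) := by
  have hp := P.isStarProjection B hB
  have h1 : P.proj B (P.proj B x) = P.proj B x := by
    have := congrArg (fun T : E →L[ℂ] E => T x) hp.isIdempotentElem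
    simpa using this
  have h2 : ContinuousLinearMap.adjoint (P.proj B) = P.proj B := hp.isSelfAdjoint
  calc ⟪x, P.proj B x⟫ = ⟪x, P.proj B (P.proj B x)⟫ := by rw [h1]
    _ = ⟪ContinuousLinearMap.adjoint (P.proj B) x, P.proj B x⟫ := by
        rw [ContinuousLinearMap.adjoint_inner_left]
    _ = _ := by rw [h2, inner_self_eq_norm_sq_to_K]; push_cast; rfl

/-- The scalar spectral measure `B ↦ ⟪x, P(B) x⟫ = ‖P(B) x‖²` of a vector `x`. -/
def scalarMeasure (P : ProjectionValuedMeasure E) (x : E) : Measure ℝ :=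
  Measure.ofMeasurable (fun B _ => ENNReal.ofReal (‖P.proj B x‖ ^ 2))
    (by simp [P.proj_empty])
    (by
      intro B hB hd
      have h := (P.hasSum_iUnion B hB hd x).mapL (innerSL ℂ x)
      simp only [innerSL_apply_apply] at h
      rw [P.inner_proj_self x (MeasurableSet.iUnion hB)] at h
      simp only [fun i => P.inner_proj_self x (hB i)] at h
      have h' := Complex.hasSum_ofReal.1 h
      rw [← h'.tsum_eq, ENNReal.ofReal_tsum_of_nonneg (fun i => sq_nonneg _) h'.summable])

/-- The push-forward `B ↦ P(f⁻¹(B))` of a projection-valued measure by a Borel function. -/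
def map (P : ProjectionValuedMeasure E) (f : ℝ → ℝ) (hf : Measurable f) :
    ProjectionValuedMeasure E where
  proj B := P.proj (f ⁻¹' B)
  isStarProjection B hB := P.isStarProjection _ (hf hB)
  proj_univ := P.proj_univ
  hasSum_iUnion B hB hd x := by
    rw [Set.preimage_iUnion]
    exact P.hasSum_iUnion _ (fun i => hf (hB i)) (fun i j hij => (hd hij).preimage f) x

/-- `P` is the spectral measure of `A`, i.e. `A = ∫ t dP(t)`: the domain of `A` consists of the `x`
with `∫ t² d⟪x, P(t) x⟫ < ∞`, and `⟪x, A x⟫ = ∫ t d⟪x, P(t) x⟫` for these `x` (this determines `A`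
by polarization, its domain being dense). -/
structure IsSpectralMeasureOf (P : ProjectionValuedMeasure E) (A : E →ₗ.[ℂ] E) : Prop where
  mem_domain_iff : ∀ x, x ∈ A.domain ↔ Integrable (fun t : ℝ => t ^ 2) (P.scalarMeasure x)
  inner_apply : ∀ x : A.domain, ⟪(x : E), A x⟫ = ((∫ t, t ∂(P.scalarMeasure x) : ℝ) : ℂ)

end ProjectionValuedMeasure

variable {E}

open Classical in
/-- The Borel functional calculus `f(T)` of a selfadjoint operator `T` for a real Borel function
`f`: the unique operator `L` whose spectral measure is `B ↦ P(f⁻¹(B))`, where `P` is the spectral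
measure of `T`. (The value `0` is only taken when `T` has no spectral measure, which never happens
for selfadjoint `T`.) -/
def borelCalculus (f : ℝ → ℝ) (hf : Measurable f) (T : E →ₗ.[ℂ] E) : E →ₗ.[ℂ] E :=
  if h : ∃ L : E →ₗ.[ℂ] E, ∃ P : ProjectionValuedMeasure E,
      P.IsSpectralMeasureOf T ∧ (P.map f hf).IsSpectralMeasureOf L then h.choose
  else 0

end Spectral

/-! ### Modular theory of a standard subspace -/

namespace StandardSubspace

section Tomita

variable {E : Type u} [NormedAddCommGroup E] [InnerProductSpace ℂ E]

/-- A decomposition `x = h + i k` with `h, k ∈ H` is unique. -/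
theorem eq_of_add_I_smul_eq (H : StandardSubspace E) {p q : E × E}
    (hp : p.1 ∈ H.toClosedSubmodule.toSubmodule ∧ p.2 ∈ H.toClosedSubmodule.toSubmodule)
    (hq : q.1 ∈ H.toClosedSubmodule.toSubmodule ∧ q.2 ∈ H.toClosedSubmodule.toSubmodule)
    (h : p.1 + Complex.I • p.2 = q.1 + Complex.I • q.2) : p = q := by
  have e : p.1 - q.1 = Complex.I • (q.2 - p.2) := by
    rw [smul_sub, sub_eq_sub_iff_add_eq_add, h, add_comm]
  have h1 : p.1 - q.1 ∈ H.toClosedSubmodule ⊓ H.toClosedSubmodule.mulI := by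
    refine ⟨sub_mem hp.1 hq.1, ?_⟩
    change p.1 - q.1 ∈ H.toClosedSubmodule.mulI
    rw [ClosedSubmodule.mem_mapEquiv_iff, scalarSMulCLE_symm_apply, e]
    have : (Complex.UnitI⁻¹ : ℂˣ) • Complex.I • (q.2 - p.2) = q.2 - p.2 := by
      simp [Units.smul_def, smul_smul]
    rw [this]
    exact H.toClosedSubmodule.toSubmodule.sub_mem hq.2 hp.2
  rw [H.IsSeparating] at h1
  have h0 : p.1 - q.1 = 0 := by simpa using h1
  rw [h0] at e
  have h2 : q.2 - p.2 = 0 := (smul_eq_zero.1 e.symm).resolve_left Complex.I_ne_zero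
  exact Prod.ext (sub_eq_zero.1 h0) (sub_eq_zero.1 h2).symm

/-- The dense complex subspace `H + iH`. -/
def tomitaDomain (H : StandardSubspace E) : Submodule ℂ E where
  carrier := {x | ∃ p : E × E, (p.1 ∈ H.toClosedSubmodule.toSubmodule ∧
    p.2 ∈ H.toClosedSubmodule.toSubmodule) ∧ x = p.1 + Complex.I • p.2}
  zero_mem' := ⟨0, ⟨zero_mem _, zero_mem _⟩, by simp⟩
  add_mem' := by
    rintro _ _ ⟨p, hp, rfl⟩ ⟨q, hq, rfl⟩
    refine ⟨p + q, ⟨add_mem hp.1 hq.1, add_mem hp.2 hq.2⟩, ?_⟩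
    simp only [Prod.fst_add, Prod.snd_add]
    module
  smul_mem' := by
    rintro c _ ⟨p, hp, rfl⟩
    refine ⟨(c.re • p.1 - c.im • p.2, c.im • p.1 + c.re • p.2),
      ⟨sub_mem (Submodule.smul_mem _ _ hp.1) (Submodule.smul_mem _ _ hp.2),
      add_mem (Submodule.smul_mem _ _ hp.1) (Submodule.smul_mem _ _ hp.2)⟩, ?_⟩
    simp only [← Complex.coe_smul]
    conv_lhs => rw [← Complex.re_add_im c]
    match_scalars <;> first | ring1 | linear_combination (c.im : ℂ) * Complex.I_mul_I

theorem mem_tomitaDomain (H : StandardSubspace E) {h k : E}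
    (hh : h ∈ H.toClosedSubmodule.toSubmodule) (hk : k ∈ H.toClosedSubmodule.toSubmodule) :
    h + Complex.I • k ∈ H.tomitaDomain := ⟨(h, k), ⟨hh, hk⟩, rfl⟩

/-- The value of the Tomita operator: `h - i k` for `x = h + i k`. -/
def tomitaValue (H : StandardSubspace E) (x : H.tomitaDomain) : E :=
  x.2.choose.1 - Complex.I • x.2.choose.2

theorem tomitaValue_eq (H : StandardSubspace E) (x : H.tomitaDomain) {h k : E}
    (hh : h ∈ H.toClosedSubmodule.toSubmodule) (hk : k ∈ H.toClosedSubmodule.toSubmodule)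
    (hx : (x : E) = h + Complex.I • k) : H.tomitaValue x = h - Complex.I • k := by
  have e : x.2.choose = (h, k) := H.eq_of_add_I_smul_eq x.2.choose_spec.1 ⟨hh, hk⟩
    (x.2.choose_spec.2.symm.trans hx)
  rw [tomitaValue, e]

/-- Tomita's operator `S_H : h + i k ↦ h - i k`, `h, k ∈ H`, an antilinear operator with domain
`H + iH`. -/
def tomita (H : StandardSubspace E) : LinearPMap (starRingEnd ℂ) E E where
  domain := H.tomitaDomain
  toFun :=
    { toFun := H.tomitaValue
      map_add' := by
        intro x y
        obtain ⟨p, hp, hx⟩ := x.2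
        obtain ⟨q, hq, hy⟩ := y.2
        rw [H.tomitaValue_eq x hp.1 hp.2 hx, H.tomitaValue_eq y hq.1 hq.2 hy,
          H.tomitaValue_eq _ (add_mem hp.1 hq.1) (add_mem hp.2 hq.2)]
        · module
        · rw [Submodule.coe_add, hx, hy]
          module
      map_smul' := by
        intro c x
        obtain ⟨p, hp, hx⟩ := x.2
        rw [H.tomitaValue_eq x hp.1 hp.2 hx,
          H.tomitaValue_eq _
            (sub_mem (Submodule.smul_mem _ c.re hp.1) (Submodule.smul_mem _ c.im hp.2))
            (add_mem (Submodule.smul_mem _ c.im hp.1) (Submodule.smul_mem _ c.re hp.2))]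
        · simp only [← Complex.coe_smul]
          have hc : starRingEnd ℂ c = (c.re : ℂ) - c.im * Complex.I := by
            apply Complex.ext <;> simp
          rw [hc]
          match_scalars <;> first | ring1 | linear_combination (-c.im : ℂ) * Complex.I_mul_I
        · rw [Submodule.coe_smul, hx]
          simp only [← Complex.coe_smul]
          conv_lhs => rw [← Complex.re_add_im c]
          match_scalars <;> first | ring1 | linear_combination (c.im : ℂ) * Complex.I_mul_I }

/-- The graph of `S_H^* S_H`: the pairs `(x, y)` with `x ∈ D(S_H)`, `S_H x ∈ D(S_H^*)` and
`y = S_H^* S_H x`, where the adjoint of the antilinear operator `S_H` is given by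
`⟪S_H u, v⟫ = ⟪S_H^* v, u⟫`. -/
def modularGraph (H : StandardSubspace E) : Submodule ℂ (E × E) where
  carrier := {p | ∃ x : H.tomita.domain, (x : E) = p.1 ∧
    ∀ u : H.tomita.domain, ⟪H.tomita u, H.tomita x⟫ = ⟪p.2, (u : E)⟫}
  zero_mem' := ⟨0, by simp, by simp⟩
  add_mem' := by
    rintro p q ⟨x, hx, hp⟩ ⟨y, hy, hq⟩
    refine ⟨x + y, by simp [hx, hy], fun u => ?_⟩
    rw [LinearPMap.map_add, inner_add_right, hp u, hq u, Prod.snd_add, inner_add_left]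
  smul_mem' := by
    rintro c p ⟨x, hx, hp⟩
    refine ⟨c • x, by simp [hx], fun u => ?_⟩
    rw [LinearPMap.map_smulₛₗ, inner_smul_right, hp u, Prod.smul_snd, inner_smul_left]

/-- The modular operator `Δ_H = S_H^* S_H`, i.e. `S_H = J_H Δ_H^{1/2}` is the polar decomposition
of Tomita's operator. -/
def modularOperator (H : StandardSubspace E) : E →ₗ.[ℂ] E :=
  H.modularGraph.toLinearPMap

end Tomita

/-- The modular Hamiltonian `log Δ_H`. The modular operator is positive and nonsingular, so that
its spectral measure lives on `(0, ∞)`. -/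
def modularHamiltonian {E : Type u} [NormedAddCommGroup E] [InnerProductSpace ℂ E] [CompleteSpace E]
    (H : StandardSubspace E) : E →ₗ.[ℂ] E :=
  borelCalculus Real.log Real.measurable_log H.modularOperator

end StandardSubspace

/-! ### Hilbert space tensor powers -/

/-- Complex inner product spaces, bundled. -/
structure BundledInnerSpace where
  carrier : Type u
  [group : NormedAddCommGroup carrier]
  [inner : InnerProductSpace ℂ carrier]

section TensorPower

variable (E : Type u) [NormedAddCommGroup E] [InnerProductSpace ℂ E]

/-- Auxiliary recursion for the algebraic tensor powers. -/
def algTensorPowerAux : ℕ → BundledInnerSpace.{u}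
  | 0 => { carrier := E }
  | n + 1 =>
    letI := (algTensorPowerAux n).group
    letI := (algTensorPowerAux n).inner
    { carrier := (algTensorPowerAux n).carrier ⊗[ℂ] E }

/-- The algebraic tensor power of `E` with `n + 1` factors. -/
def AlgTensorPower (n : ℕ) : Type u := (algTensorPowerAux E n).carrier

instance (n : ℕ) : NormedAddCommGroup (AlgTensorPower E n) := (algTensorPowerAux E n).group

instance (n : ℕ) : InnerProductSpace ℂ (AlgTensorPower E n) := (algTensorPowerAux E n).inner

/-- The Hilbert space tensor power of `E` with `n + 1` factors: the completion of the algebraic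
tensor power. -/
abbrev HilbertTensorPower (n : ℕ) : Type u := UniformSpace.Completion (AlgTensorPower E n)

variable {E}

/-- The monomial `v 0 ⊗ v 1 ⊗ ⋯ ⊗ v n` in the algebraic tensor power. -/
def algMonomial : (n : ℕ) → (Fin (n + 1) → E) → AlgTensorPower E n
  | 0, v => v 0
  | n + 1, v => (algMonomial n (Fin.init v) ⊗ₜ[ℂ] v (Fin.last (n + 1)) : AlgTensorPower E n ⊗[ℂ] E)

/-- The operator `T ⊗ T ⊗ ⋯ ⊗ T` (`n + 1` factors) on the algebraic tensor power. -/
def algOperatorPower (T : E →L[ℂ] E) : (n : ℕ) → AlgTensorPower E n →L[ℂ] AlgTensorPower E n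
  | 0 => T
  | n + 1 => (TensorProduct.mapL (algOperatorPower T n) T :
      AlgTensorPower E n ⊗[ℂ] E →L[ℂ] AlgTensorPower E n ⊗[ℂ] E)

/-- The operator `T ⊗ T ⊗ ⋯ ⊗ T` (`n + 1` factors) on the Hilbert space tensor power. -/
def operatorPower (T : E →L[ℂ] E) (n : ℕ) : HilbertTensorPower E n →L[ℂ] HilbertTensorPower E n :=
  (algOperatorPower T n).completion

/-- The tensor power `H ⊗ H ⊗ ⋯ ⊗ H` (`n + 1` factors) of a real subspace: the closed real linear
span of the monomials `h₀ ⊗ h₁ ⊗ ⋯ ⊗ hₙ`, `hᵢ ∈ H`. -/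
def realTensorPower (H : Submodule ℝ E) (n : ℕ) : Submodule ℝ (HilbertTensorPower E n) :=
  (Submodule.span ℝ {x | ∃ v : Fin (n + 1) → E, (∀ i, v i ∈ H) ∧
    x = (algMonomial n v : HilbertTensorPower E n)}).topologicalClosure

end TensorPower

/-! ### Activity -/

section Active

variable {E : Type u} [NormedAddCommGroup E] [InnerProductSpace ℂ E]

/-- `A` is active with respect to `H`: `(ξ, A ξ) ≥ 0` for all `ξ ∈ D(A) ∩ H`. (The number
`(ξ, A ξ)` is real when `A` is selfadjoint.) -/
def IsActive (A : E →ₗ.[ℂ] E) (H : Submodule ℝ E) : Prop :=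
  ∀ ξ : A.domain, (ξ : E) ∈ H → 0 ≤ (⟪(ξ : E), A ξ⟫).re

variable [CompleteSpace E]

/-- `A` is `(n + 1)`-active with respect to `H`: the generator of
`t ↦ e^{itA} ⊗ ⋯ ⊗ e^{itA}` is active with respect to `H ⊗ ⋯ ⊗ H` (`n + 1` factors). -/
def IsSuccActive (n : ℕ) (A : E →ₗ.[ℂ] E) (H : Submodule ℝ E) : Prop :=
  IsActive (groupGenerator fun t => operatorPower (unitaryExp A t) n) (realTensorPower H n)

/-- `A` is completely active with respect to `H`: it is `n`-active for all `n ≥ 1`. -/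
def IsCompletelyActive (A : E →ₗ.[ℂ] E) (H : Submodule ℝ E) : Prop :=
  ∀ n : ℕ, IsSuccActive n A H

end Active

end

noncomputable section

set_option linter.unusedSectionVars false

/-! ### Weak limits of bounded operators -/

section WeakLimits

variable {E : Type*} [NormedAddCommGroup E] [InnerProductSpace ℂ E]

/-! Let p and q be the real orthogonal projections onto H and iH, R = p + q (`projSum`, complex
linear) and T = p - q (`projDiff`, antilinear). Both are bounded, S_H R = T and Δ_H = (2 - R) R⁻¹,
that is R = 2 / (1 + Δ_H), so the modular operator can be studied through bounded operators
(`mem_modularGraph_iff`). As e^{isA} maps H onto itself, it commutes with R and T. Antilinearity of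
T then makes it carry the spectral subspace of A over a Borel set B into the one over -B
(`projDiff_proj`).

Activity implies proportionality. For x in the spectral subspace of [l, r], the vectors η = R x and
ζ = T x = S_H η lie over [l, r] and [-r, -l]. For such pairs the tensor ⊗ η_i + ⊗ ζ_i belongs to H ⊗
⋯ ⊗ H, and as soon as one l_i is positive the cross terms between its two summands vanish. Activity
becomes (∑ l_i) ∏ ‖ζ_i‖² ≤ (∑ r_i) ∏ ‖η_i‖². Repeating two pairs pm and qm times and letting m grow
removes the sums: ‖ζ‖^{2p} ‖ζ'‖^{2q} ≤ ‖η‖^{2p} ‖η'‖^{2q} whenever p l + q l' > 0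
(`pow_mul_pow_le`). This is where all tensor powers are needed. For k = log ‖ζ‖² - log ‖η‖² it says
p k + q k' ≤ 0 whenever p l + q l' > 0, and a cut argument (`exists_slope`) yields a single c ≤ 0
with c r ≤ k ≤ c l for all pairs. Hence ‖S_H η‖² lies between e^{cr} ‖η‖² and e^{cl} ‖η‖²;
subdividing the spectrum turns this into R = 2 / (1 + e^{cA}) (`projSum_eq_integral`), so log Δ_H is
the closure of cA.

Proportionality implies activity. Let c < 0. The KMS relation ⟪a, e^{cA} b⟫ = ⟪b, a⟫ for a, b in H
passes to tensor powers. Up to spectral truncation, f(s) = ⟪ξ, (e^{csA} ⊗ ⋯ ⊗ e^{csA}) ξ⟫ thus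
satisfies f(1) = f(0) for ξ in H ⊗ ⋯ ⊗ H. Cauchy-Schwarz gives f(s/2)² ≤ f(0) f(s), which forces
f'(0) ≤ 0; f'(0) is c times the form of the tensor generator (`isSuccActive_of_neg`). If c = 0, then
R = 1, the inner product is real on H and the form vanishes (`isSuccActive_of_projSum_eq_one`).

The analytic base is the spectral theorem: projection-valued measures come from the continuous
functional calculus of normal operators, unbounded selfadjoint operators are reached through their
resolvent, and characteristic functions recover spectral projections from unitary groups. -/

theorem clm_ext_inner_self {S T : E →L[ℂ] E} (h : ∀ x, ⟪x, S x⟫ = ⟪x, T x⟫) : S = T := by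
  have := (ext_inner_map (S : E →ₗ[ℂ] E) (T : E →ₗ[ℂ] E)).1 fun x => by
    rw [← inner_conj_symm, ← inner_conj_symm (_ : E) x]
    exact congrArg _ (h x)
  exact ContinuousLinearMap.coe_injective this

theorem inner_polarization (T : E →L[ℂ] E) (x y : E) :
    ⟪x, T y⟫ = (⟪x + y, T (x + y)⟫ - ⟪x - y, T (x - y)⟫
      - Complex.I * ⟪x + Complex.I • y, T (x + Complex.I • y)⟫
      + Complex.I * ⟪x - Complex.I • y, T (x - Complex.I • y)⟫) / 4 := by
  simp only [map_add, map_sub, map_smul, inner_add_left, inner_add_right, inner_sub_left,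
    inner_sub_right, inner_smul_left, inner_smul_right, Complex.conj_I]
  linear_combination ((1 / 2) * ⟪x, T y⟫ - (1 / 2) * ⟪y, T x⟫) * Complex.I_mul_I

theorem tendsto_inner_of_tendsto_inner_self {ι : Type*} {l : Filter ι} {T : ι → E →L[ℂ] E}
    {S : E →L[ℂ] E} (h : ∀ x, Tendsto (fun n => ⟪x, T n x⟫) l (𝓝 ⟪x, S x⟫)) (x y : E) :
    Tendsto (fun n => ⟪x, T n y⟫) l (𝓝 ⟪x, S y⟫) := by
  simp only [inner_polarization _ x y]
  exact ((((h _).sub (h _)).sub ((h _).const_mul _)).add ((h _).const_mul _)).div_const _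

variable [CompleteSpace E]

/-- If the quadratic forms of a sequence of bounded operators converge pointwise, the limit is
the quadratic form of a bounded operator. -/
theorem exists_clm_of_tendsto_inner_self {T : ℕ → E →L[ℂ] E} {q : E → ℂ}
    (h : ∀ x, Tendsto (fun n => ⟪x, T n x⟫) atTop (𝓝 (q x))) :
    ∃ S : E →L[ℂ] E, ∀ x, ⟪x, S x⟫ = q x := by
  have h2 : ∀ x y, ∃ b, Tendsto (fun n => ⟪x, T n y⟫) atTop (𝓝 b) := by
    intro x y
    simp only [inner_polarization _ x y]
    exact ⟨_, ((((h _).sub (h _)).sub ((h _).const_mul _)).add ((h _).const_mul _)).div_const _⟩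
  choose b hb using h2
  have hbd : ∀ y, ∃ C, ∀ n, ‖T n y‖ ≤ C := by
    intro y
    -- Uniform boundedness is used twice: for fixed `y` on the functionals `⟪T n y, ·⟫`, then on the
    -- operators themselves. The limit form is therefore bounded.
    obtain ⟨C, hC⟩ := banach_steinhaus (g := fun n => innerSL ℂ (T n y)) (fun x => by
      obtain ⟨C, hC⟩ := (hb x y).norm.bddAbove_range
      refine ⟨C, fun n => ?_⟩
      rw [innerSL_apply_apply, norm_inner_symm]
      exact hC ⟨n, rfl⟩)
    exact ⟨C, fun n => by simpa using hC n⟩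
  obtain ⟨C, hC⟩ := banach_steinhaus hbd
  have u : ∀ {f : ℕ → ℂ} {a c : ℂ}, Tendsto f atTop (𝓝 a) → Tendsto f atTop (𝓝 c) → a = c :=
    fun h h' => tendsto_nhds_unique h h'
  let B : E →ₗ⋆[ℂ] E →ₗ[ℂ] ℂ := LinearMap.mk₂'ₛₗ _ _ b
    (fun x x' y => u (hb _ _) (by simpa [inner_add_left] using (hb x y).add (hb x' y)))
    (fun c x y => u (hb _ _) (by
      simpa [inner_smul_left, mul_comm] using (hb x y).const_mul (starRingEnd ℂ c)))
    (fun x y y' => u (hb _ _) (by simpa [inner_add_right] using (hb x y).add (hb x y')))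
    (fun c x y => u (hb _ _) (by simpa [inner_smul_right] using (hb x y).const_mul c))
  have hB : ∀ x y, ‖B x y‖ ≤ C * ‖x‖ * ‖y‖ := by
    intro x y
    refine le_of_tendsto (hb x y).norm (Eventually.of_forall fun n => ?_)
    refine (norm_inner_le_norm _ _).trans ?_
    have := (T n).le_of_opNorm_le (hC n) y
    nlinarith [norm_nonneg x]
  let S := InnerProductSpace.continuousLinearMapOfBilin (LinearMap.mkContinuous₂ B C hB)
  -- The Fréchet–Riesz operator satisfies `⟪S x, y⟫ = B x y`, with `S` in the left slot, hence the
  -- adjoint.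
  refine ⟨ContinuousLinearMap.adjoint S, fun x => ?_⟩
  rw [ContinuousLinearMap.adjoint_inner_right]
  refine (InnerProductSpace.continuousLinearMapOfBilin_apply _ _ _).trans ?_
  exact u (hb x x) (h x)

end WeakLimits

/-! ### Bounded measurable functions -/

/-- Bounded measurable complex functions. -/
structure IsBddMeasurable {Ω : Type*} [MeasurableSpace Ω] (f : Ω → ℂ) : Prop where
  measurable : Measurable f
  bdd : ∃ C, ∀ ω, ‖f ω‖ ≤ C

namespace IsBddMeasurable

variable {Ω : Type*} [MeasurableSpace Ω] {f g : Ω → ℂ}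

theorem const (c : ℂ) : IsBddMeasurable (fun _ : Ω => c) := ⟨measurable_const, ‖c‖, fun _ => le_rfl⟩

theorem add (hf : IsBddMeasurable f) (hg : IsBddMeasurable g) :
    IsBddMeasurable (fun ω => f ω + g ω) := by
  obtain ⟨C, hC⟩ := hf.bdd
  obtain ⟨D, hD⟩ := hg.bdd
  exact ⟨hf.1.add hg.1, C + D, fun ω => (norm_add_le _ _).trans (add_le_add (hC ω) (hD ω))⟩

theorem mul (hf : IsBddMeasurable f) (hg : IsBddMeasurable g) :
    IsBddMeasurable (fun ω => f ω * g ω) := by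
  obtain ⟨C, hC⟩ := hf.bdd
  obtain ⟨D, hD⟩ := hg.bdd
  refine ⟨hf.1.mul hg.1, C * D, fun ω => ?_⟩
  rw [norm_mul]
  exact mul_le_mul (hC ω) (hD ω) (norm_nonneg _) ((norm_nonneg _).trans (hC ω))

theorem const_mul (hf : IsBddMeasurable f) (c : ℂ) : IsBddMeasurable (fun ω => c * f ω) :=
  (const c).mul hf

theorem sub (hf : IsBddMeasurable f) (hg : IsBddMeasurable g) :
    IsBddMeasurable (fun ω => f ω - g ω) := by
  simpa [sub_eq_add_neg] using hf.add (hg.const_mul (-1))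

theorem conj (hf : IsBddMeasurable f) : IsBddMeasurable (fun ω => starRingEnd ℂ (f ω)) :=
  ⟨Complex.continuous_conj.measurable.comp hf.1, by simpa using hf.bdd⟩

theorem indicator (hf : IsBddMeasurable f) {B : Set Ω} (hB : MeasurableSet B) :
    IsBddMeasurable (B.indicator f) := by
  obtain ⟨C, hC⟩ := hf.bdd
  exact ⟨hf.1.indicator hB, C, fun ω => (norm_indicator_le_norm_self f ω).trans (hC ω)⟩

theorem indicator_one {B : Set Ω} (hB : MeasurableSet B) :
    IsBddMeasurable (B.indicator fun _ => (1 : ℂ)) := (const 1).indicator hB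

theorem simpleFunc (f : SimpleFunc Ω ℂ) : IsBddMeasurable f := by
  obtain ⟨C, hC⟩ := f.exists_forall_norm_le
  exact ⟨f.measurable, C, hC⟩

theorem integrable (hf : IsBddMeasurable f) (μ : Measure Ω) [IsFiniteMeasure μ] :
    Integrable f μ := by
  obtain ⟨C, hC⟩ := hf.bdd
  exact Integrable.of_bound hf.1.aestronglyMeasurable C (Eventually.of_forall hC)

/-- Every bounded measurable function is a pointwise limit of uniformly bounded simple functions. -/
theorem exists_simpleFunc (hf : IsBddMeasurable f) : ∃ (s : ℕ → SimpleFunc Ω ℂ) (C : ℝ),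
    (∀ n ω, ‖s n ω‖ ≤ C) ∧ ∀ ω, Tendsto (fun n => s n ω) atTop (𝓝 (f ω)) := by
  obtain ⟨C, hC⟩ := hf.bdd
  have h : ∀ ω, ‖f ω‖ ≤ max C 0 := fun ω => (hC ω).trans (le_max_left _ _)
  exact ⟨fun n => hf.1.stronglyMeasurable.approxBounded (max C 0) n, max C 0,
    fun n ω => StronglyMeasurable.norm_approxBounded_le _ (le_max_right _ _) _ _,
    fun ω => StronglyMeasurable.tendsto_approxBounded_of_norm_le _ (h ω)⟩

end IsBddMeasurable

theorem tendsto_integral_of_bounded {Ω : Type*} [MeasurableSpace Ω] (μ : Measure Ω)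
    [IsFiniteMeasure μ] {s : ℕ → Ω → ℂ} {f : Ω → ℂ} {C : ℝ} (hs : ∀ n, Measurable (s n))
    (hC : ∀ n ω, ‖s n ω‖ ≤ C) (h : ∀ ω, Tendsto (fun n => s n ω) atTop (𝓝 (f ω))) :
    Tendsto (fun n => ∫ ω, s n ω ∂μ) atTop (𝓝 (∫ ω, f ω ∂μ)) :=
  tendsto_integral_of_dominated_convergence (fun _ => C) (fun n => (hs n).aestronglyMeasurable)
    (integrable_const C) (fun n => Eventually.of_forall (hC n)) (Eventually.of_forall h)

/-! ### Projection-valued measures on a measurable space -/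

/-- Projection-valued measures on a measurable space `Ω`. -/
structure PVMeasure (Ω : Type*) [MeasurableSpace Ω] (E : Type*) [NormedAddCommGroup E]
    [InnerProductSpace ℂ E] [CompleteSpace E] where
  proj : Set Ω → E →L[ℂ] E
  isStarProjection : ∀ B, MeasurableSet B → IsStarProjection (proj B)
  proj_univ : proj Set.univ = 1
  hasSum_iUnion : ∀ B : ℕ → Set Ω, (∀ i, MeasurableSet (B i)) →
    Pairwise (Function.onFun Disjoint B) → ∀ x, HasSum (fun i => proj (B i) x) (proj (⋃ i, B i) x)

namespace PVMeasure

variable {Ω : Type*} [MeasurableSpace Ω] {E : Type*} [NormedAddCommGroup E]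
  [InnerProductSpace ℂ E] [CompleteSpace E] (P : PVMeasure Ω E)

theorem proj_empty : P.proj ∅ = 0 := by
  ext x
  have h := P.hasSum_iUnion (fun _ => ∅) (fun _ => MeasurableSet.empty)
    (fun _ _ _ => by simp [Function.onFun]) x
  have h0 := h.summable.tendsto_atTop_zero
  simpa using tendsto_nhds_unique tendsto_const_nhds h0

variable {B C : Set Ω}

theorem proj_proj (hB : MeasurableSet B) (x : E) : P.proj B (P.proj B x) = P.proj B x :=
  congrArg (fun T : E →L[ℂ] E => T x) (P.isStarProjection B hB).isIdempotentElem

theorem inner_proj_left (hB : MeasurableSet B) (x y : E) :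
    ⟪P.proj B x, y⟫ = ⟪x, P.proj B y⟫ := by
  have h2 : ContinuousLinearMap.adjoint (P.proj B) = P.proj B :=
    (P.isStarProjection B hB).isSelfAdjoint
  rw [← ContinuousLinearMap.adjoint_inner_right, h2]

theorem inner_proj_self (x : E) (hB : MeasurableSet B) :
    ⟪x, P.proj B x⟫ = ((‖P.proj B x‖ ^ 2 : ℝ) : ℂ) := by
  rw [← P.proj_proj hB, ← P.inner_proj_left hB, P.proj_proj hB, inner_self_eq_norm_sq_to_K]
  push_cast
  rfl

/-- The scalar measure `B ↦ ⟪x, P(B) x⟫ = ‖P(B) x‖²` of a vector `x`. -/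
def scalarMeasure (x : E) : Measure Ω :=
  Measure.ofMeasurable (fun B _ => ENNReal.ofReal (‖P.proj B x‖ ^ 2))
    (by simp [P.proj_empty])
    (by
      intro B hB hd
      have h := (P.hasSum_iUnion B hB hd x).mapL (innerSL ℂ x)
      simp only [innerSL_apply_apply] at h
      rw [P.inner_proj_self x (MeasurableSet.iUnion hB)] at h
      simp only [fun i => P.inner_proj_self x (hB i)] at h
      have h' := Complex.hasSum_ofReal.1 h
      rw [← h'.tsum_eq, ENNReal.ofReal_tsum_of_nonneg (fun i => sq_nonneg _) h'.summable])

theorem scalarMeasure_apply (x : E) (hB : MeasurableSet B) :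
    P.scalarMeasure x B = ENNReal.ofReal (‖P.proj B x‖ ^ 2) :=
  Measure.ofMeasurable_apply B hB

instance (x : E) : IsFiniteMeasure (P.scalarMeasure x) :=
  ⟨by rw [P.scalarMeasure_apply x MeasurableSet.univ]; exact ENNReal.ofReal_lt_top⟩

theorem scalarMeasure_real (x : E) (hB : MeasurableSet B) :
    (P.scalarMeasure x).real B = ‖P.proj B x‖ ^ 2 := by
  rw [measureReal_def, P.scalarMeasure_apply x hB, ENNReal.toReal_ofReal (sq_nonneg _)]

theorem scalarMeasure_real_univ (x : E) : (P.scalarMeasure x).real Set.univ = ‖x‖ ^ 2 := by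
  simp [P.scalarMeasure_real x MeasurableSet.univ, P.proj_univ]

theorem inner_proj (x : E) (hB : MeasurableSet B) :
    ⟪x, P.proj B x⟫ = ((P.scalarMeasure x).real B : ℂ) := by
  rw [P.inner_proj_self x hB, P.scalarMeasure_real x hB]

theorem proj_union (hB : MeasurableSet B) (hC : MeasurableSet C) (hd : Disjoint B C) :
    P.proj (B ∪ C) = P.proj B + P.proj C := by
  refine clm_ext_inner_self fun x => ?_
  rw [add_apply, inner_add_right, P.inner_proj x (hB.union hC),
    P.inner_proj x hB, P.inner_proj x hC, measureReal_union hd hC]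
  push_cast
  rfl

theorem proj_compl (hB : MeasurableSet B) : P.proj Bᶜ = 1 - P.proj B := by
  have := P.proj_union hB hB.compl disjoint_compl_right
  rw [Set.union_compl_self, P.proj_univ] at this
  rw [this, add_sub_cancel_left]

theorem proj_apply_eq_zero_iff (x : E) (hB : MeasurableSet B) :
    P.proj B x = 0 ↔ P.scalarMeasure x B = 0 := by
  rw [P.scalarMeasure_apply x hB, ENNReal.ofReal_eq_zero]
  constructor
  · intro h
    simp [h]
  · intro h
    simpa using le_antisymm h (sq_nonneg _)

/-- Multiplicativity is not an axiom. The scalar measure of `P.proj C x` vanishes on the complement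
of `C`, which contains `B`. -/
theorem proj_mul_of_disjoint (hB : MeasurableSet B) (hC : MeasurableSet C) (hd : Disjoint B C) :
    P.proj B * P.proj C = 0 := by
  ext x
  refine (P.proj_apply_eq_zero_iff _ hB).2 (measure_mono_null hd.subset_compl_right ?_)
  refine (P.proj_apply_eq_zero_iff _ hC.compl).1 ?_
  rw [P.proj_compl hC]
  simp [P.proj_proj hC]

theorem proj_inter (hB : MeasurableSet B) (hC : MeasurableSet C) :
    P.proj (B ∩ C) = P.proj B * P.proj C := by
  have h1 : P.proj B = P.proj (B ∩ C) + P.proj (B \ C) := by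
    rw [← P.proj_union (hB.inter hC) (hB.diff hC) Set.disjoint_sdiff_inter.symm,
      Set.inter_union_sdiff]
  have h2 : P.proj C = P.proj (B ∩ C) + P.proj (C \ B) := by
    rw [Set.inter_comm, ← P.proj_union (hC.inter hB) (hC.diff hB) Set.disjoint_sdiff_inter.symm,
      Set.inter_union_sdiff]
  rw [h2, mul_add, P.proj_mul_of_disjoint hB (hC.diff hB) Set.disjoint_sdiff_right, add_zero, h1,
    add_mul, P.proj_mul_of_disjoint (hB.diff hC) (hB.inter hC)
      Set.disjoint_sdiff_inter, add_zero]
  exact (P.isStarProjection _ (hB.inter hC)).isIdempotentElem.symm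

theorem proj_proj_inter (hB : MeasurableSet B) (hC : MeasurableSet C) (x : E) :
    P.proj B (P.proj C x) = P.proj (B ∩ C) x := by
  rw [P.proj_inter hB hC]; rfl

theorem scalarMeasure_proj (hB : MeasurableSet B) (x : E) :
    P.scalarMeasure (P.proj B x) = (P.scalarMeasure x).restrict B := by
  refine Measure.ext fun C hC => ?_
  rw [Measure.restrict_apply hC, P.scalarMeasure_apply _ hC, P.scalarMeasure_apply _ (hC.inter hB),
    P.proj_proj_inter hC hB]

/-! ### The integral of bounded functions -/

theorem exists_integral_simpleFunc (f : SimpleFunc Ω ℂ) :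
    ∃ T : E →L[ℂ] E, ∀ x, ⟪x, T x⟫ = ∫ ω, f ω ∂P.scalarMeasure x := by
  refine ⟨∑ c ∈ f.range, c • P.proj (f ⁻¹' {c}), fun x => ?_⟩
  rw [SimpleFunc.integral_eq_sum _ ((IsBddMeasurable.simpleFunc f).integrable _),
    sum_apply, inner_sum]
  refine Finset.sum_congr rfl fun c _ => ?_
  rw [smul_apply, inner_smul_right, P.inner_proj x (f.measurableSet_fiber c),
    Complex.real_smul, mul_comm]

/-- Convergence of quadratic forms suffices to produce a bounded operator, so uniformly bounded
simple functions converging pointwise do the job. -/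
theorem exists_integral {f : Ω → ℂ} (hf : IsBddMeasurable f) :
    ∃ T : E →L[ℂ] E, ∀ x, ⟪x, T x⟫ = ∫ ω, f ω ∂P.scalarMeasure x := by
  obtain ⟨s, C, hC, hs⟩ := hf.exists_simpleFunc
  choose T hT using fun n => P.exists_integral_simpleFunc (s n)
  refine exists_clm_of_tendsto_inner_self (T := T) fun x => ?_
  simp only [hT]
  exact tendsto_integral_of_bounded _ (fun n => (s n).measurable) hC hs

open Classical in
/-- The operator `∫ f dP` for a bounded measurable function `f`. -/
def integral (f : Ω → ℂ) : E →L[ℂ] E :=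
  if h : ∃ T : E →L[ℂ] E, ∀ x, ⟪x, T x⟫ = ∫ ω, f ω ∂P.scalarMeasure x then h.choose else 0

variable {f g : Ω → ℂ}

theorem inner_integral_self (hf : IsBddMeasurable f) (x : E) :
    ⟪x, P.integral f x⟫ = ∫ ω, f ω ∂P.scalarMeasure x := by
  rw [integral, dif_pos (P.exists_integral hf)]
  exact (P.exists_integral hf).choose_spec x

theorem integral_eq_of_inner (hf : IsBddMeasurable f) {T : E →L[ℂ] E}
    (h : ∀ x, ⟪x, T x⟫ = ∫ ω, f ω ∂P.scalarMeasure x) : P.integral f = T :=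
  clm_ext_inner_self fun x => by rw [P.inner_integral_self hf, h]

theorem integral_add (hf : IsBddMeasurable f) (hg : IsBddMeasurable g) :
    P.integral (fun ω => f ω + g ω) = P.integral f + P.integral g := by
  refine P.integral_eq_of_inner (hf.add hg) fun x => ?_
  rw [add_apply, inner_add_right, P.inner_integral_self hf,
    P.inner_integral_self hg, MeasureTheory.integral_add (hf.integrable _) (hg.integrable _)]

theorem integral_const_mul (c : ℂ) (hf : IsBddMeasurable f) :
    P.integral (fun ω => c * f ω) = c • P.integral f := by
  refine P.integral_eq_of_inner (hf.const_mul c) fun x => ?_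
  rw [smul_apply, inner_smul_right, P.inner_integral_self hf,
    MeasureTheory.integral_const_mul]

theorem integral_sub (hf : IsBddMeasurable f) (hg : IsBddMeasurable g) :
    P.integral (fun ω => f ω - g ω) = P.integral f - P.integral g := by
  refine P.integral_eq_of_inner (hf.sub hg) fun x => ?_
  rw [sub_apply, inner_sub_right, P.inner_integral_self hf,
    P.inner_integral_self hg, MeasureTheory.integral_sub (hf.integrable _) (hg.integrable _)]

theorem integral_conj (hf : IsBddMeasurable f) :
    P.integral (fun ω => starRingEnd ℂ (f ω)) = ContinuousLinearMap.adjoint (P.integral f) := by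
  refine P.integral_eq_of_inner hf.conj fun x => ?_
  rw [ContinuousLinearMap.adjoint_inner_right, ← inner_conj_symm, P.inner_integral_self hf,
    _root_.integral_conj]

theorem integral_indicator_one (hB : MeasurableSet B) :
    P.integral (B.indicator fun _ => (1 : ℂ)) = P.proj B := by
  refine P.integral_eq_of_inner (.indicator_one hB) fun x => ?_
  rw [P.inner_proj x hB, MeasureTheory.integral_indicator_const _ hB]
  simp

theorem integral_const (c : ℂ) : P.integral (fun _ => c) = c • 1 := by
  refine P.integral_eq_of_inner (.const c) fun x => ?_
  rw [MeasureTheory.integral_const, P.scalarMeasure_real_univ, smul_apply,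
    inner_smul_right, one_apply_eq_self, inner_self_eq_norm_sq_to_K, Complex.real_smul,
    mul_comm]
  push_cast
  rfl

theorem tendsto_inner_integral {s : ℕ → Ω → ℂ} {C : ℝ} (hs : ∀ n, Measurable (s n))
    (hC : ∀ n ω, ‖s n ω‖ ≤ C) (hf : IsBddMeasurable f)
    (h : ∀ ω, Tendsto (fun n => s n ω) atTop (𝓝 (f ω))) (x y : E) :
    Tendsto (fun n => ⟪x, P.integral (s n) y⟫) atTop (𝓝 ⟪x, P.integral f y⟫) := by
  refine tendsto_inner_of_tendsto_inner_self (fun x => ?_) x y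
  simp only [P.inner_integral_self hf, P.inner_integral_self ⟨hs _, C, hC _⟩]
  exact tendsto_integral_of_bounded _ hs hC h

theorem integral_simpleFunc (s : SimpleFunc Ω ℂ) :
    P.integral s = ∑ c ∈ s.range, c • P.proj (s ⁻¹' {c}) := by
  refine P.integral_eq_of_inner (.simpleFunc s) fun x => ?_
  rw [SimpleFunc.integral_eq_sum _ ((IsBddMeasurable.simpleFunc s).integrable _),
    sum_apply, inner_sum]
  refine Finset.sum_congr rfl fun c _ => ?_
  rw [smul_apply, inner_smul_right, P.inner_proj x (s.measurableSet_fiber c),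
    Complex.real_smul, mul_comm]

/-- A bounded operator intertwining two projection-valued measures intertwines the integrals. -/
theorem integral_intertwine {F : Type*} [NormedAddCommGroup F] [InnerProductSpace ℂ F]
    [CompleteSpace F] (Q : PVMeasure Ω F) (X : E →L[ℂ] F) (hf : IsBddMeasurable f)
    (h : ∀ B, MeasurableSet B → ∀ x, X (P.proj B x) = Q.proj B (X x)) (x : E) :
    X (P.integral f x) = Q.integral f (X x) := by
  obtain ⟨s, C, hC, hs⟩ := hf.exists_simpleFunc
  refine ext_inner_left ℂ fun y => ?_
  refine tendsto_nhds_unique (f := fun n => ⟪y, X (P.integral (s n) x)⟫) (l := atTop) ?_ ?_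
  · simp only [← ContinuousLinearMap.adjoint_inner_left X]
    exact P.tendsto_inner_integral (fun n => (s n).measurable) hC hf hs _ _
  · have := Q.tendsto_inner_integral (fun n => (s n).measurable) hC hf hs y (X x)
    refine this.congr fun n => ?_
    rw [P.integral_simpleFunc, Q.integral_simpleFunc]
    simp only [sum_apply, smul_apply, map_sum, map_smul]
    simp only [h _ ((s n).measurableSet_fiber _)]

theorem proj_comm (hB : MeasurableSet B) (hC : MeasurableSet C) (x : E) :
    P.proj B (P.proj C x) = P.proj C (P.proj B x) := by
  rw [P.proj_proj_inter hB hC, P.proj_proj_inter hC hB, Set.inter_comm]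

theorem proj_integral_comm (hB : MeasurableSet B) (hf : IsBddMeasurable f) (x : E) :
    P.proj B (P.integral f x) = P.integral f (P.proj B x) :=
  P.integral_intertwine P (P.proj B) hf (fun _ hC x => P.proj_comm hB hC x) x

theorem integral_proj (hB : MeasurableSet B) (hf : IsBddMeasurable f) (x : E) :
    P.integral f (P.proj B x) = P.integral (B.indicator f) x := by
  have : P.integral (B.indicator f) = P.integral f * P.proj B := by
    refine P.integral_eq_of_inner (hf.indicator hB) fun x => ?_
    rw [mul_apply_eq_comp, ← P.proj_proj hB, ← P.proj_integral_comm hB hf,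
      ← P.inner_proj_left hB, P.inner_integral_self hf, P.scalarMeasure_proj hB,
      MeasureTheory.integral_indicator hB]
  rw [this]
  rfl

/-- A weak limit in `g` reduces the claim to simple functions, hence to one indicator factor, which
is `integral_proj`. -/
theorem integral_mul (hf : IsBddMeasurable f) (hg : IsBddMeasurable g) :
    P.integral (fun ω => f ω * g ω) = P.integral f * P.integral g := by
  obtain ⟨D, hD⟩ := hf.bdd
  obtain ⟨s, C, hC, hs⟩ := hg.exists_simpleFunc
  refine ContinuousLinearMap.ext fun x => ext_inner_left ℂ fun y => ?_
  refine tendsto_nhds_unique (f := fun n => ⟪y, P.integral f (P.integral (s n) x)⟫) (l := atTop)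
    ?_ ?_
  · refine (P.tendsto_inner_integral (s := fun n ω => f ω * s n ω) (C := D * C)
      (fun n => hf.1.mul (s n).measurable) (fun n ω => ?_) (hf.mul hg)
      (fun ω => (hs ω).const_mul _) y x).congr fun n => ?_
    · rw [norm_mul]
      exact mul_le_mul (hD ω) (hC n ω) (norm_nonneg _) ((norm_nonneg _).trans (hD ω))
    · congr 1
      rw [P.integral_simpleFunc]
      simp only [sum_apply, smul_apply, map_sum, map_smul,
        P.integral_proj ((s n).measurableSet_fiber _) hf]
      have e : P.integral (fun ω => f ω * s n ω) =
          ∑ c ∈ (s n).range, c • P.integral ((s n ⁻¹' {c}).indicator f) := by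
        refine P.integral_eq_of_inner (hf.mul (.simpleFunc _)) fun x => ?_
        rw [sum_apply, inner_sum]
        simp only [smul_apply, inner_smul_right,
          P.inner_integral_self (hf.indicator ((s n).measurableSet_fiber _)),
          ← MeasureTheory.integral_const_mul]
        rw [← MeasureTheory.integral_finsetSum _ fun c _ =>
          ((hf.indicator ((s n).measurableSet_fiber c)).integrable _).const_mul c]
        congr 1
        ext ω
        rw [Finset.sum_eq_single (s n ω)]
        · simp [mul_comm]
        · intro c _ hc
          rw [Set.indicator_of_notMem (by simpa using hc.symm), mul_zero]
        · intro h
          exact absurd (SimpleFunc.mem_range_self _ _) h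
      rw [e]
      simp
  · simp only [← ContinuousLinearMap.adjoint_inner_left (P.integral f)]
    rw [mul_apply_eq_comp, ← ContinuousLinearMap.adjoint_inner_left (P.integral f)]
    exact P.tendsto_inner_integral (fun n => (s n).measurable) hC hg hs _ _

theorem integral_integral (hf : IsBddMeasurable f) (hg : IsBddMeasurable g) (x : E) :
    P.integral f (P.integral g x) = P.integral (fun ω => f ω * g ω) x := by
  rw [P.integral_mul hf hg]; rfl

theorem inner_integral_integral (hf : IsBddMeasurable f) (hg : IsBddMeasurable g) (x y : E) :
    ⟪P.integral f x, P.integral g y⟫ =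
      ⟪x, P.integral (fun ω => starRingEnd ℂ (f ω) * g ω) y⟫ := by
  rw [P.integral_mul hf.conj hg, P.integral_conj hf, mul_apply_eq_comp,
    ContinuousLinearMap.adjoint_inner_right]

/-- The integral is a ⋆-homomorphism, so the left side is the quadratic form of `|f|²`. This
identity turns norm limits of operators applied to `x` into scalar limits. -/
theorem norm_integral_sq (hf : IsBddMeasurable f) (x : E) :
    ‖P.integral f x‖ ^ 2 = ∫ ω, ‖f ω‖ ^ 2 ∂P.scalarMeasure x := by
  have h := P.inner_integral_integral hf hf x x
  rw [inner_self_eq_norm_sq_to_K, P.inner_integral_self (hf.conj.mul hf)] at h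
  simp only [Complex.conj_mul'] at h
  have e : (∫ ω, ((‖f ω‖ : ℂ) ^ 2) ∂P.scalarMeasure x) =
      ((∫ ω, ‖f ω‖ ^ 2 ∂P.scalarMeasure x : ℝ) : ℂ) := by
    rw [← integral_complex_ofReal]
    push_cast
    rfl
  rw [e] at h
  exact Complex.ofReal_injective (by simpa using h)

theorem norm_integral_le {C : ℝ} (hC0 : 0 ≤ C) (hf : Measurable f) (hC : ∀ ω, ‖f ω‖ ≤ C) :
    ‖P.integral f‖ ≤ C := by
  refine ContinuousLinearMap.opNorm_le_bound _ hC0 fun x => ?_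
  refine le_of_sq_le_sq ?_ (by positivity)
  have hf' : IsBddMeasurable f := ⟨hf, C, hC⟩
  rw [P.norm_integral_sq hf', mul_pow, ← P.scalarMeasure_real_univ x, mul_comm, ← smul_eq_mul,
    ← MeasureTheory.integral_const]
  refine integral_mono_of_nonneg (Eventually.of_forall fun ω => sq_nonneg _) (integrable_const _)
    (Eventually.of_forall fun ω => ?_)
  exact pow_le_pow_left₀ (norm_nonneg _) (hC ω) 2

/-- The integral only depends on the values almost everywhere. -/
theorem integral_congr_ae (hf : IsBddMeasurable f) (hg : IsBddMeasurable g) {x : E}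
    (h : f =ᵐ[P.scalarMeasure x] g) : P.integral f x = P.integral g x := by
  have h1 := P.norm_integral_sq (hf.sub hg) x
  rw [P.integral_sub hf hg, MeasureTheory.integral_eq_zero_of_ae] at h1
  · simpa [sub_eq_zero] using h1
  · filter_upwards [h] with ω hω
    simp [hω]

theorem tendsto_integral {s : ℕ → Ω → ℂ} {C : ℝ} (hs : ∀ n, Measurable (s n))
    (hC : ∀ n ω, ‖s n ω‖ ≤ C) (hf : IsBddMeasurable f)
    (h : ∀ ω, Tendsto (fun n => s n ω) atTop (𝓝 (f ω))) (x : E) :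
    Tendsto (fun n => P.integral (s n) x) atTop (𝓝 (P.integral f x)) := by
  obtain ⟨D, hD⟩ := hf.bdd
  rw [tendsto_iff_norm_sub_tendsto_zero]
  have h2 : Tendsto (fun n => ‖P.integral (s n) x - P.integral f x‖ ^ 2) atTop (𝓝 0) := by
    have e : ∀ n, ‖P.integral (s n) x - P.integral f x‖ ^ 2 =
        ∫ ω, ‖s n ω - f ω‖ ^ 2 ∂P.scalarMeasure x := fun n => by
      have hsn : IsBddMeasurable (s n) := ⟨hs n, C, hC n⟩
      rw [← P.norm_integral_sq (hsn.sub hf), P.integral_sub hsn hf]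
      rfl
    simp only [e]
    rw [← MeasureTheory.integral_zero Ω ℝ (μ := P.scalarMeasure x)]
    refine tendsto_integral_of_dominated_convergence (fun _ => (C + D) ^ 2) (fun n => ?_)
      (integrable_const _) (fun n => Eventually.of_forall fun ω => ?_)
      (Eventually.of_forall fun ω => ?_)
    · exact (((hs n).sub hf.1).norm.pow_const 2).aestronglyMeasurable
    · rw [Real.norm_of_nonneg (sq_nonneg _)]
      exact pow_le_pow_left₀ (norm_nonneg _)
        ((norm_sub_le _ _).trans (add_le_add (hC n ω) (hD ω))) 2
    · simpa using (((h ω).sub_const (f ω)).norm).pow 2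
  have := h2.sqrt
  simpa using this

/-- Continuity from below along an exhausting sequence. -/
theorem tendsto_proj {s : ℕ → Set Ω} (hs : ∀ n, MeasurableSet (s n))
    (h : ∀ ω, ∀ᶠ n in atTop, ω ∈ s n) (x : E) :
    Tendsto (fun n => P.proj (s n) x) atTop (𝓝 x) := by
  have := P.tendsto_integral (s := fun n => (s n).indicator fun _ => (1 : ℂ)) (C := 1)
    (fun n => (IsBddMeasurable.indicator_one (hs n)).1)
    (fun n ω => (norm_indicator_le_norm_self _ _).trans (by simp)) (.const 1) (fun ω => ?_) x
  · simpa [P.integral_indicator_one (hs _), P.integral_const] using this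
  · refine tendsto_const_nhds.congr' ?_
    filter_upwards [h ω] with n hn
    simp [hn]

theorem ae_eq_zero_of_integral_eq_zero {f : Ω → ℂ} (hf : IsBddMeasurable f) {x : E}
    (h : P.integral f x = 0) : ∀ᵐ ω ∂P.scalarMeasure x, f ω = 0 := by
  have h1 := P.norm_integral_sq hf x
  rw [h, norm_zero, zero_pow two_ne_zero, eq_comm,
    integral_eq_zero_iff_of_nonneg (fun _ => sq_nonneg _)] at h1
  · filter_upwards [h1] with z hz'
    simpa using hz'
  · obtain ⟨C, hC⟩ := hf.bdd
    refine Integrable.of_bound (C := C ^ 2) ((hf.1.norm.pow_const 2).aestronglyMeasurable)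
      (Eventually.of_forall fun z => ?_)
    rw [Real.norm_of_nonneg (sq_nonneg _)]
    exact pow_le_pow_left₀ (norm_nonneg _) (hC z) 2

/-- The spectral projection of the zero set of `f` maps into the kernel of `P.integral f`. -/
theorem ae_ne_zero_of_injective {f : Ω → ℂ} (hf : IsBddMeasurable f)
    (h : ∀ v, P.integral f v = 0 → v = 0) (x : E) : ∀ᵐ ω ∂P.scalarMeasure x, f ω ≠ 0 := by
  have hB : MeasurableSet {z | f z = 0} := hf.1 (measurableSet_singleton 0)
  have h0 : P.integral f (P.proj {z | f z = 0} x) = 0 := by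
    rw [P.integral_proj hB hf]
    have : ({z | f z = 0}.indicator f) = fun _ => 0 := by
      ext z
      by_cases h : f z = 0 <;> simp [Set.indicator, h]
    rw [this, P.integral_const, zero_smul]
    rfl
  rw [ae_iff]
  simpa using (P.proj_apply_eq_zero_iff x hB).1 (h _ h0)

/-- The hypothesis is tested on the projection of `x` to the set where the real part is negative:
the integral of a negative function is then nonnegative, so the set is null. -/
theorem ae_re_nonneg_of_inner_nonneg {f : Ω → ℂ} (hf : IsBddMeasurable f)
    (h : ∀ v, 0 ≤ (⟪v, P.integral f v⟫).re) (x : E) :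
    ∀ᵐ ω ∂P.scalarMeasure x, 0 ≤ (f ω).re := by
  have hm : Measurable fun ω => (f ω).re := Complex.measurable_re.comp hf.1
  have hB : MeasurableSet {ω | (f ω).re < 0} := hm measurableSet_Iio
  have h1 := h (P.proj {ω | (f ω).re < 0} x)
  rw [P.inner_integral_self hf, P.scalarMeasure_proj hB] at h1
  have h2 : (∫ ω in {ω | (f ω).re < 0}, f ω ∂P.scalarMeasure x).re =
      ∫ ω in {ω | (f ω).re < 0}, (f ω).re ∂P.scalarMeasure x :=
    (integral_re (hf.integrable _)).symm
  rw [h2] at h1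
  have h3 : ∀ᵐ ω ∂(P.scalarMeasure x).restrict {ω | (f ω).re < 0}, (f ω).re < 0 :=
    ae_restrict_mem hB
  have h4 : 0 ≤ᵐ[(P.scalarMeasure x).restrict {ω | (f ω).re < 0}] fun ω => -(f ω).re := by
    filter_upwards [h3] with ω hω
    simpa using hω.le
  have h5 : ∫ ω in {ω | (f ω).re < 0}, -(f ω).re ∂P.scalarMeasure x = 0 := by
    refine le_antisymm ?_ (integral_nonneg_of_ae h4)
    rw [MeasureTheory.integral_neg]
    linarith
  rw [integral_eq_zero_iff_of_nonneg_ae h4 (hf.integrable _).re.neg] at h5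
  have h6 : ∀ᵐ ω ∂(P.scalarMeasure x).restrict {ω | (f ω).re < 0}, False := by
    filter_upwards [h3, h5] with ω h7 h8
    have : -(f ω).re = 0 := h8
    linarith
  rw [ae_restrict_iff' hB] at h6
  filter_upwards [h6] with ω hω
  exact not_lt.1 hω

end PVMeasure

/-! ### The spectral theorem for representations of `C(X, ℂ)` -/

theorem hasSum_measureReal_iUnion {Ω : Type*} [MeasurableSpace Ω] (μ : Measure Ω)
    [IsFiniteMeasure μ] {B : ℕ → Set Ω} (hB : ∀ i, MeasurableSet (B i))
    (hd : Pairwise (Function.onFun Disjoint B)) :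
    HasSum (fun i => μ.real (B i)) (μ.real (⋃ i, B i)) := by
  have h := measure_iUnion (μ := μ) hd hB
  have h2 := ENNReal.hasSum_toReal (f := fun i => μ (B i)) (by rw [← h]; finiteness)
  rwa [← ENNReal.tsum_toReal_eq (fun i => by finiteness), ← h] at h2

namespace StarAlgHom

variable {X : Type*} [TopologicalSpace X] [CompactSpace X] [T2Space X] [MeasurableSpace X]
  [BorelSpace X] {E : Type*} [NormedAddCommGroup E] [InnerProductSpace ℂ E] [CompleteSpace E]
  (Φ : C(X, ℂ) →⋆ₐ[ℂ] (E →L[ℂ] E))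

theorem inner_map_map (f g : C(X, ℂ)) (x y : E) : ⟪Φ f x, Φ g y⟫ = ⟪x, Φ (star f * g) y⟫ := by
  rw [map_mul, map_star, mul_apply_eq_comp, ContinuousLinearMap.star_eq_adjoint,
    ContinuousLinearMap.adjoint_inner_right]

theorem inner_map_conj (f : C(X, ℂ)) (x : E) :
    ⟪x, Φ (star f) x⟫ = starRingEnd ℂ ⟪x, Φ f x⟫ := by
  rw [map_star, ContinuousLinearMap.star_eq_adjoint, ContinuousLinearMap.adjoint_inner_right,
    inner_conj_symm]

/-- A real continuous function as a complex one. -/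
def realToComplex (f : C(X, ℝ)) : C(X, ℂ) := ⟨fun t => (f t : ℂ), by fun_prop⟩

/-- The positive functional `f ↦ ⟪x, Φ(f) x⟫`. -/
def stateFunctional (x : E) : CompactlySupportedContinuousMap X ℝ →ₚ[ℝ] ℝ :=
  PositiveLinearMap.mk₀
    { toFun := fun f => (⟪x, Φ (realToComplex f.toContinuousMap) x⟫).re
      map_add' := fun f g => by
        have : realToComplex (f + g).toContinuousMap =
            realToComplex f.toContinuousMap + realToComplex g.toContinuousMap := by
          ext t; simp [realToComplex]
        rw [this, map_add, add_apply, inner_add_right, Complex.add_re]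
      map_smul' := fun c f => by
        have : realToComplex (c • f).toContinuousMap =
            (c : ℂ) • realToComplex f.toContinuousMap := by
          ext t; simp [realToComplex]
        rw [this, map_smul, smul_apply, inner_smul_right]
        simp }
    (by
      intro f hf
      let g : C(X, ℂ) := realToComplex ⟨fun t => Real.sqrt (f t), by fun_prop⟩
      have e : realToComplex f.toContinuousMap = star g * g := by
        ext t
        have h0 : 0 ≤ f t := hf t
        have : Real.sqrt (f t) * Real.sqrt (f t) = f t := Real.mul_self_sqrt h0
        simp [g, realToComplex, ← Complex.ofReal_mul, this]
      change 0 ≤ (⟪x, Φ (realToComplex f.toContinuousMap) x⟫).re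
      rw [e, ← inner_map_map, inner_self_eq_norm_sq_to_K, ← RCLike.ofReal_pow]
      exact sq_nonneg _)

/-- The measure representing `f ↦ ⟪x, Φ(f) x⟫`. -/
def stateMeasure (x : E) : Measure X := RealRMK.rieszMeasure (stateFunctional Φ x)

instance (x : E) : IsFiniteMeasure (stateMeasure Φ x) := by
  unfold stateMeasure; infer_instance

theorem integral_stateMeasure_real (f : C(X, ℝ)) (x : E) :
    ((∫ t, f t ∂stateMeasure Φ x : ℝ) : ℂ) = ⟪x, Φ (realToComplex f) x⟫ := by
  have h := RealRMK.integral_rieszMeasure (stateFunctional Φ x)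
    ⟨f, HasCompactSupport.of_compactSpace _⟩
  have h2 : ∫ t, f t ∂stateMeasure Φ x = (⟪x, Φ (realToComplex f) x⟫).re := h
  rw [h2]
  refine Complex.conj_eq_iff_re.1 ?_
  rw [← inner_map_conj]
  congr 3
  ext t
  simp [realToComplex]

theorem continuousMap_integrable (f : C(X, ℂ)) (μ : Measure X) [IsFiniteMeasure μ] :
    Integrable f μ :=
  (BoundedContinuousFunction.mkOfCompact f).integrable μ

theorem isBddMeasurable_continuousMap (f : C(X, ℂ)) : IsBddMeasurable f :=
  ⟨f.continuous.measurable, ‖f‖, f.norm_coe_le_norm⟩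

theorem integral_stateMeasure (f : C(X, ℂ)) (x : E) :
    ∫ t, f t ∂stateMeasure Φ x = ⟪x, Φ f x⟫ := by
  let u : C(X, ℝ) := ⟨fun t => (f t).re, by fun_prop⟩
  let v : C(X, ℝ) := ⟨fun t => (f t).im, by fun_prop⟩
  have e : f = realToComplex u + Complex.I • realToComplex v := by
    ext t
    simp [realToComplex, u, v, mul_comm Complex.I]
  have h := integral_re_add_im (continuousMap_integrable f (stateMeasure Φ x))
  rw [← h]
  conv_rhs => rw [e, map_add, map_smul, add_apply, smul_apply, inner_add_right, inner_smul_right,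
    ← integral_stateMeasure_real, ← integral_stateMeasure_real]
  rw [mul_comm Complex.I]
  rfl

theorem stateMeasure_real_univ (x : E) :
    ((stateMeasure Φ x).real Set.univ : ℂ) = ⟪x, x⟫ := by
  have := integral_stateMeasure Φ 1 x
  simpa using this

variable [HasOuterApproxClosed X]

/-- Continuous approximation of the indicator of a closed set. -/
def closedApprox {C : Set X} (hC : IsClosed C) (n : ℕ) : C(X, ℂ) :=
  ⟨fun t => ((hC.apprSeq n t : ℝ) : ℂ), by fun_prop⟩

theorem norm_closedApprox_le {C : Set X} (hC : IsClosed C) (n : ℕ) (t : X) :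
    ‖closedApprox hC n t‖ ≤ 1 := by
  simpa [closedApprox] using HasOuterApproxClosed.apprSeq_apply_le_one hC n t

theorem tendsto_closedApprox {C : Set X} (hC : IsClosed C) (t : X) :
    Tendsto (fun n => closedApprox hC n t) atTop (𝓝 (C.indicator (fun _ => (1 : ℂ)) t)) := by
  have h := (tendsto_pi_nhds.1 (HasOuterApproxClosed.tendsto_apprSeq hC) t)
  have h2 := (Complex.continuous_ofReal.comp NNReal.continuous_coe).continuousAt.tendsto.comp h
  have e : ((Complex.ofReal ∘ NNReal.toReal) (C.indicator (fun _ => 1) t)) =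
      C.indicator (fun _ => (1 : ℂ)) t := by
    by_cases ht : t ∈ C <;> simp [ht]
  rw [e] at h2
  exact h2

theorem tendsto_setIntegral_closedApprox {C : Set X} (hC : IsClosed C) (B : Set X)
    (μ : Measure X) [IsFiniteMeasure μ] :
    Tendsto (fun n => ∫ t in B, closedApprox hC n t ∂μ) atTop (𝓝 (μ.real (C ∩ B) : ℂ)) := by
  have := tendsto_integral_of_bounded (μ.restrict B)
    (fun n => (closedApprox hC n).continuous.measurable) (norm_closedApprox_le hC)
    (tendsto_closedApprox hC)
  rw [integral_indicator_const _ hC.measurableSet, measureReal_restrict_apply hC.measurableSet]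
    at this
  simpa using this

/-- Indicators of closed sets are bounded pointwise limits of continuous functions, to which `Φ`
applies; complements and disjoint unions follow by Dynkin induction. -/
theorem exists_indicator (B : Set X) (hB : MeasurableSet B) :
    ∃ T : E →L[ℂ] E, ∀ x, ⟪x, T x⟫ = ((stateMeasure Φ x).real B : ℂ) := by
  refine MeasurableSpace.induction_on_inter
    (C := fun B _ => ∃ T : E →L[ℂ] E, ∀ x, ⟪x, T x⟫ = ((stateMeasure Φ x).real B : ℂ))
    ((BorelSpace.measurable_eq (α := X)).trans borel_eq_generateFrom_isClosed)
    isPiSystem_isClosed ?_ ?_ ?_ ?_ B hB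
  · exact ⟨0, fun x => by simp⟩
  · intro C (hC : IsClosed C)
    refine exists_clm_of_tendsto_inner_self (T := fun n => Φ (closedApprox hC n)) fun x => ?_
    have := tendsto_setIntegral_closedApprox hC Set.univ (stateMeasure Φ x)
    simpa [integral_stateMeasure] using this
  · rintro C hC ⟨T, hT⟩
    refine ⟨1 - T, fun x => ?_⟩
    rw [sub_apply, inner_sub_right, hT, one_apply_eq_self, ← stateMeasure_real_univ Φ,
      measureReal_compl hC]
    push_cast
    rfl
  · intro C hd hC h
    choose T hT using h
    refine exists_clm_of_tendsto_inner_self (T := fun n => ∑ i ∈ Finset.range n, T i) fun x => ?_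
    have h := (Complex.hasSum_ofReal.2
      (hasSum_measureReal_iUnion (stateMeasure Φ x) hC hd)).tendsto_sum_nat
    simpa [inner_sum, hT] using h

open Classical in
/-- The operator attached to the indicator function of a Borel set. -/
def indicatorOp (B : Set X) : E →L[ℂ] E :=
  if hB : MeasurableSet B then (exists_indicator Φ B hB).choose else 0

variable {B C : Set X}

theorem inner_indicatorOp (hB : MeasurableSet B) (x : E) :
    ⟪x, indicatorOp Φ B x⟫ = ((stateMeasure Φ x).real B : ℂ) := by
  rw [indicatorOp, dif_pos hB]
  exact (exists_indicator Φ B hB).choose_spec x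

theorem indicatorOp_adjoint (hB : MeasurableSet B) :
    ContinuousLinearMap.adjoint (indicatorOp Φ B) = indicatorOp Φ B := by
  refine clm_ext_inner_self fun x => ?_
  rw [ContinuousLinearMap.adjoint_inner_right, ← inner_conj_symm, inner_indicatorOp Φ hB,
    Complex.conj_ofReal]

/-- Both measures integrate a real continuous `f` to `⟪x, Φ(|h|² f) x⟫`, and finite measures are
determined by such integrals. It lets indicators be combined with continuous functions. -/
theorem stateMeasure_map (h : C(X, ℂ)) (x : E) : stateMeasure Φ (Φ h x) =
    (stateMeasure Φ x).withDensity fun t => ENNReal.ofReal (‖h t‖ ^ 2) := by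
  have hm : Measurable fun t => Real.toNNReal (‖h t‖ ^ 2) := by fun_prop
  have hfin : IsFiniteMeasure
      ((stateMeasure Φ x).withDensity fun t => ENNReal.ofReal (‖h t‖ ^ 2)) := by
    refine isFiniteMeasure_withDensity_ofReal ?_
    exact ((BoundedContinuousFunction.mkOfCompact
      (⟨fun t => ‖h t‖ ^ 2, by fun_prop⟩ : C(X, ℝ))).integrable (stateMeasure Φ x)).2
  refine ext_of_forall_integral_eq_of_IsFiniteMeasure fun f => ?_
  have h1 := integral_withDensity_eq_integral_smul (μ := stateMeasure Φ x) hm fun t => f t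
  refine Eq.trans ?_ h1.symm
  have h2 := integral_stateMeasure_real Φ f.toContinuousMap (Φ h x)
  have h3 := integral_stateMeasure_real Φ
    (⟨fun t => ‖h t‖ ^ 2 * f t, by fun_prop⟩ : C(X, ℝ)) x
  have h4 : ⟪Φ h x, Φ (realToComplex f.toContinuousMap) (Φ h x)⟫ =
      ⟪x, Φ (realToComplex (⟨fun t => ‖h t‖ ^ 2 * f t, by fun_prop⟩ : C(X, ℝ))) x⟫ := by
    rw [← mul_apply_eq_comp, ← map_mul, inner_map_map]
    congr 3
    ext t
    simp only [realToComplex, ContinuousMap.mul_apply, ContinuousMap.star_apply,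
      ContinuousMap.coe_mk, Complex.ofReal_mul, Complex.ofReal_pow, RCLike.star_def]
    rw [← Complex.conj_mul']
    change starRingEnd ℂ (h t) * ((f t : ℂ) * h t) = _
    ring
  rw [h4, ← h3] at h2
  refine (Complex.ofReal_injective h2).trans ?_
  congr 1
  ext t
  simp [NNReal.smul_def, Real.coe_toNNReal _ (sq_nonneg ‖h t‖)]

theorem inner_map_indicatorOp_map (hB : MeasurableSet B) (h : C(X, ℂ)) (x : E) :
    ⟪Φ h x, indicatorOp Φ B (Φ h x)⟫ = ∫ t in B, starRingEnd ℂ (h t) * h t ∂stateMeasure Φ x := by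
  let u : C(X, ℝ) := ⟨fun t => ‖h t‖ ^ 2, by fun_prop⟩
  have hi : Integrable (fun t => ‖h t‖ ^ 2) ((stateMeasure Φ x).restrict B) :=
    (BoundedContinuousFunction.mkOfCompact u).integrable _
  rw [inner_indicatorOp Φ hB, stateMeasure_map, measureReal_def, withDensity_apply _ hB,
    ← ofReal_integral_eq_lintegral_ofReal hi (Eventually.of_forall fun t => sq_nonneg _),
    ENNReal.toReal_ofReal (integral_nonneg fun t => sq_nonneg _), ← integral_complex_ofReal]
  congr 1
  ext t
  rw [Complex.conj_mul', Complex.ofReal_pow]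

/-- Polarisation of `inner_map_indicatorOp_map` along the functions `1 + c g` with `c = 1, -1, i,
-i`. -/
theorem inner_indicatorOp_map (hB : MeasurableSet B) (g : C(X, ℂ)) (x : E) :
    ⟪x, indicatorOp Φ B (Φ g x)⟫ = ∫ t in B, g t ∂stateMeasure Φ x := by
  have key : ∀ c : ℂ, ⟪x + c • Φ g x, indicatorOp Φ B (x + c • Φ g x)⟫ =
      ∫ t in B, starRingEnd ℂ (1 + c * g t) * (1 + c * g t) ∂stateMeasure Φ x := by
    intro c
    have := inner_map_indicatorOp_map Φ hB (1 + c • g) x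
    simpa using this
  have hp := inner_polarization (indicatorOp Φ B) x (Φ g x)
  have k1 := key 1
  have k2 := key (-1)
  have k3 := key Complex.I
  have k4 := key (-Complex.I)
  simp only [one_smul, neg_smul, ← sub_eq_add_neg] at k1 k2 k3 k4
  rw [k1, k2, k3, k4, ← integral_sub, ← integral_const_mul, ← integral_sub, ← integral_const_mul,
    ← integral_add, ← integral_div] at hp
  · rw [hp]
    congr 1
    ext t
    simp only [map_add, map_mul, map_one, map_neg, Complex.conj_I]
    linear_combination ((1 / 2) * starRingEnd ℂ (g t) - (1 / 2) * g t) * Complex.I_mul_I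
  all_goals
    refine IsBddMeasurable.integrable ?_ _
    have hg := isBddMeasurable_continuousMap g
    have h1 : ∀ c : ℂ, IsBddMeasurable fun t => starRingEnd ℂ (1 + c * g t) * (1 + c * g t) :=
      fun c => ((IsBddMeasurable.const 1).add (hg.const_mul c)).conj.mul
        ((IsBddMeasurable.const 1).add (hg.const_mul c))
    first
      | exact h1 _
      | exact (h1 _).const_mul _
      | exact (h1 _).sub (h1 _)
      | exact ((h1 _).sub (h1 _)).sub ((h1 _).const_mul _)

theorem tendsto_inner_closedApprox (hC : IsClosed C) (x y : E) :
    Tendsto (fun n => ⟪x, Φ (closedApprox hC n) y⟫) atTop (𝓝 ⟪x, indicatorOp Φ C y⟫) := by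
  refine tendsto_inner_of_tendsto_inner_self (fun x => ?_) x y
  rw [inner_indicatorOp Φ hC.measurableSet]
  have := tendsto_setIntegral_closedApprox hC Set.univ (stateMeasure Φ x)
  simpa [integral_stateMeasure] using this

theorem tendsto_inner_sum_indicatorOp {C : ℕ → Set X} (hC : ∀ i, MeasurableSet (C i))
    (hd : Pairwise (Function.onFun Disjoint C)) (x y : E) :
    Tendsto (fun n => ⟪x, (∑ i ∈ Finset.range n, indicatorOp Φ (C i)) y⟫) atTop
      (𝓝 ⟪x, indicatorOp Φ (⋃ i, C i) y⟫) := by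
  refine tendsto_inner_of_tendsto_inner_self (fun x => ?_) x y
  rw [inner_indicatorOp Φ (MeasurableSet.iUnion hC)]
  have h := (Complex.hasSum_ofReal.2
    (hasSum_measureReal_iUnion (stateMeasure Φ x) hC hd)).tendsto_sum_nat
  simpa [inner_sum, inner_indicatorOp Φ (hC _)] using h

theorem indicatorOp_univ : indicatorOp Φ Set.univ = 1 :=
  clm_ext_inner_self fun x => by
    rw [inner_indicatorOp Φ MeasurableSet.univ, stateMeasure_real_univ]; rfl

theorem indicatorOp_union (hB : MeasurableSet B) (hC : MeasurableSet C) (hd : Disjoint B C) :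
    indicatorOp Φ (B ∪ C) = indicatorOp Φ B + indicatorOp Φ C := by
  refine clm_ext_inner_self fun x => ?_
  rw [add_apply, inner_add_right, inner_indicatorOp Φ (hB.union hC),
    inner_indicatorOp Φ hB, inner_indicatorOp Φ hC, measureReal_union hd hC]
  push_cast
  rfl

theorem indicatorOp_compl (hB : MeasurableSet B) :
    indicatorOp Φ Bᶜ = 1 - indicatorOp Φ B := by
  have := indicatorOp_union Φ hB hB.compl disjoint_compl_right
  rw [Set.union_compl_self, indicatorOp_univ] at this
  rw [this, add_sub_cancel_left]

/-- Multiplicativity of the indicator operators, by Dynkin induction in `C`. For closed `C` it is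
the limit of `inner_indicatorOp_map` along the continuous approximations. -/
theorem inner_indicatorOp_indicatorOp (hB : MeasurableSet B) (hC : MeasurableSet C) (x : E) :
    ⟪x, indicatorOp Φ B (indicatorOp Φ C x)⟫ = ((stateMeasure Φ x).real (C ∩ B) : ℂ) := by
  have ad : ∀ y, ⟪x, indicatorOp Φ B y⟫ = ⟪indicatorOp Φ B x, y⟫ := fun y => by
    rw [← ContinuousLinearMap.adjoint_inner_right, indicatorOp_adjoint Φ hB]
  refine MeasurableSpace.induction_on_inter
    (C := fun C _ => ⟪x, indicatorOp Φ B (indicatorOp Φ C x)⟫ =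
      ((stateMeasure Φ x).real (C ∩ B) : ℂ))
    ((BorelSpace.measurable_eq (α := X)).trans borel_eq_generateFrom_isClosed)
    isPiSystem_isClosed ?_ ?_ ?_ ?_ C hC
  · have : indicatorOp Φ (∅ : Set X) = 0 := by
      have := indicatorOp_compl Φ (MeasurableSet.univ (α := X))
      rwa [Set.compl_univ, indicatorOp_univ, sub_self] at this
    simp [this]
  · intro C (hC : IsClosed C)
    have h1 := tendsto_inner_closedApprox Φ hC (indicatorOp Φ B x) x
    simp only [← ad, inner_indicatorOp_map Φ hB] at h1
    exact tendsto_nhds_unique h1 (tendsto_setIntegral_closedApprox hC B _)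
  · intro C hC h
    rw [indicatorOp_compl Φ hC, sub_apply, map_sub, inner_sub_right, h, one_apply_eq_self,
      inner_indicatorOp Φ hB, sub_eq_iff_eq_add, ← Complex.ofReal_add, add_comm,
      Set.inter_comm C, Set.inter_comm Cᶜ, ← Set.sdiff_eq, measureReal_inter_add_sdiff hC]
  · intro C hd hC h
    have h1 := tendsto_inner_sum_indicatorOp Φ hC hd (indicatorOp Φ B x) x
    simp only [← ad, sum_apply, map_sum, inner_sum, h] at h1
    have h2 := (Complex.hasSum_ofReal.2 (hasSum_measureReal_iUnion (stateMeasure Φ x)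
      (B := fun i => C i ∩ B) (fun i => (hC i).inter hB)
      (fun i j hij => (hd hij).mono Set.inter_subset_left Set.inter_subset_left))).tendsto_sum_nat
    rw [← Set.iUnion_inter] at h2
    exact tendsto_nhds_unique h1 h2

theorem indicatorOp_isStarProjection (hB : MeasurableSet B) :
    IsStarProjection (indicatorOp Φ B) := by
  refine ⟨clm_ext_inner_self fun x => ?_, indicatorOp_adjoint Φ hB⟩
  rw [mul_apply_eq_comp, inner_indicatorOp_indicatorOp Φ hB hB, inner_indicatorOp Φ hB,
    Set.inter_self]

theorem norm_indicatorOp_sq (hB : MeasurableSet B) (x : E) :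
    ‖indicatorOp Φ B x‖ ^ 2 = (stateMeasure Φ x).real B := by
  have h := inner_indicatorOp_indicatorOp Φ hB hB x
  rw [← ContinuousLinearMap.adjoint_inner_left, indicatorOp_adjoint Φ hB,
    inner_self_eq_norm_sq_to_K, Set.inter_self] at h
  exact Complex.ofReal_injective (by simpa using h)

theorem hasSum_indicatorOp {B : ℕ → Set X} (hB : ∀ i, MeasurableSet (B i))
    (hd : Pairwise (Function.onFun Disjoint B)) (x : E) :
    HasSum (fun i => indicatorOp Φ (B i) x) (indicatorOp Φ (⋃ i, B i) x) := by
  have hU := MeasurableSet.iUnion hB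
  -- The remainder is the indicator operator of what the finite union leaves out, so its norm is the
  -- square root of a measure tending to zero.
  have hfin : ∀ s : Finset ℕ, ‖∑ i ∈ s, indicatorOp Φ (B i) x - indicatorOp Φ (⋃ i, B i) x‖ =
      Real.sqrt ((stateMeasure Φ x).real (⋃ i, B i) - ∑ i ∈ s, (stateMeasure Φ x).real (B i)) := by
    intro s
    have hD : MeasurableSet (⋃ i ∈ s, B i) := Finset.measurableSet_biUnion _ fun i _ => hB i
    have hpd : ((s : Set ℕ)).PairwiseDisjoint B := fun i _ j _ hij => hd hij
    have e1 : ∑ i ∈ s, indicatorOp Φ (B i) = indicatorOp Φ (⋃ i ∈ s, B i) := by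
      refine clm_ext_inner_self fun y => ?_
      rw [inner_indicatorOp Φ hD, measureReal_biUnion_finset hpd (fun i _ => hB i), sum_apply,
        inner_sum]
      simp [inner_indicatorOp Φ (hB _)]
    have hsub : ⋃ i ∈ s, B i ⊆ ⋃ i, B i := Set.iUnion₂_subset_iUnion _ _
    have e2 : indicatorOp Φ (⋃ i, B i) =
        indicatorOp Φ (⋃ i ∈ s, B i) + indicatorOp Φ ((⋃ i, B i) \ ⋃ i ∈ s, B i) := by
      rw [← indicatorOp_union Φ hD (hU.diff hD) Set.disjoint_sdiff_right, Set.union_sdiff_cancel hsub]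
    rw [← sum_apply, e1, e2, add_apply, sub_add_cancel_left, norm_neg,
      ← measureReal_biUnion_finset hpd (fun i _ => hB i), ← measureReal_sdiff hsub hD,
      ← norm_indicatorOp_sq Φ (hU.diff hD), Real.sqrt_sq (norm_nonneg _)]
  have h := hasSum_measureReal_iUnion (stateMeasure Φ x) hB hd
  rw [HasSum, tendsto_iff_norm_sub_tendsto_zero]
  simp only [hfin]
  have h2 : Tendsto (fun s : Finset ℕ => (stateMeasure Φ x).real (⋃ i, B i) -
      ∑ i ∈ s, (stateMeasure Φ x).real (B i)) (SummationFilter.unconditional ℕ).filter (𝓝 0) := by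
    simpa using (tendsto_const_nhds (x := (stateMeasure Φ x).real (⋃ i, B i))).sub h
  simpa using h2.sqrt

/-- The projection-valued measure of a representation of `C(X, ℂ)`. -/
def toPVMeasure : PVMeasure X E where
  proj := indicatorOp Φ
  isStarProjection _ hB := indicatorOp_isStarProjection Φ hB
  proj_univ := indicatorOp_univ Φ
  hasSum_iUnion _ hB hd x := hasSum_indicatorOp Φ hB hd x

theorem scalarMeasure_toPVMeasure (x : E) :
    (toPVMeasure Φ).scalarMeasure x = stateMeasure Φ x := by
  refine Measure.ext fun B hB => ?_
  rw [PVMeasure.scalarMeasure_apply _ _ hB]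
  change ENNReal.ofReal (‖indicatorOp Φ B x‖ ^ 2) = _
  rw [norm_indicatorOp_sq Φ hB, measureReal_def, ENNReal.ofReal_toReal (by finiteness)]

theorem integral_toPVMeasure (f : C(X, ℂ)) : (toPVMeasure Φ).integral f = Φ f := by
  refine PVMeasure.integral_eq_of_inner _ (isBddMeasurable_continuousMap f) fun x => ?_
  rw [scalarMeasure_toPVMeasure, integral_stateMeasure]

end StarAlgHom

/-! ### Spectral theorem for bounded normal operators -/

section Normal

variable {E : Type*} [NormedAddCommGroup E] [InnerProductSpace ℂ E] [CompleteSpace E]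

/-- The spectral measure of a bounded normal operator. -/
def normalPVMeasure (a : E →L[ℂ] E) (ha : IsStarNormal a) : PVMeasure (spectrum ℂ a) E :=
  (cfcHom ha : C(spectrum ℂ a, ℂ) →⋆ₐ[ℂ] (E →L[ℂ] E)).toPVMeasure

theorem integral_normalPVMeasure (a : E →L[ℂ] E) (ha : IsStarNormal a) :
    (normalPVMeasure a ha).integral (fun z => (z : ℂ)) = a := by
  refine Eq.trans ?_ (cfcHom_id (R := ℂ) ha)
  exact StarAlgHom.integral_toPVMeasure
    (cfcHom ha : C(spectrum ℂ a, ℂ) →⋆ₐ[ℂ] (E →L[ℂ] E))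
    (ContinuousMap.restrict (spectrum ℂ a) (ContinuousMap.id ℂ))

/-- The spectral theorem for bounded normal operators. -/
theorem exists_integral_eq_of_isStarNormal (a : E →L[ℂ] E) (ha : IsStarNormal a) :
    ∃ (Ω : Type) (_ : MeasurableSpace Ω) (P : PVMeasure Ω E) (b : Ω → ℂ),
      IsBddMeasurable b ∧ P.integral b = a :=
  ⟨_, _, normalPVMeasure a ha, fun z => z, StarAlgHom.isBddMeasurable_continuousMap
    (ContinuousMap.restrict (spectrum ℂ a) (ContinuousMap.id ℂ)), integral_normalPVMeasure a ha⟩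

end Normal

/-! ### Integrals of unbounded real functions -/

namespace PVMeasure

variable {Ω : Type*} [MeasurableSpace Ω] {E : Type*} [NormedAddCommGroup E]
  [InnerProductSpace ℂ E] [CompleteSpace E] (P : PVMeasure Ω E)

/-- The set on which `|f| ≤ n`. -/
def levelSet (f : Ω → ℝ) (n : ℕ) : Set Ω := {ω | |f ω| ≤ n}

/-- The truncation of `f` to the set on which `|f| ≤ n`. -/
def truncation (f : Ω → ℝ) (n : ℕ) : Ω → ℂ := (levelSet f n).indicator fun ω => (f ω : ℂ)

/-- The graph of `∫ f dP`. -/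
def operatorGraph (f : Ω → ℝ) : Submodule ℂ (E × E) where
  -- No domain condition is imposed: the equations for all `n` bound every truncated integral by
  -- `‖p.2‖`, which already forces `f` to be square integrable.
  carrier := {p | ∀ n, P.proj (levelSet f n) p.2 = P.integral (truncation f n) p.1}
  zero_mem' := by simp
  add_mem' := by
    intro p q hp hq n
    rw [Prod.snd_add, Prod.fst_add, map_add, map_add, hp n, hq n]
  smul_mem' := by
    intro c p hp n
    rw [Prod.smul_snd, Prod.smul_fst, map_smul, map_smul, hp n]

/-- The operator `∫ f dP` for a measurable real function `f`. -/
def operator (f : Ω → ℝ) : E →ₗ.[ℂ] E := (P.operatorGraph f).toLinearPMap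

variable {f : Ω → ℝ}

theorem measurableSet_levelSet (hf : Measurable f) (n : ℕ) : MeasurableSet (levelSet f n) :=
  measurableSet_le hf.abs measurable_const

theorem eventually_mem_levelSet (f : Ω → ℝ) (ω : Ω) : ∀ᶠ n in atTop, ω ∈ levelSet f n := by
  obtain ⟨N, hN⟩ := exists_nat_ge |f ω|
  filter_upwards [eventually_ge_atTop N] with n hn
  exact hN.trans (by exact_mod_cast hn)

theorem norm_truncation_le (f : Ω → ℝ) (n : ℕ) (ω : Ω) : ‖truncation f n ω‖ ≤ n := by
  by_cases h : ω ∈ levelSet f n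
  · rw [truncation, Set.indicator_of_mem h, Complex.norm_real]
    exact h
  · simp [truncation, h]

theorem norm_truncation_le_abs (f : Ω → ℝ) (n : ℕ) (ω : Ω) : ‖truncation f n ω‖ ≤ |f ω| := by
  refine (norm_indicator_le_norm_self _ _).trans ?_
  simp

theorem isBddMeasurable_truncation (hf : Measurable f) (n : ℕ) : IsBddMeasurable (truncation f n) :=
  ⟨(Complex.measurable_ofReal.comp hf).indicator (measurableSet_levelSet hf n), n,
    norm_truncation_le f n⟩

theorem tendsto_truncation (f : Ω → ℝ) (ω : Ω) :
    Tendsto (fun n => truncation f n ω) atTop (𝓝 (f ω : ℂ)) := by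
  refine tendsto_const_nhds.congr' ?_
  filter_upwards [eventually_mem_levelSet f ω] with n hn
  simp [truncation, hn]

theorem tendsto_proj_levelSet (hf : Measurable f) (x : E) :
    Tendsto (fun n => P.proj (levelSet f n) x) atTop (𝓝 x) :=
  P.tendsto_proj (measurableSet_levelSet hf) (eventually_mem_levelSet f) x

theorem eq_of_proj_levelSet (hf : Measurable f) {x y : E}
    (h : ∀ n, P.proj (levelSet f n) x = P.proj (levelSet f n) y) : x = y := by
  have h1 := P.tendsto_proj_levelSet hf x
  simp only [h] at h1
  exact tendsto_nhds_unique h1 (P.tendsto_proj_levelSet hf y)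

theorem graph_operator (hf : Measurable f) : (P.operator f).graph = P.operatorGraph f := by
  refine Submodule.toLinearPMap_graph_eq _ ?_
  rintro ⟨x, y⟩ hx (rfl : x = 0)
  refine P.eq_of_proj_levelSet hf fun n => ?_
  have := hx n
  simpa using this

theorem mem_graph_operator (hf : Measurable f) {x y : E} : (x, y) ∈ (P.operator f).graph ↔
    ∀ n, P.proj (levelSet f n) y = P.integral (truncation f n) x := by
  rw [P.graph_operator hf]
  rfl

theorem tendsto_integral_truncation (hf : Measurable f) {x y : E}
    (h : (x, y) ∈ (P.operator f).graph) :
    Tendsto (fun n => P.integral (truncation f n) x) atTop (𝓝 y) := by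
  have h1 := P.tendsto_proj_levelSet hf y
  simpa only [(P.mem_graph_operator hf).1 h] using h1

theorem integrable_norm_truncation_sq (hf : Measurable f) (x : E) (n : ℕ) :
    Integrable (fun ω => ‖truncation f n ω‖ ^ 2) (P.scalarMeasure x) := by
  have hb := isBddMeasurable_truncation hf n
  refine Integrable.of_bound (hb.1.norm.pow_const 2).aestronglyMeasurable ((n : ℝ) ^ 2)
    (Eventually.of_forall fun ω => ?_)
  rw [Real.norm_of_nonneg (sq_nonneg _)]
  exact pow_le_pow_left₀ (norm_nonneg _) (norm_truncation_le f n ω) 2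

/-- Fatou's lemma: the truncations have square integrals at most `‖y‖²`. -/
theorem integrable_sq_of_mem (hf : Measurable f) {x y : E} (h : (x, y) ∈ (P.operator f).graph) :
    Integrable (fun ω => f ω ^ 2) (P.scalarMeasure x) := by
  have hb := isBddMeasurable_truncation hf
  refine ⟨(hf.pow_const 2).aestronglyMeasurable, ?_⟩
  have hle : ∀ n, ∫⁻ ω, ENNReal.ofReal (‖truncation f n ω‖ ^ 2) ∂P.scalarMeasure x ≤
      ENNReal.ofReal (‖y‖ ^ 2) := by
    intro n
    rw [← ofReal_integral_eq_lintegral_ofReal (P.integrable_norm_truncation_sq hf x n)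
      (Eventually.of_forall fun ω => sq_nonneg _), ← P.norm_integral_sq (hb n),
      ← (P.mem_graph_operator hf).1 h n]
    refine ENNReal.ofReal_le_ofReal (pow_le_pow_left₀ (norm_nonneg _) ?_ 2)
    have hp := (P.isStarProjection _ (measurableSet_levelSet hf n)).norm_le
    simpa using ContinuousLinearMap.le_of_opNorm_le _ hp y
  have hlim : ∫⁻ ω, ENNReal.ofReal (f ω ^ 2) ∂P.scalarMeasure x ≤ ENNReal.ofReal (‖y‖ ^ 2) := by
    have hF := lintegral_liminf_le (μ := P.scalarMeasure x) (u := atTop)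
      (f := fun n ω => ENNReal.ofReal (‖truncation f n ω‖ ^ 2))
      (fun n => ((hb n).1.norm.pow_const 2).ennreal_ofReal)
    have e : ∀ ω, liminf (fun n => ENNReal.ofReal (‖truncation f n ω‖ ^ 2)) atTop =
        ENNReal.ofReal (f ω ^ 2) := fun ω => by
      refine Tendsto.liminf_eq ?_
      refine (ENNReal.continuous_ofReal.tendsto _).comp ?_
      simpa using ((tendsto_truncation f ω).norm).pow 2
    simp only [e] at hF
    exact hF.trans (liminf_le_of_le (by isBoundedDefault) fun b hb' => by
      obtain ⟨n, hn⟩ := hb'.exists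
      exact hn.trans (hle n))
  rw [hasFiniteIntegral_iff_ofReal (Eventually.of_forall fun ω => sq_nonneg _)]
  exact hlim.trans_lt ENNReal.ofReal_lt_top

theorem tendsto_integral_norm_sub_truncation (hf : Measurable f) {x : E} {g : Ω → ℂ}
    (hg : IsBddMeasurable g) (h : Integrable (fun ω => f ω ^ 2) (P.scalarMeasure x)) :
    Tendsto (fun n => ∫ ω, ‖g ω - truncation f n ω‖ ^ 2 ∂P.scalarMeasure x) atTop
      (𝓝 (∫ ω, ‖g ω - f ω‖ ^ 2 ∂P.scalarMeasure x)) := by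
  have hb := isBddMeasurable_truncation hf
  obtain ⟨C, hC⟩ := hg.bdd
  have hi : Integrable (fun ω => 2 * C ^ 2 + 2 * f ω ^ 2) (P.scalarMeasure x) :=
    (integrable_const (2 * C ^ 2)).add (h.const_mul 2)
  refine tendsto_integral_of_dominated_convergence (fun ω => 2 * C ^ 2 + 2 * f ω ^ 2)
    (fun n => ?_) hi (fun n => Eventually.of_forall fun ω => ?_) (Eventually.of_forall fun ω => ?_)
  · exact ((hg.sub (hb n)).1.norm.pow_const 2).aestronglyMeasurable
  · rw [Real.norm_of_nonneg (sq_nonneg _)]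
    have h1 := norm_sub_le (g ω) (truncation f n ω)
    have h2 := norm_truncation_le_abs f n ω
    have h3 := hC ω
    have h4 : ‖g ω - truncation f n ω‖ ≤ C + |f ω| := by linarith
    have h5 := pow_le_pow_left₀ (norm_nonneg _) h4 2
    nlinarith [sq_nonneg (C - |f ω|), sq_abs (f ω)]
  · exact (((tendsto_truncation f ω).const_sub (g ω)).norm).pow 2

theorem norm_integral_sub_sq (hf : Measurable f) {x y : E} (h : (x, y) ∈ (P.operator f).graph)
    {g : Ω → ℂ} (hg : IsBddMeasurable g) :
    ‖P.integral g x - y‖ ^ 2 = ∫ ω, ‖g ω - f ω‖ ^ 2 ∂P.scalarMeasure x := by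
  have hb := isBddMeasurable_truncation hf
  have h1 := (((P.tendsto_integral_truncation hf h).const_sub (P.integral g x)).norm).pow 2
  refine tendsto_nhds_unique h1 ?_
  refine (P.tendsto_integral_norm_sub_truncation hf hg (P.integrable_sq_of_mem hf h)).congr
    fun n => ?_
  rw [← P.norm_integral_sq (hg.sub (hb n)), P.integral_sub hg (hb n), sub_apply]

/-- The truncated integrals are Cauchy, since for `N ≤ n` two truncations differ pointwise by at
most `|f - truncation f N|`, which tends to zero in `L²`. -/
theorem exists_mem_graph (hf : Measurable f) {x : E}
    (h : Integrable (fun ω => f ω ^ 2) (P.scalarMeasure x)) :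
    ∃ y, (x, y) ∈ (P.operator f).graph := by
  have hb := isBddMeasurable_truncation hf
  have hsub : ∀ m n : ℕ, m ≤ n → levelSet f m ⊆ levelSet f n := fun m n hmn ω hω =>
    le_trans (b := (m : ℝ)) hω (Nat.cast_le.2 hmn)
  have hpt : ∀ m n : ℕ, m ≤ n → ∀ x, P.proj (levelSet f m) (P.integral (truncation f n) x) =
      P.integral (truncation f m) x := by
    intro m n hmn x
    rw [P.proj_integral_comm (measurableSet_levelSet hf m) (hb n),
      P.integral_proj (measurableSet_levelSet hf m) (hb n), truncation, Set.indicator_indicator,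
      Set.inter_eq_left.2 (hsub m n hmn)]
    rfl
  have hc : CauchySeq fun n => P.integral (truncation f n) x := by
    have hlim : Tendsto (fun n : ℕ => ∫ ω, ‖(f ω : ℂ) - truncation f n ω‖ ^ 2 ∂P.scalarMeasure x)
        atTop (𝓝 0) := by
      rw [← MeasureTheory.integral_zero Ω ℝ (μ := P.scalarMeasure x)]
      refine tendsto_integral_of_dominated_convergence (fun ω => f ω ^ 2)
        (fun n => (((Complex.measurable_ofReal.comp hf).sub
          (hb n).1).norm.pow_const 2).aestronglyMeasurable) h
        (fun n => Eventually.of_forall fun ω => ?_) (Eventually.of_forall fun ω => ?_)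
      · by_cases hω : ω ∈ levelSet f n
        · simp [truncation, hω, sq_nonneg]
        · simp [truncation, hω]
      · simpa using (((tendsto_truncation f ω).const_sub (f ω : ℂ)).norm).pow 2
    refine cauchySeq_of_le_tendsto_0 (fun n => 2 * Real.sqrt
      (∫ ω, ‖(f ω : ℂ) - truncation f n ω‖ ^ 2 ∂P.scalarMeasure x)) (fun n m N hn hm => ?_)
      (by simpa using (hlim.sqrt).const_mul 2)
    have key : ∀ n, N ≤ n → dist (P.integral (truncation f n) x) (P.integral (truncation f N) x) ≤
        Real.sqrt (∫ ω, ‖(f ω : ℂ) - truncation f N ω‖ ^ 2 ∂P.scalarMeasure x) := by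
      intro n hn
      refine Real.le_sqrt_of_sq_le ?_
      rw [dist_eq_norm, ← sub_apply, ← P.integral_sub (hb n) (hb N),
        P.norm_integral_sq ((hb n).sub (hb N))]
      refine integral_mono_of_nonneg (Eventually.of_forall fun ω => sq_nonneg _) ?_
        (Eventually.of_forall fun ω => ?_)
      · refine h.mono' (((Complex.measurable_ofReal.comp hf).sub
          (hb N).1).norm.pow_const 2).aestronglyMeasurable (Eventually.of_forall fun ω => ?_)
        by_cases hω : ω ∈ levelSet f N
        · simp [truncation, hω, sq_nonneg]
        · simp [truncation, hω]
      · refine pow_le_pow_left₀ (norm_nonneg _) ?_ 2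
        by_cases hω : ω ∈ levelSet f N
        · simp [truncation, hω, hsub N n hn hω]
        · by_cases hω' : ω ∈ levelSet f n <;> simp [truncation, hω, hω']
    rw [two_mul]
    exact (dist_triangle_right _ _ _).trans (add_le_add (key n hn) (key m hm))
  obtain ⟨y, hy⟩ := cauchySeq_tendsto_of_complete hc
  refine ⟨y, (P.mem_graph_operator hf).2 fun m => ?_⟩
  refine tendsto_nhds_unique (((P.proj (levelSet f m)).continuous.tendsto y).comp hy) ?_
  refine tendsto_const_nhds.congr' ?_
  filter_upwards [eventually_ge_atTop m] with n hn
  exact (hpt m n hn x).symm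

theorem mem_domain_operator_iff (hf : Measurable f) (x : E) :
    x ∈ (P.operator f).domain ↔ Integrable (fun ω => f ω ^ 2) (P.scalarMeasure x) := by
  rw [LinearPMap.mem_domain_iff]
  exact ⟨fun ⟨y, hy⟩ => P.integrable_sq_of_mem hf hy, P.exists_mem_graph hf⟩

theorem inner_of_mem_graph (hf : Measurable f) {x y : E} (h : (x, y) ∈ (P.operator f).graph) :
    ⟪x, y⟫ = ((∫ ω, f ω ∂P.scalarMeasure x : ℝ) : ℂ) := by
  have hb := isBddMeasurable_truncation hf
  have h1 : Tendsto (fun n => ⟪x, P.integral (truncation f n) x⟫) atTop (𝓝 ⟪x, y⟫) :=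
    tendsto_const_nhds.inner (P.tendsto_integral_truncation hf h)
  refine tendsto_nhds_unique h1 ?_
  simp only [P.inner_integral_self (hb _)]
  rw [← integral_complex_ofReal]
  have hi : Integrable (fun ω => |f ω|) (P.scalarMeasure x) := by
    have h2 := (P.integrable_sq_of_mem hf h).add (integrable_const (1 : ℝ))
    refine h2.mono' hf.abs.aestronglyMeasurable (Eventually.of_forall fun ω => ?_)
    rw [Real.norm_eq_abs, abs_abs]
    simp only [Pi.add_apply]
    nlinarith [sq_nonneg (|f ω| - 1), sq_abs (f ω)]
  exact tendsto_integral_of_dominated_convergence _ (fun n => (hb n).1.aestronglyMeasurable) hi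
    (fun n => Eventually.of_forall (norm_truncation_le_abs f n))
    (Eventually.of_forall (tendsto_truncation f))

theorem mem_graph_integral (hf : Measurable f) {b c : Ω → ℂ} (hb : IsBddMeasurable b)
    (hc : IsBddMeasurable c) {z : E} (h : ∀ᵐ ω ∂P.scalarMeasure z, c ω = f ω * b ω) :
    (P.integral b z, P.integral c z) ∈ (P.operator f).graph := by
  refine (P.mem_graph_operator hf).2 fun n => ?_
  have hB := measurableSet_levelSet hf n
  have ht := isBddMeasurable_truncation hf n
  rw [P.proj_integral_comm hB hc, P.integral_proj hB hc, P.integral_integral ht hb]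
  refine P.integral_congr_ae (hc.indicator hB) (ht.mul hb) ?_
  filter_upwards [h] with ω hω
  by_cases hmem : ω ∈ levelSet f n <;> simp [truncation, hmem, hω]

theorem proj_levelSet_mem_domain (hf : Measurable f) (x : E) (n : ℕ) :
    P.proj (levelSet f n) x ∈ (P.operator f).domain := by
  rw [LinearPMap.mem_domain_iff]
  refine ⟨P.integral (truncation f n) x, ?_⟩
  rw [← P.integral_indicator_one (measurableSet_levelSet hf n)]
  refine P.mem_graph_integral hf (.indicator_one (measurableSet_levelSet hf n))
    (isBddMeasurable_truncation hf n) (Eventually.of_forall fun ω => ?_)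
  by_cases hmem : ω ∈ levelSet f n <;> simp [truncation, hmem]

theorem dense_domain_operator (hf : Measurable f) : Dense ((P.operator f).domain : Set E) :=
  fun x => mem_closure_of_tendsto (P.tendsto_proj_levelSet hf x)
    (Eventually.of_forall fun n => P.proj_levelSet_mem_domain hf x n)

theorem integral_of_mem_graph (hf : Measurable f) {x y : E} (h : (x, y) ∈ (P.operator f).graph)
    {g k : Ω → ℂ} (hg : IsBddMeasurable g) (hk : IsBddMeasurable k)
    (hgk : ∀ᵐ ω ∂P.scalarMeasure x, k ω = f ω * g ω) :
    P.integral g y = P.integral k x := by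
  refine P.eq_of_proj_levelSet hf fun n => ?_
  have hB := measurableSet_levelSet hf n
  have ht := isBddMeasurable_truncation hf n
  rw [P.proj_integral_comm hB hg, (P.mem_graph_operator hf).1 h n, P.proj_integral_comm hB hk,
    P.integral_proj hB hk, P.integral_integral hg ht]
  refine P.integral_congr_ae (hg.mul ht) (hk.indicator hB) ?_
  filter_upwards [hgk] with ω hω
  by_cases hmem : ω ∈ levelSet f n <;> simp [truncation, hmem, hω, mul_comm]

/-- If `c = f b` and `d b + e c = 1` for bounded `b`, `c`, then the graph of `∫ f dP` consists of the
pairs `(∫ b dP z, ∫ c dP z)`. -/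
theorem mem_graph_operator_iff_exists (hf : Measurable f) {b c : Ω → ℂ} (hb : IsBddMeasurable b)
    (hc : IsBddMeasurable c) (h : ∀ z, ∀ᵐ ω ∂P.scalarMeasure z, c ω = f ω * b ω) {d e : ℂ}
    (h1 : ∀ ω, d * b ω + e * c ω = 1) {x y : E} :
    (x, y) ∈ (P.operator f).graph ↔ ∃ z, P.integral b z = x ∧ P.integral c z = y := by
  constructor
  · intro hxy
    have e1 : ∀ v, d • P.integral b v + e • P.integral c v = v := fun v => by
      rw [← smul_apply, ← smul_apply, ← P.integral_const_mul d hb, ← P.integral_const_mul e hc,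
        ← add_apply, ← P.integral_add (hb.const_mul d) (hc.const_mul e)]
      simp only [h1, P.integral_const, one_smul, one_apply_eq_self]
    have e2 : P.integral b y = P.integral c x := P.integral_of_mem_graph hf hxy hb hc (h x)
    -- From `b z = x`, `c z = y` and `d b + e c = 1` the vector `z` can only be `d x + e y`.
    refine ⟨d • x + e • y, ?_, ?_⟩
    · rw [map_add, map_smul, map_smul, e2, e1]
    · rw [map_add, map_smul, map_smul, ← e2, e1]
  · rintro ⟨z, rfl, rfl⟩
    exact P.mem_graph_integral hf hb hc (h z)

theorem symm_of_mem_graph (hf : Measurable f) {x y x' y' : E} (h : (x, y) ∈ (P.operator f).graph)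
    (h' : (x', y') ∈ (P.operator f).graph) : ⟪y, x'⟫ = ⟪x, y'⟫ := by
  have hb := isBddMeasurable_truncation hf
  have h1 : Tendsto (fun n => ⟪P.integral (truncation f n) x, x'⟫) atTop (𝓝 ⟪y, x'⟫) :=
    (P.tendsto_integral_truncation hf h).inner tendsto_const_nhds
  have h2 : Tendsto (fun n => ⟪x, P.integral (truncation f n) x'⟫) atTop (𝓝 ⟪x, y'⟫) :=
    tendsto_const_nhds.inner (P.tendsto_integral_truncation hf h')
  refine tendsto_nhds_unique h1 (h2.congr fun n => ?_)
  rw [← ContinuousLinearMap.adjoint_inner_left, ← P.integral_conj (hb n)]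
  congr 3
  ext ω
  by_cases hmem : ω ∈ levelSet f n <;> simp [truncation, hmem]

/-- The image of a projection-valued measure under a real function. -/
def toReal (f : Ω → ℝ) (hf : Measurable f) : ProjectionValuedMeasure E where
  proj B := P.proj (f ⁻¹' B)
  isStarProjection B hB := P.isStarProjection _ (hf hB)
  proj_univ := P.proj_univ
  hasSum_iUnion B hB hd x := by
    rw [Set.preimage_iUnion]
    exact P.hasSum_iUnion _ (fun i => hf (hB i)) (fun i j hij => (hd hij).preimage f) x

/-- A projection-valued measure on the real line. -/
def ofReal (Q : ProjectionValuedMeasure E) : PVMeasure ℝ E where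
  proj := Q.proj
  isStarProjection := Q.isStarProjection
  proj_univ := Q.proj_univ
  hasSum_iUnion := Q.hasSum_iUnion

theorem scalarMeasure_toReal (hf : Measurable f) (x : E) :
    (P.toReal f hf).scalarMeasure x = (P.scalarMeasure x).map f := by
  refine Measure.ext fun B hB => ?_
  rw [Measure.map_apply hf hB, P.scalarMeasure_apply x (hf hB)]
  exact Measure.ofMeasurable_apply B hB

theorem isSpectralMeasureOf_toReal (hf : Measurable f) :
    (P.toReal f hf).IsSpectralMeasureOf (P.operator f) where
  mem_domain_iff x := by
    rw [P.mem_domain_operator_iff hf, P.scalarMeasure_toReal hf,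
      integrable_map_measure (by fun_prop) hf.aemeasurable]
    rfl
  inner_apply x := by
    rw [P.inner_of_mem_graph hf ((P.operator f).mem_graph x), P.scalarMeasure_toReal hf,
      integral_map hf.aemeasurable (by fun_prop)]

end PVMeasure

/-- An operator with dense domain is determined by its quadratic form. -/
theorem LinearPMap.eq_of_inner_self {E : Type*} [NormedAddCommGroup E] [InnerProductSpace ℂ E]
    {L M : E →ₗ.[ℂ] E} (hd : Dense (L.domain : Set E)) (h : L.domain = M.domain)
    (hq : ∀ (x : L.domain) (y : M.domain), (x : E) = y → ⟪(x : E), L x⟫ = ⟪(y : E), M y⟫) :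
    L = M := by
  obtain ⟨D, L⟩ := L
  obtain ⟨D', M⟩ := M
  obtain rfl : D = D' := h
  congr 1
  ext y
  refine hd.eq_of_inner_right ℂ fun x hx => ?_
  have hq' : ∀ z : D, ⟪(z : E), L z⟫ = ⟪(z : E), M z⟫ := fun z => hq z z rfl
  have hpol : ∀ (N : D →ₗ[ℂ] E) (x y : D), ⟪(x : E), N y⟫ =
      (⟪((x + y : D) : E), N (x + y)⟫ - ⟪((x - y : D) : E), N (x - y)⟫
      - Complex.I * ⟪((x + Complex.I • y : D) : E), N (x + Complex.I • y)⟫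
      + Complex.I * ⟪((x - Complex.I • y : D) : E), N (x - Complex.I • y)⟫) / 4 := by
    intro N x y
    simp only [N.map_add, N.map_sub, N.map_smul, Submodule.coe_add, Submodule.coe_sub,
      Submodule.coe_smul, inner_add_left, inner_add_right, inner_sub_left,
      inner_sub_right, inner_smul_left, inner_smul_right, Complex.conj_I]
    linear_combination ((1 / 2) * ⟪(x : E), N y⟫ - (1 / 2) * ⟪(y : E), N x⟫) * Complex.I_mul_I
  rw [hpol L ⟨x, hx⟩ y, hpol M ⟨x, hx⟩ y]
  simp only [hq']

namespace PVMeasure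

variable {E : Type*} [NormedAddCommGroup E] [InnerProductSpace ℂ E] [CompleteSpace E]

/-- An operator with spectral measure `Q` is `∫ t dQ(t)`. -/
theorem eq_operator_of_isSpectralMeasureOf {Q : ProjectionValuedMeasure E} {L : E →ₗ.[ℂ] E}
    (h : Q.IsSpectralMeasureOf L) : L = (ofReal Q).operator id := by
  have hdom : L.domain = ((ofReal Q).operator id).domain := by
    ext x
    rw [h.mem_domain_iff, (ofReal Q).mem_domain_operator_iff measurable_id]
    rfl
  refine LinearPMap.eq_of_inner_self ?_ hdom fun x y hxy => ?_
  · rw [hdom]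
    exact (ofReal Q).dense_domain_operator measurable_id
  · rw [h.inner_apply, (ofReal Q).inner_of_mem_graph measurable_id
      (((ofReal Q).operator id).mem_graph y), ← hxy]
    rfl

end PVMeasure

/-! ### The spectral theorem for selfadjoint operators -/

section SelfAdjoint

variable {E : Type*} [NormedAddCommGroup E] [InnerProductSpace ℂ E] [CompleteSpace E]
  {A : E →ₗ.[ℂ] E}

theorem IsSelfAdjoint.symm_graph (hA : IsSelfAdjoint A) {x y x' y' : E} (h : (x, y) ∈ A.graph)
    (h' : (x', y') ∈ A.graph) : ⟪y, x'⟫ = ⟪x, y'⟫ := by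
  have hf := LinearPMap.adjoint_isFormalAdjoint hA.dense_domain
  rw [LinearPMap.isSelfAdjoint_def.1 hA] at hf
  obtain ⟨u, rfl, rfl⟩ := (LinearPMap.mem_graph_iff _).1 h
  obtain ⟨v, rfl, rfl⟩ := (LinearPMap.mem_graph_iff _).1 h'
  exact hf u v

theorem IsSelfAdjoint.mem_graph_of_forall (hA : IsSelfAdjoint A) {w v : E}
    (h : ∀ x y, (x, y) ∈ A.graph → ⟪v, x⟫ = ⟪w, y⟫) : (w, v) ∈ A.graph := by
  rw [← LinearPMap.isSelfAdjoint_def.1 hA,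
    LinearPMap.adjoint_graph_eq_graph_adjoint hA.dense_domain, Submodule.mem_adjoint_iff]
  intro a b hab
  rw [sub_eq_zero, ← inner_conj_symm, ← h a b hab, inner_conj_symm]

/-- Symmetry makes `⟪y, x⟫` real, so the cross term with an imaginary `σ` has real part zero. -/
theorem IsSelfAdjoint.norm_sq_add_smul (hA : IsSelfAdjoint A) {x y : E} (h : (x, y) ∈ A.graph)
    {σ : ℂ} (hσ : σ = Complex.I ∨ σ = -Complex.I) :
    ‖y + σ • x‖ ^ 2 = ‖y‖ ^ 2 + ‖x‖ ^ 2 := by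
  have hs := hA.symm_graph h h
  have hn : ‖σ‖ = 1 := by rcases hσ with rfl | rfl <;> simp
  have hre : (⟪y, σ • x⟫).re = 0 := by
    have him : (⟪y, x⟫).im = 0 := by
      have := congrArg Complex.im hs
      rw [← inner_conj_symm x y, Complex.conj_im] at this
      linarith
    rcases hσ with rfl | rfl <;> simp [inner_smul_right, him]
  have := norm_add_sq (𝕜 := ℂ) y (σ • x)
  rw [this, norm_smul, hn, one_mul]
  have h0 : RCLike.re ⟪y, σ • x⟫ = 0 := hre
  rw [h0]
  ring

/-- The norm identity makes the range closed. A vector orthogonal to it would be an eigenvector of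
`A` with the nonreal eigenvalue `σ`, hence is zero. -/
theorem IsSelfAdjoint.exists_add_smul_eq (hA : IsSelfAdjoint A) {σ : ℂ}
    (hσ : σ = Complex.I ∨ σ = -Complex.I) (z : E) : ∃ x y, (x, y) ∈ A.graph ∧ y + σ • x = z := by
  have hcl : IsClosed (A.graph : Set (E × E)) := hA.isClosed
  have : CompleteSpace A.graph := hcl.completeSpace_coe
  let F : A.graph →L[ℂ] E := (ContinuousLinearMap.snd ℂ E E + σ • ContinuousLinearMap.fst ℂ E E).comp
    A.graph.subtypeL
  have hF : ∀ p : A.graph, F p = p.1.2 + σ • p.1.1 := fun p => rfl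
  have hanti : AntilipschitzWith 1 F := by
    refine AddMonoidHomClass.antilipschitz_of_bound F fun p => ?_
    have h1 := hA.norm_sq_add_smul (x := p.1.1) (y := p.1.2) p.2 hσ
    rw [hF, NNReal.coe_one, one_mul]
    change max ‖p.1.1‖ ‖p.1.2‖ ≤ _
    refine max_le ?_ ?_ <;> refine le_of_sq_le_sq ?_ (norm_nonneg _) <;> rw [h1] <;>
      nlinarith [sq_nonneg ‖p.1.1‖, sq_nonneg ‖p.1.2‖]
  have hclosed : IsClosed (Set.range F) := hanti.isClosed_range F.uniformContinuous
  have htop : (LinearMap.range (F : A.graph →ₗ[ℂ] E)) = ⊤ := by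
    have hc : IsClosed ((LinearMap.range (F : A.graph →ₗ[ℂ] E) : Submodule ℂ E) : Set E) := by
      rw [LinearMap.coe_range]
      exact hclosed
    have : CompleteSpace (LinearMap.range (F : A.graph →ₗ[ℂ] E)) := hc.completeSpace_coe
    rw [← Submodule.orthogonal_eq_bot_iff, Submodule.eq_bot_iff]
    intro w hw
    have horth : ∀ x y, (x, y) ∈ A.graph → ⟪w, y + σ • x⟫ = 0 := by
      intro x y hxy
      have : ⟪y + σ • x, w⟫ = 0 := (Submodule.mem_orthogonal _ _).1 hw _ ⟨⟨(x, y), hxy⟩, rfl⟩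
      rw [← inner_conj_symm, this, map_zero]
    have hmem : (w, -(starRingEnd ℂ σ) • w) ∈ A.graph := by
      refine hA.mem_graph_of_forall fun x y hxy => ?_
      have := horth x y hxy
      rw [inner_add_right, inner_smul_right] at this
      rw [inner_smul_left, map_neg, Complex.conj_conj]
      linear_combination -this
    have hs := horth _ _ hmem
    have h2 : -(starRingEnd ℂ σ) • w + σ • w = (2 * σ) • w := by
      rcases hσ with rfl | rfl <;> simp [two_mul, add_smul]
    rw [h2, inner_smul_right] at hs
    have hσ0 : (2 * σ) ≠ 0 := by rcases hσ with rfl | rfl <;> simp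
    exact inner_self_eq_zero.1 ((mul_eq_zero.1 hs).resolve_left hσ0)
  have : z ∈ LinearMap.range (F : A.graph →ₗ[ℂ] E) := by rw [htop]; trivial
  obtain ⟨p, hp⟩ := this
  exact ⟨p.1.1, p.1.2, p.2, hp⟩

/-- The resolvent of a selfadjoint operator at `∓ i`. -/
theorem IsSelfAdjoint.exists_resolvent (hA : IsSelfAdjoint A) {σ : ℂ}
    (hσ : σ = Complex.I ∨ σ = -Complex.I) : ∃ G : E →L[ℂ] E,
      (∀ z, (G z, z - σ • G z) ∈ A.graph) ∧ ∀ x y, (x, y) ∈ A.graph → G (y + σ • x) = x := by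
  choose G0 Y h1 h2 using hA.exists_add_smul_eq hσ
  have huniq : ∀ x y x' y', (x, y) ∈ A.graph → (x', y') ∈ A.graph → y + σ • x = y' + σ • x' →
      x = x' := by
    intro x y x' y' h h' e
    have hsub : (x - x', y - y') ∈ A.graph := A.graph.sub_mem h h'
    have := hA.norm_sq_add_smul hsub hσ
    have e0 : y - y' + σ • (x - x') = 0 := by
      rw [smul_sub, sub_add_sub_comm, e, sub_self]
    rw [e0, norm_zero] at this
    have h3 : ‖x - x'‖ ^ 2 = 0 := by nlinarith [sq_nonneg ‖y - y'‖, sq_nonneg ‖x - x'‖]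
    simpa [sub_eq_zero] using h3
  let L : E →ₗ[ℂ] E :=
    { toFun := G0
      map_add' := fun z w => huniq _ _ _ _ (h1 _) (A.graph.add_mem (h1 z) (h1 w)) (by
        rw [h2, smul_add, add_add_add_comm, h2, h2])
      map_smul' := fun c z => huniq _ _ _ _ (h1 _) (A.graph.smul_mem c (h1 z)) (by
        change _ = c • Y z + σ • c • G0 z
        rw [h2, smul_comm σ, ← smul_add, h2]) }
  refine ⟨L.mkContinuous 1 fun z => ?_, fun z => ?_, fun x y h => ?_⟩
  · rw [one_mul]
    refine le_of_sq_le_sq ?_ (norm_nonneg _)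
    have := hA.norm_sq_add_smul (h1 z) hσ
    rw [h2] at this
    change ‖G0 z‖ ^ 2 ≤ _
    nlinarith [sq_nonneg ‖Y z‖]
  · change (G0 z, z - σ • G0 z) ∈ A.graph
    have : z - σ • G0 z = Y z := by
      conv_lhs => rw [← h2 z, add_sub_assoc]
      simp [h2]
    rw [this]
    exact h1 z
  · exact huniq _ _ _ _ (h1 _) h (h2 _)

/-- The spectral theorem: every selfadjoint operator is an integral `∫ f dP`. -/
theorem IsSelfAdjoint.exists_eq_operator (hA : IsSelfAdjoint A) :
    ∃ P : PVMeasure ℝ E, A = P.operator id := by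
  obtain ⟨G, hG, hG'⟩ := hA.exists_resolvent (Or.inl rfl)
  obtain ⟨F, hF, hF'⟩ := hA.exists_resolvent (Or.inr rfl)
  have hadj : ContinuousLinearMap.adjoint G = F := by
    refine ContinuousLinearMap.ext fun w => ext_inner_left ℂ fun z => ?_
    rw [ContinuousLinearMap.adjoint_inner_right]
    have := hA.symm_graph (hG z) (hF w)
    rw [inner_sub_left, inner_sub_right, inner_smul_left, inner_smul_right, Complex.conj_I] at this
    linear_combination -this
  have hres : G - F + (2 * Complex.I) • (F * G) = 0 := by
    ext z
    have h1 : F ((z - Complex.I • G z) + (-Complex.I) • G z) = G z := hF' _ _ (hG z)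
    have h2 : (z - Complex.I • G z) + (-Complex.I) • G z = z - (2 * Complex.I) • G z := by module
    rw [h2, map_sub, map_smul] at h1
    simp only [add_apply, sub_apply, smul_apply, mul_apply_eq_comp, zero_apply]
    rw [← sub_eq_zero] at h1
    rw [← neg_eq_zero, ← h1]
    module
  have hres' : F - G - (2 * Complex.I) • (G * F) = 0 := by
    ext z
    have h1 : G ((z - (-Complex.I) • F z) + Complex.I • F z) = F z := hG' _ _ (hF z)
    have h2 : (z - (-Complex.I) • F z) + Complex.I • F z = z + (2 * Complex.I) • F z := by module
    rw [h2, map_add, map_smul] at h1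
    simp only [sub_apply, smul_apply, mul_apply_eq_comp, zero_apply]
    rw [← sub_eq_zero] at h1
    rw [← neg_eq_zero, ← h1]
    module
  have hnormal : IsStarNormal G := by
    refine ⟨?_⟩
    change star G * G = G * star G
    rw [ContinuousLinearMap.star_eq_adjoint, hadj]
    -- Adding the two resolvent identities cancels `G - F` and leaves the commutator.
    have h3 : (2 * Complex.I) • (F * G - G * F) = 0 := by
      rw [smul_sub]
      rw [← add_zero (0 : E →L[ℂ] E)]
      nth_rw 1 [← hres]
      rw [← hres']
      abel
    rcases smul_eq_zero.1 h3 with h | h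
    · simp at h
    · exact sub_eq_zero.1 h
  obtain ⟨Ω, _, P, b, hz, hPG⟩ := exists_integral_eq_of_isStarNormal G hnormal
  -- The operator `G` is the inverse of `A + i`, so `b` should be `1 / (f + i)`. The real part of
  -- `b⁻¹` is taken as `f`; the resolvent identity, transferred to `b` in `hrel`, says that its
  -- imaginary part is `1` almost everywhere.
  let f : Ω → ℝ := fun z => ((b z)⁻¹).re
  have hf : Measurable f := Complex.measurable_re.comp (hz.1.inv)
  have hc : IsBddMeasurable fun z : Ω => 1 - Complex.I * b z :=
    (IsBddMeasurable.const 1).sub (hz.const_mul _)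
  have hcG : P.integral (fun z => 1 - Complex.I * b z) = 1 - Complex.I • G := by
    rw [P.integral_sub (.const 1) (hz.const_mul _), P.integral_const, P.integral_const_mul _ hz,
      hPG, one_smul]
  have hne : ∀ x, ∀ᵐ z ∂P.scalarMeasure x, b z ≠ 0 := fun x => by
    refine P.ae_ne_zero_of_injective hz (fun v hv => ?_) x
    rw [hPG] at hv
    have := hG v
    rw [hv, smul_zero, sub_zero] at this
    exact LinearPMap.graph_fst_eq_zero_snd _ this rfl
  have hrel : ∀ x, ∀ᵐ z ∂P.scalarMeasure x,
      b z - starRingEnd ℂ (b z) + 2 * Complex.I * (starRingEnd ℂ (b z) * b z) = 0 := by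
    intro x
    have hb := (hz.sub hz.conj).add ((hz.conj.mul hz).const_mul (2 * Complex.I))
    have h0 : P.integral (fun z => b z - starRingEnd ℂ (b z) +
        2 * Complex.I * (starRingEnd ℂ (b z) * b z)) = 0 := by
      rw [P.integral_add (hz.sub hz.conj) ((hz.conj.mul hz).const_mul _), P.integral_sub hz hz.conj,
        P.integral_const_mul _ (hz.conj.mul hz), P.integral_mul hz.conj hz, P.integral_conj hz, hPG,
        hadj, hres]
    exact P.ae_eq_zero_of_integral_eq_zero hb (by rw [h0]; rfl)
  have hfc : ∀ x, ∀ᵐ z ∂P.scalarMeasure x, 1 - Complex.I * b z = f z * b z := by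
    intro x
    filter_upwards [hne x, hrel x] with z h0 h1
    have h0' : starRingEnd ℂ (b z) ≠ 0 := by simpa using h0
    have h2 : ((f z : ℝ) : ℂ) = ((b z)⁻¹ + (starRingEnd ℂ (b z))⁻¹) / 2 := by
      rw [Complex.re_eq_add_conj, map_inv₀]
    rw [h2]
    field_simp
    linear_combination -h1
  have hAf : A = P.operator f := by
    refine LinearPMap.eq_of_eq_graph (Submodule.ext fun p => ?_)
    obtain ⟨x, y⟩ := p
    rw [P.mem_graph_operator_iff_exists hf hz hc hfc (d := Complex.I) (e := 1)
      (fun z => by ring), hPG, hcG]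
    constructor
    · intro h
      refine ⟨y + Complex.I • x, hG' _ _ h, ?_⟩
      rw [sub_apply, smul_apply, hG' _ _ h, one_apply_eq_self, add_sub_cancel_right]
    · rintro ⟨z, rfl, rfl⟩
      exact hG z
  exact ⟨_, hAf.trans (PVMeasure.eq_operator_of_isSpectralMeasureOf
    (P.isSpectralMeasureOf_toReal hf))⟩

end SelfAdjoint

/-! ### Unitary groups -/

namespace IsUnitaryGroup

variable {E : Type*} [NormedAddCommGroup E] [InnerProductSpace ℂ E] [CompleteSpace E]
  {U V : ℝ → E →L[ℂ] E}

theorem mem_generatorGraph_apply (hV : IsUnitaryGroup V) {x y : E} (h : (x, y) ∈ generatorGraph V)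
    (s : ℝ) : (V s x, V s y) ∈ generatorGraph V := by
  have h' : Tendsto (fun t : ℝ => (Complex.I * (t : ℂ))⁻¹ • (V t x - x)) (𝓝[≠] 0) (𝓝 y) := h
  have h2 := ((V s).continuous.tendsto y).comp h'
  refine h2.congr fun t => ?_
  have e : V s (V t x) = V t (V s x) := by
    rw [← mul_apply_eq_comp, ← mul_apply_eq_comp, ← hV.map_add, ← hV.map_add, add_comm]
  simp [e]

theorem hasDerivAt (hV : IsUnitaryGroup V) {x y : E} (h : (x, y) ∈ generatorGraph V) (s : ℝ) :
    HasDerivAt (fun t => V t x) (Complex.I • V s y) s := by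
  have h' : Tendsto (fun t : ℝ => (Complex.I * (t : ℂ))⁻¹ • (V t (V s x) - V s x)) (𝓝[≠] 0)
    (𝓝 (V s y)) := hV.mem_generatorGraph_apply h s
  rw [hasDerivAt_iff_tendsto_slope_zero]
  refine (h'.const_smul Complex.I).congr fun t => ?_
  rw [add_comm s t, hV.map_add, mul_apply_eq_comp, smul_smul, mul_inv, ← mul_assoc,
    mul_inv_cancel₀ Complex.I_ne_zero, one_mul, ← Complex.ofReal_inv, Complex.coe_smul]

/-- A unitary group is determined by its generator. -/
theorem eq_of_generatorGraph_eq (hU : IsUnitaryGroup U) (hV : IsUnitaryGroup V)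
    (h : generatorGraph U = generatorGraph V)
    (hsymm : ∀ x y x' y', (x, y) ∈ generatorGraph V → (x', y') ∈ generatorGraph V →
      ⟪y, x'⟫ = ⟪x, y'⟫) (hd : Dense {x | ∃ y, (x, y) ∈ generatorGraph V}) : U = V := by
  have key : ∀ x y z w, (x, y) ∈ generatorGraph V → (z, w) ∈ generatorGraph V → ∀ t,
      ⟪U t z, V t x⟫ = ⟪z, x⟫ := by
    intro x y z w hxy hzw t
    have hzw' : (z, w) ∈ generatorGraph U := by rw [h]; exact hzw
    -- Both groups preserve the domain of the common generator, whose symmetry cancels the two terms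
    -- of the derivative.
    have hder : ∀ s, HasDerivAt (fun t => ⟪U t z, V t x⟫) 0 s := by
      intro s
      have h1 := (hU.hasDerivAt hzw' s).inner ℂ (hV.hasDerivAt hxy s)
      have h2 : (U s z, U s w) ∈ generatorGraph V := by
        rw [← h]; exact hU.mem_generatorGraph_apply hzw' s
      have h3 := hsymm _ _ _ _ h2 (hV.mem_generatorGraph_apply hxy s)
      have e : ⟪U s z, Complex.I • V s y⟫ + ⟪Complex.I • U s w, V s x⟫ = 0 := by
        rw [inner_smul_left, inner_smul_right, h3, Complex.conj_I]
        ring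
      rw [e] at h1
      exact h1
    have hc := is_const_of_deriv_eq_zero (fun s => (hder s).differentiableAt)
      (fun s => (hder s).deriv) t 0
    simpa [hU.map_zero, hV.map_zero] using hc
  funext t
  have hon : ∀ x ∈ {x | ∃ y, (x, y) ∈ generatorGraph V}, U t x = V t x := by
    rintro x ⟨y, hxy⟩
    have h1 : ContinuousLinearMap.adjoint (U t) (V t x) = x := by
      refine hd.eq_of_inner_right ℂ ?_
      rintro z ⟨w, hzw⟩
      rw [ContinuousLinearMap.adjoint_inner_right, key x y z w hxy hzw t]
    have h2 : U t (ContinuousLinearMap.adjoint (U t) (V t x)) = V t x := by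
      rw [← mul_apply_eq_comp, ← ContinuousLinearMap.star_eq_adjoint,
        (Unitary.mem_iff.1 (hU.unitary_mem t)).2]
      rfl
    rwa [h1] at h2
  refine ContinuousLinearMap.ext fun x => ?_
  exact congrFun (Continuous.ext_on hd (U t).continuous (V t).continuous hon) x

end IsUnitaryGroup

namespace PVMeasure

variable {Ω : Type*} [MeasurableSpace Ω] {E : Type*} [NormedAddCommGroup E]
  [InnerProductSpace ℂ E] [CompleteSpace E] (P : PVMeasure Ω E) {f : Ω → ℝ}

/-- The unitary group `t ↦ ∫ e^{i t f} dP`. -/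
def unitaryGroup (f : Ω → ℝ) (t : ℝ) : E →L[ℂ] E :=
  P.integral fun ω => Complex.exp (Complex.I * (t * f ω : ℝ))

theorem isBddMeasurable_phase (hf : Measurable f) (t : ℝ) :
    IsBddMeasurable fun ω => Complex.exp (Complex.I * (t * f ω : ℝ)) :=
  ⟨by fun_prop, 1, fun ω => by rw [mul_comm, Complex.norm_exp_ofReal_mul_I]⟩

theorem unitaryGroup_zero : P.unitaryGroup f 0 = 1 := by
  simp [unitaryGroup, P.integral_const]

theorem unitaryGroup_add (hf : Measurable f) (s t : ℝ) :
    P.unitaryGroup f (s + t) = P.unitaryGroup f s * P.unitaryGroup f t := by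
  rw [unitaryGroup, unitaryGroup, unitaryGroup,
    ← P.integral_mul (isBddMeasurable_phase hf s) (isBddMeasurable_phase hf t)]
  congr 1
  ext ω
  rw [← Complex.exp_add, ← mul_add, ← Complex.ofReal_add, add_mul]

theorem adjoint_unitaryGroup (hf : Measurable f) (t : ℝ) :
    ContinuousLinearMap.adjoint (P.unitaryGroup f t) = P.unitaryGroup f (-t) := by
  rw [unitaryGroup, unitaryGroup, ← P.integral_conj (isBddMeasurable_phase hf t)]
  congr 1
  ext ω
  rw [← Complex.exp_conj, map_mul, Complex.conj_I, Complex.conj_ofReal]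
  congr 1
  push_cast
  ring

theorem isUnitaryGroup (hf : Measurable f) : IsUnitaryGroup (P.unitaryGroup f) where
  unitary_mem t := by
    rw [Unitary.mem_iff, ContinuousLinearMap.star_eq_adjoint, P.adjoint_unitaryGroup hf,
      ← P.unitaryGroup_add hf, ← P.unitaryGroup_add hf]
    simp [P.unitaryGroup_zero]
  map_zero := P.unitaryGroup_zero
  map_add := P.unitaryGroup_add hf
  continuous_apply x := by
    refine continuous_iff_seqContinuous.2 fun u t hu => ?_
    refine P.tendsto_integral (C := 1) (fun n => (isBddMeasurable_phase hf _).1)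
      (fun n ω => by rw [mul_comm, Complex.norm_exp_ofReal_mul_I]) (isBddMeasurable_phase hf t)
      (fun ω => ?_) x
    have hc : Continuous fun t : ℝ => Complex.exp (Complex.I * (t * f ω : ℝ)) := by fun_prop
    exact (hc.tendsto t).comp hu

/-- The difference quotient of the phase. -/
def phaseQuotient (f : Ω → ℝ) (t : ℝ) (ω : Ω) : ℂ :=
  (Complex.I * (t : ℂ))⁻¹ * (Complex.exp (Complex.I * (t * f ω : ℝ)) - 1)

theorem isBddMeasurable_phaseQuotient (hf : Measurable f) (t : ℝ) :
    IsBddMeasurable (phaseQuotient f t) :=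
  ((isBddMeasurable_phase hf t).sub (.const 1)).const_mul _

theorem integral_phaseQuotient (hf : Measurable f) (t : ℝ) (x : E) :
    P.integral (phaseQuotient f t) x = (Complex.I * (t : ℂ))⁻¹ • (P.unitaryGroup f t x - x) := by
  unfold phaseQuotient
  rw [P.integral_const_mul _ ((isBddMeasurable_phase hf t).sub (.const 1)),
    P.integral_sub (isBddMeasurable_phase hf t) (.const 1), P.integral_const]
  simp [unitaryGroup]

theorem norm_phaseQuotient_le (f : Ω → ℝ) (t : ℝ) (ω : Ω) : ‖phaseQuotient f t ω‖ ≤ |f ω| := by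
  rw [phaseQuotient, norm_mul, norm_inv, norm_mul, Complex.norm_I, one_mul, Complex.norm_real]
  have h := Real.norm_exp_I_mul_ofReal_sub_one_le (x := t * f ω)
  rw [norm_mul, Real.norm_eq_abs (f ω)] at h
  rcases eq_or_ne t 0 with rfl | ht
  · simp
  · have h0 : 0 < ‖t‖ := norm_pos_iff.2 ht
    rw [inv_mul_le_iff₀ h0]
    exact h

theorem tendsto_phaseQuotient (f : Ω → ℝ) (ω : Ω) :
    Tendsto (fun t => phaseQuotient f t ω) (𝓝[≠] 0) (𝓝 (f ω : ℂ)) := by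
  have h : HasDerivAt (fun t : ℝ => Complex.exp (Complex.I * (t * f ω : ℝ)))
      (Complex.I * f ω) 0 := by
    have h1 : HasDerivAt (fun t : ℝ => Complex.I * ((t * f ω : ℝ) : ℂ)) (Complex.I * f ω) 0 := by
      refine HasDerivAt.const_mul _ ?_
      have := ((hasDerivAt_id (0 : ℝ)).mul_const (f ω)).ofReal_comp
      simpa using this
    simpa using h1.cexp
  rw [hasDerivAt_iff_tendsto_slope_zero] at h
  have h2 := h.const_mul (Complex.I⁻¹)
  rw [← mul_assoc, inv_mul_cancel₀ Complex.I_ne_zero, one_mul] at h2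
  refine h2.congr fun t => ?_
  rw [phaseQuotient, Complex.real_smul, mul_inv, Complex.ofReal_inv]
  simp [mul_assoc]

/-- The difference quotient of the phase tends to `f` and is dominated by `|f|`. On a level set
bounded convergence identifies the limit; conversely, on the domain, `4 f²` dominates the squared
error. -/
theorem generatorGraph_unitaryGroup (hf : Measurable f) :
    generatorGraph (P.unitaryGroup f) = (P.operator f).graph := by
  ext ⟨x, y⟩
  have hq : (x, y) ∈ generatorGraph (P.unitaryGroup f) ↔
      Tendsto (fun t => P.integral (phaseQuotient f t) x) (𝓝[≠] 0) (𝓝 y) := by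
    simp only [P.integral_phaseQuotient hf]
    rfl
  rw [hq]
  constructor
  · intro h
    refine (P.mem_graph_operator hf).2 fun n => ?_
    have hB := measurableSet_levelSet hf n
    obtain ⟨u, hu⟩ := exists_seq_tendsto (𝓝[≠] (0 : ℝ))
    have h1 := ((P.proj (levelSet f n)).continuous.tendsto y).comp (h.comp hu)
    refine tendsto_nhds_unique h1 ?_
    refine (P.tendsto_integral (C := n)
      (s := fun k => (levelSet f n).indicator (phaseQuotient f (u k)))
      (fun k => ((isBddMeasurable_phaseQuotient hf _).indicator hB).1) (fun k ω => ?_)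
      (isBddMeasurable_truncation hf n) (fun ω => ?_) x).congr fun k => ?_
    · by_cases hω : ω ∈ levelSet f n
      · rw [Set.indicator_of_mem hω]
        exact (norm_phaseQuotient_le f _ ω).trans hω
      · simp [hω]
    · by_cases hω : ω ∈ levelSet f n
      · simp only [truncation, Set.indicator_of_mem hω]
        exact (tendsto_phaseQuotient f ω).comp hu
      · simp [truncation, hω]
    · simp only [Function.comp_apply]
      rw [P.proj_integral_comm hB (isBddMeasurable_phaseQuotient hf _),
        P.integral_proj hB (isBddMeasurable_phaseQuotient hf _)]
  · intro h
    have hsq := P.integrable_sq_of_mem hf h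
    rw [tendsto_iff_norm_sub_tendsto_zero]
    have h2 : Tendsto (fun t => ‖P.integral (phaseQuotient f t) x - y‖ ^ 2) (𝓝[≠] 0) (𝓝 0) := by
      simp only [P.norm_integral_sub_sq hf h (isBddMeasurable_phaseQuotient hf _)]
      rw [← MeasureTheory.integral_zero Ω ℝ (μ := P.scalarMeasure x)]
      refine tendsto_integral_filter_of_dominated_convergence (fun ω => 4 * f ω ^ 2)
        (Eventually.of_forall fun t => ?_) (Eventually.of_forall fun t =>
          Eventually.of_forall fun ω => ?_) (hsq.const_mul 4) (Eventually.of_forall fun ω => ?_)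
      · exact (((isBddMeasurable_phaseQuotient hf t).1.sub
          (Complex.measurable_ofReal.comp hf)).norm.pow_const 2).aestronglyMeasurable
      · rw [Real.norm_of_nonneg (sq_nonneg _)]
        have h3 : ‖phaseQuotient f t ω - f ω‖ ≤ 2 * |f ω| := by
          refine (norm_sub_le _ _).trans ?_
          rw [Complex.norm_real, Real.norm_eq_abs]
          linarith [norm_phaseQuotient_le f t ω]
        have h4 := pow_le_pow_left₀ (norm_nonneg _) h3 2
        rw [mul_pow, sq_abs] at h4
        linarith
      · simpa using (((tendsto_phaseQuotient f ω).sub_const (f ω : ℂ)).norm).pow 2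
    simpa using h2.sqrt

theorem groupGenerator_unitaryGroup (hf : Measurable f) :
    groupGenerator (P.unitaryGroup f) = P.operator f :=
  LinearPMap.eq_of_eq_graph (by rw [graph_groupGenerator, P.generatorGraph_unitaryGroup hf])

theorem eq_unitaryGroup (hf : Measurable f) {V : ℝ → E →L[ℂ] E} (hV : IsUnitaryGroup V)
    (h : groupGenerator V = P.operator f) : V = P.unitaryGroup f := by
  have hg : generatorGraph V = (P.operator f).graph := by rw [← graph_groupGenerator, h]
  refine (hV.eq_of_generatorGraph_eq (P.isUnitaryGroup hf)
    (by rw [hg, P.generatorGraph_unitaryGroup hf]) ?_ ?_)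
  · rw [P.generatorGraph_unitaryGroup hf]
    intro x y x' y' h1 h2
    exact P.symm_of_mem_graph hf h1 h2
  · rw [P.generatorGraph_unitaryGroup hf]
    convert P.dense_domain_operator hf using 1
    ext x
    exact LinearPMap.mem_domain_iff.symm

/-- The theorem of Stone for `∫ f dP`. -/
theorem unitaryExp_operator (hf : Measurable f) :
    unitaryExp (P.operator f) = P.unitaryGroup f := by
  have h : ∃ V : ℝ → E →L[ℂ] E, IsUnitaryGroup V ∧ groupGenerator V = P.operator f :=
    ⟨_, P.isUnitaryGroup hf, P.groupGenerator_unitaryGroup hf⟩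
  rw [unitaryExp, dif_pos h]
  exact P.eq_unitaryGroup hf h.choose_spec.1 h.choose_spec.2

/-! ### Uniqueness of spectral measures -/

theorem charFun_scalarMeasure (P : PVMeasure ℝ E) (x : E) (t : ℝ) :
    charFun (P.scalarMeasure x) t = ⟪x, P.unitaryGroup id t x⟫ := by
  rw [charFun_apply_real, unitaryGroup, P.inner_integral_self (isBddMeasurable_phase measurable_id t)]
  congr 1
  ext s
  congr 1
  simp only [id]
  push_cast
  ring

theorem charFun_add_measure {μ ν : Measure ℝ} [IsFiniteMeasure μ] [IsFiniteMeasure ν] (t : ℝ) :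
    charFun (μ + ν) t = charFun μ t + charFun ν t := by
  simp only [charFun_apply_real]
  have h : IsBddMeasurable fun s : ℝ => Complex.exp (t * s * Complex.I) :=
    ⟨by fun_prop, 1, fun s => by rw [← Complex.ofReal_mul, Complex.norm_exp_ofReal_mul_I]⟩
  exact integral_add_measure (h.integrable μ) (h.integrable ν)

variable {F : Type*} [NormedAddCommGroup F] [InnerProductSpace ℂ F] [CompleteSpace F]

/-- Matrix coefficients of the unitary groups determine those of the spectral projections. -/
theorem inner_proj_eq_of_inner_unitaryGroup_eq (P : PVMeasure ℝ E) (Q : PVMeasure ℝ F)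
    {x y : E} {x' y' : F}
    (h : ∀ t, ⟪x, P.unitaryGroup id t y⟫ = ⟪x', Q.unitaryGroup id t y'⟫)
    {B : Set ℝ} (hB : MeasurableSet B) : ⟪x, P.proj B y⟫ = ⟪x', Q.proj B y'⟫ := by
  have hconj : ∀ {μ : Measure ℝ} (t : ℝ), starRingEnd ℂ (charFun μ (-t)) = charFun μ t :=
    fun t => by rw [charFun_neg, Complex.conj_conj]
  -- Polarisation writes the hypothesis as `D₁ = i D₂`, where `D₁` and `D₂` are combinations of
  -- characteristic functions. Conjugation at `-t` gives `D₁ = -i D₂`, so both vanish. Moving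
  -- negative terms across leaves equal sums of positive measures, to which uniqueness of
  -- characteristic functions applies.
  have h1 : ∀ t,
      (charFun (P.scalarMeasure (x + y)) t - charFun (P.scalarMeasure (x - y)) t
        - (charFun (Q.scalarMeasure (x' + y')) t - charFun (Q.scalarMeasure (x' - y')) t))
      = Complex.I * (charFun (P.scalarMeasure (x + Complex.I • y)) t
        - charFun (P.scalarMeasure (x - Complex.I • y)) t
        - (charFun (Q.scalarMeasure (x' + Complex.I • y')) t
          - charFun (Q.scalarMeasure (x' - Complex.I • y')) t)) := by
    intro t
    have := h t
    rw [inner_polarization, inner_polarization (Q.unitaryGroup id t)] at this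
    simp only [charFun_scalarMeasure]
    linear_combination 4 * this
  have h2 : ∀ t,
      (charFun (P.scalarMeasure (x + y)) t - charFun (P.scalarMeasure (x - y)) t
        - (charFun (Q.scalarMeasure (x' + y')) t - charFun (Q.scalarMeasure (x' - y')) t))
      = -Complex.I * (charFun (P.scalarMeasure (x + Complex.I • y)) t
        - charFun (P.scalarMeasure (x - Complex.I • y)) t
        - (charFun (Q.scalarMeasure (x' + Complex.I • y')) t
          - charFun (Q.scalarMeasure (x' - Complex.I • y')) t)) := by
    intro t
    have := congrArg (starRingEnd ℂ) (h1 (-t))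
    simpa only [map_mul, map_sub, Complex.conj_I, hconj] using this
  have e1 : P.scalarMeasure (x + y) + Q.scalarMeasure (x' - y') =
      P.scalarMeasure (x - y) + Q.scalarMeasure (x' + y') := by
    refine Measure.ext_of_charFun (funext fun t => ?_)
    rw [charFun_add_measure, charFun_add_measure]
    linear_combination (1 / 2) * (h1 t) + (1 / 2) * h2 t
  have e2 : P.scalarMeasure (x + Complex.I • y) + Q.scalarMeasure (x' - Complex.I • y') =
      P.scalarMeasure (x - Complex.I • y) + Q.scalarMeasure (x' + Complex.I • y') := by
    refine Measure.ext_of_charFun (funext fun t => ?_)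
    rw [charFun_add_measure, charFun_add_measure]
    linear_combination (Complex.I / 2) * (h1 t) - (Complex.I / 2) * h2 t +
      (charFun (P.scalarMeasure (x + Complex.I • y)) t
        - charFun (P.scalarMeasure (x - Complex.I • y)) t
        - (charFun (Q.scalarMeasure (x' + Complex.I • y')) t
          - charFun (Q.scalarMeasure (x' - Complex.I • y')) t)) * Complex.I_mul_I
  have hadd : ∀ (μ ν : Measure ℝ) [IsFiniteMeasure μ] [IsFiniteMeasure ν],
      (μ + ν).real B = μ.real B + ν.real B := fun μ ν _ _ => measureReal_add_apply
  have f1 : ((_ : ℝ) : ℂ) = _ := congrArg (fun μ : Measure ℝ => ((μ.real B : ℝ) : ℂ)) e1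
  have f2 : ((_ : ℝ) : ℂ) = _ := congrArg (fun μ : Measure ℝ => ((μ.real B : ℝ) : ℂ)) e2
  rw [hadd, hadd, Complex.ofReal_add, Complex.ofReal_add, ← P.inner_proj _ hB, ← P.inner_proj _ hB,
    ← Q.inner_proj _ hB, ← Q.inner_proj _ hB] at f1 f2
  rw [inner_polarization, inner_polarization (Q.proj B)]
  linear_combination (1 / 4) * f1 - (Complex.I / 4) * f2

/-- The operator determines its unitary group, and the matrix coefficients of the group determine
those of the projections. -/
theorem proj_eq_of_operator_eq {P Q : PVMeasure ℝ E} (h : P.operator id = Q.operator id)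
    {B : Set ℝ} (hB : MeasurableSet B) : P.proj B = Q.proj B := by
  have hU : P.unitaryGroup id = Q.unitaryGroup id := by
    rw [← P.unitaryExp_operator measurable_id, h, Q.unitaryExp_operator measurable_id]
  refine ContinuousLinearMap.ext fun y => ext_inner_left ℂ fun x => ?_
  exact P.inner_proj_eq_of_inner_unitaryGroup_eq Q (fun t => by rw [hU]) hB

/-- A bounded operator commuting with the unitary group commutes with the projections. -/
theorem proj_comm_of_unitaryGroup_comm (P : PVMeasure ℝ E) {X : E →L[ℂ] E}
    (h : ∀ t x, P.unitaryGroup id t (X x) = X (P.unitaryGroup id t x)) {B : Set ℝ}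
    (hB : MeasurableSet B) (x : E) : P.proj B (X x) = X (P.proj B x) := by
  refine ext_inner_left ℂ fun z => ?_
  rw [← ContinuousLinearMap.adjoint_inner_left X]
  refine P.inner_proj_eq_of_inner_unitaryGroup_eq P (fun t => ?_) hB
  rw [h, ContinuousLinearMap.adjoint_inner_left]

end PVMeasure

/-- The functional calculus of an operator `∫ f dP`. -/
theorem borelCalculus_eq {Ω : Type*} [MeasurableSpace Ω] {E : Type*} [NormedAddCommGroup E]
    [InnerProductSpace ℂ E] [CompleteSpace E] (P : PVMeasure Ω E) {f : Ω → ℝ} (hf : Measurable f)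
    {g : ℝ → ℝ} (hg : Measurable g) :
    borelCalculus g hg (P.operator f) = P.operator (g ∘ f) := by
  have hgf : Measurable (g ∘ f) := hg.comp hf
  have h : ∃ L : E →ₗ.[ℂ] E, ∃ Q : ProjectionValuedMeasure E,
      Q.IsSpectralMeasureOf (P.operator f) ∧ (Q.map g hg).IsSpectralMeasureOf L :=
    ⟨P.operator (g ∘ f), P.toReal f hf, P.isSpectralMeasureOf_toReal hf,
      P.isSpectralMeasureOf_toReal hgf⟩
  rw [borelCalculus, dif_pos h]
  obtain ⟨Q, hQ, hL⟩ := h.choose_spec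
  set L := h.choose
  have e1 := PVMeasure.eq_operator_of_isSpectralMeasureOf hQ
  have e2 := PVMeasure.eq_operator_of_isSpectralMeasureOf (P.isSpectralMeasureOf_toReal hf)
  have hproj : ∀ B, MeasurableSet B → Q.proj B = P.proj (f ⁻¹' B) := fun B hB =>
    PVMeasure.proj_eq_of_operator_eq (P := PVMeasure.ofReal Q)
      (Q := PVMeasure.ofReal (P.toReal f hf)) (e1.symm.trans e2) hB
  have hsm : ∀ x, (Q.map g hg).scalarMeasure x = (P.toReal (g ∘ f) hgf).scalarMeasure x := by
    intro x
    refine Measure.ext fun B hB => ?_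
    have h1 : (Q.map g hg).scalarMeasure x B = ENNReal.ofReal (‖Q.proj (g ⁻¹' B) x‖ ^ 2) :=
      Measure.ofMeasurable_apply B hB
    have h2 : (P.toReal (g ∘ f) hgf).scalarMeasure x B =
        ENNReal.ofReal (‖P.proj ((g ∘ f) ⁻¹' B) x‖ ^ 2) := Measure.ofMeasurable_apply B hB
    rw [h1, h2, hproj _ (hg hB)]
    rfl
  have hM := P.isSpectralMeasureOf_toReal hgf
  have hdom : L.domain = (P.operator (g ∘ f)).domain := by
    ext x
    rw [hL.mem_domain_iff, hM.mem_domain_iff, hsm]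
  refine LinearPMap.eq_of_inner_self ?_ hdom fun x y hxy => ?_
  · rw [hdom]
    exact P.dense_domain_operator hgf
  · rw [hL.inner_apply, hM.inner_apply, hsm, hxy]

/-! ### Modular theory by means of real projections -/

section RealProjection

open ClosedSubmodule

theorem exists_real_projection {E : Type*} [NormedAddCommGroup E] [InnerProductSpace ℂ E]
    [CompleteSpace E] (K : ClosedSubmodule ℝ E) :
    ∃ p : E →L[ℝ] E, ∀ x, p x ∈ K ∧ ∀ h ∈ K, (⟪h, x - p x⟫).re = 0 := by
  have : CompleteSpace K.toSubmodule := K.isClosed.completeSpace_coe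
  refine ⟨K.toSubmodule.starProjection, fun x => ⟨K.toSubmodule.starProjection_apply_mem x,
    fun h hh => ?_⟩⟩
  exact K.toSubmodule.sub_starProjection_mem_orthogonal x h hh

end RealProjection

theorem Complex.inner_ext_re {E : Type*} [NormedAddCommGroup E] [InnerProductSpace ℂ E]
    {a b c d : E} (h1 : (⟪a, b⟫).re = (⟪c, d⟫).re)
    (h2 : (⟪a, Complex.I • b⟫).re = (⟪c, Complex.I • d⟫).re) : ⟪a, b⟫ = ⟪c, d⟫ := by
  rw [inner_smul_right, inner_smul_right] at h2
  refine Complex.ext h1 ?_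
  simpa using h2

namespace StandardSubspace

variable {E : Type*} [NormedAddCommGroup E] [InnerProductSpace ℂ E] [CompleteSpace E]
  (H : StandardSubspace E)

/-- The orthogonal projection onto `H` with respect to the real part of the inner product. -/
def realProj : E →L[ℝ] E := (exists_real_projection H.toClosedSubmodule).choose

theorem realProj_mem (x : E) : H.realProj x ∈ H.toClosedSubmodule :=
  ((exists_real_projection H.toClosedSubmodule).choose_spec x).1

theorem re_inner_sub_realProj {h : E} (hh : h ∈ H.toClosedSubmodule) (x : E) :
    (⟪h, x - H.realProj x⟫).re = 0 :=
  ((exists_real_projection H.toClosedSubmodule).choose_spec x).2 h hh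

theorem realProj_eq_of {x y : E} (hy : y ∈ H.toClosedSubmodule)
    (h : ∀ k ∈ H.toClosedSubmodule, (⟪k, x - y⟫).re = 0) : H.realProj x = y := by
  have hm : H.realProj x - y ∈ H.toClosedSubmodule :=
    H.toClosedSubmodule.toSubmodule.sub_mem (H.realProj_mem x) hy
  have h1 := h _ hm
  have h2 := H.re_inner_sub_realProj hm x
  have h3 : (⟪H.realProj x - y, H.realProj x - y⟫).re = 0 := by
    have e : H.realProj x - y = (x - y) - (x - H.realProj x) := by abel
    nth_rw 2 [e]
    rw [inner_sub_right, Complex.sub_re, h1, h2, sub_zero]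
  rw [← sub_eq_zero, ← inner_self_eq_zero (𝕜 := ℂ)]
  refine Complex.ext h3 ?_
  exact inner_self_im (𝕜 := ℂ) _

theorem realProj_eq_self {x : E} (hx : x ∈ H.toClosedSubmodule) : H.realProj x = x :=
  H.realProj_eq_of hx fun k _ => by simp

theorem re_inner_realProj_left (x y : E) :
    (⟪H.realProj x, y⟫).re = (⟪x, H.realProj y⟫).re := by
  have h1 := H.re_inner_sub_realProj (H.realProj_mem x) y
  have h2 := H.re_inner_sub_realProj (H.realProj_mem y) x
  rw [inner_sub_right, Complex.sub_re, sub_eq_zero] at h1 h2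
  have h3 : ∀ a b : E, (⟪a, b⟫).re = (⟪b, a⟫).re := fun a b => inner_re_symm (𝕜 := ℂ) a b
  rw [h1, h3 x, h2, h3]

/-- The orthogonal projection onto `i H`. -/
def imagProj (x : E) : E := Complex.I • H.realProj (-(Complex.I • x))

theorem imagProj_add (x y : E) : H.imagProj (x + y) = H.imagProj x + H.imagProj y := by
  simp only [imagProj, smul_add, neg_add, map_add]

theorem imagProj_imagProj (x : E) : H.imagProj (H.imagProj x) = H.imagProj x := by
  have : -(Complex.I • H.imagProj x) = H.realProj (-(Complex.I • x)) := by
    rw [imagProj, smul_smul, Complex.I_mul_I, neg_one_smul, neg_neg]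
  rw [imagProj, this, H.realProj_eq_self (H.realProj_mem _)]
  rfl

theorem I_smul_realProj (x : E) : Complex.I • H.realProj x = H.imagProj (Complex.I • x) := by
  rw [imagProj, smul_smul, Complex.I_mul_I, neg_one_smul, neg_neg]

theorem I_smul_imagProj (x : E) : Complex.I • H.imagProj x = H.realProj (Complex.I • x) := by
  rw [imagProj, smul_smul, Complex.I_mul_I, map_neg, neg_one_smul, neg_neg]

theorem re_inner_imagProj_left (x y : E) :
    (⟪H.imagProj x, y⟫).re = (⟪x, H.imagProj y⟫).re := by
  have h : ∀ a b : E, ⟪Complex.I • a, b⟫ = ⟪a, -(Complex.I • b)⟫ := fun a b => by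
    simp [inner_smul_right, mul_comm]
  have h' : ∀ a b : E, ⟪a, Complex.I • b⟫ = ⟪-(Complex.I • a), b⟫ := fun a b => by
    simp [inner_smul_left, mul_comm]
  rw [imagProj, imagProj, h, h', H.re_inner_realProj_left]

theorem realProj_smul (c : ℂ) (x : E) :
    H.realProj (c • x) = c.re • H.realProj x + c.im • H.realProj (Complex.I • x) := by
  have : c • x = c.re • x + c.im • (Complex.I • x) := by
    rw [← Complex.coe_smul, ← Complex.coe_smul, smul_smul, ← add_smul, Complex.re_add_im]
  rw [this, map_add, map_smul, map_smul]

theorem imagProj_smul (c : ℂ) (x : E) :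
    H.imagProj (c • x) = c.re • H.imagProj x + c.im • H.imagProj (Complex.I • x) := by
  simp only [imagProj]
  rw [smul_comm Complex.I c x, ← smul_neg, H.realProj_smul c, smul_add, smul_comm Complex.I,
    smul_comm Complex.I]
  congr 4
  simp

/-- The sum of the orthogonal projections onto `H` and `i H`. -/
def projSum : E →L[ℂ] E where
  toFun x := H.realProj x + H.imagProj x
  map_add' x y := by rw [map_add, imagProj_add]; abel
  map_smul' c x := by
    rw [H.realProj_smul, H.imagProj_smul, ← I_smul_realProj, ← I_smul_imagProj, RingHom.id_apply]
    conv_rhs => rw [← Complex.re_add_im c]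
    simp only [← Complex.coe_smul]
    module
  cont := by
    have : Continuous fun x => H.imagProj x := by unfold imagProj; fun_prop
    fun_prop

/-- The difference of the orthogonal projections onto `H` and `i H`. -/
def projDiff : E →ₗ⋆[ℂ] E where
  toFun x := H.realProj x - H.imagProj x
  map_add' x y := by rw [map_add, imagProj_add]; abel
  map_smul' c x := by
    rw [H.realProj_smul, H.imagProj_smul, ← I_smul_realProj, ← I_smul_imagProj]
    have hc : starRingEnd ℂ c = (c.re : ℂ) - c.im * Complex.I := by
      apply Complex.ext <;> simp
    rw [hc]
    simp only [← Complex.coe_smul]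
    module

theorem projSum_apply (x : E) : H.projSum x = H.realProj x + H.imagProj x := rfl

theorem projDiff_apply (x : E) : H.projDiff x = H.realProj x - H.imagProj x := rfl

theorem two_smul_realProj (x : E) : (2 : ℂ) • H.realProj x = H.projSum x + H.projDiff x := by
  rw [projSum_apply, projDiff_apply]
  module

theorem inner_projSum_left (x y : E) : ⟪H.projSum x, y⟫ = ⟪x, H.projSum y⟫ := by
  have h : ∀ x y, (⟪H.projSum x, y⟫).re = (⟪x, H.projSum y⟫).re := fun x y => by
    rw [projSum_apply, projSum_apply, inner_add_left, inner_add_right, Complex.add_re,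
      Complex.add_re, H.re_inner_realProj_left, H.re_inner_imagProj_left]
  refine Complex.inner_ext_re (h x y) ?_
  rw [h, map_smul]

theorem inner_projDiff_left (x y : E) : ⟪H.projDiff x, y⟫ = ⟪H.projDiff y, x⟫ := by
  have h : ∀ x y, (⟪H.projDiff x, y⟫).re = (⟪H.projDiff y, x⟫).re := fun x y => by
    rw [← inner_conj_symm (H.projDiff y), Complex.conj_re, projDiff_apply, projDiff_apply,
      inner_sub_left, inner_sub_right, Complex.sub_re,
      Complex.sub_re, H.re_inner_realProj_left, H.re_inner_imagProj_left]
  refine Complex.inner_ext_re (h x y) ?_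
  rw [h, LinearMap.map_smulₛₗ, inner_smul_left, inner_smul_right, Complex.conj_conj]

/-- With `R` for the sum and `T` for the difference, idempotence of the two projections gives `T² =
R (2 - R)`, and likewise `T R = (2 - R) T` below. These two relations carry the whole modular
theory. -/
theorem projDiff_projDiff (x : E) :
    H.projDiff (H.projDiff x) = (2 : ℂ) • H.projSum x - H.projSum (H.projSum x) := by
  have h1 := H.realProj_eq_self (H.realProj_mem x)
  have h2 := H.imagProj_imagProj x
  simp only [projSum_apply, projDiff_apply, map_add, map_sub, h1, h2]
  module

theorem projDiff_projSum (x : E) :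
    H.projDiff (H.projSum x) = (2 : ℂ) • H.projDiff x - H.projSum (H.projDiff x) := by
  have h1 := H.realProj_eq_self (H.realProj_mem x)
  have h2 := H.imagProj_imagProj x
  simp only [projSum_apply, projDiff_apply, map_add, map_sub, h1, h2]
  module

theorem inner_projDiff_projDiff (x y : E) :
    ⟪H.projDiff x, H.projDiff y⟫ = ⟪(2 : ℂ) • H.projSum y - H.projSum (H.projSum y), x⟫ := by
  rw [inner_projDiff_left, projDiff_projDiff]

theorem re_inner_realProj_self (x : E) : (⟪x, H.realProj x⟫).re = ‖H.realProj x‖ ^ 2 := by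
  rw [← H.re_inner_realProj_left]
  have h1 := H.re_inner_sub_realProj (H.realProj_mem x) x
  rw [inner_sub_right, Complex.sub_re, sub_eq_zero] at h1
  rw [h1]
  exact inner_self_eq_norm_sq (𝕜 := ℂ) _

theorem norm_imagProj (x : E) : ‖H.imagProj x‖ = ‖H.realProj (Complex.I • x)‖ := by
  rw [imagProj, map_neg, smul_neg, norm_neg, norm_smul, Complex.norm_I, one_mul]

theorem re_inner_imagProj_self (x : E) : (⟪x, H.imagProj x⟫).re = ‖H.imagProj x‖ ^ 2 := by
  rw [norm_imagProj, ← re_inner_realProj_self, ← I_smul_imagProj, inner_smul_left, inner_smul_right,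
    ← mul_assoc]
  simp

/-- Such an `x` is orthogonal to `H` in both the real and the imaginary part of the inner product,
hence to the closure of `H + iH`. -/
theorem eq_zero_of_realProj_eq_zero {x : E} (h1 : H.realProj x = 0) (h2 : H.imagProj x = 0) :
    x = 0 := by
  have hH : ∀ h ∈ H.toClosedSubmodule, ⟪h, x⟫ = 0 := by
    intro h hh
    refine Complex.ext ?_ ?_
    · simpa [h1] using H.re_inner_sub_realProj hh x
    · have h3 : H.realProj (Complex.I • x) = 0 := by rw [← I_smul_imagProj, h2, smul_zero]
      have := H.re_inner_sub_realProj hh (Complex.I • x)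
      rw [h3, sub_zero, inner_smul_right] at this
      simpa using this
  let K : ClosedSubmodule ℝ E :=
    { carrier := {y | ⟪y, x⟫ = 0}
      add_mem' := fun {a b} ha hb => by
        simp only [Set.mem_ofPred_eq] at *
        rw [inner_add_left, ha, hb, add_zero]
      zero_mem' := by simp
      smul_mem' := fun c y hy => by
        simp only [Set.mem_ofPred_eq] at *
        rw [← Complex.coe_smul, inner_smul_left, hy, mul_zero]
      isClosed' := isClosed_eq (by fun_prop) continuous_const }
  have hle : H.toClosedSubmodule ⊔ H.toClosedSubmodule.mulI ≤ K := by
    refine sup_le (fun h hh => hH h hh) fun h hh => ?_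
    have hh' : h ∈ H.toClosedSubmodule.mulI := hh
    rw [ClosedSubmodule.mem_mapEquiv_iff, scalarSMulCLE_symm_apply] at hh'
    have := hH _ hh'
    rw [Units.smul_def, inner_smul_left] at this
    exact (mul_eq_zero.1 this).resolve_left (by simp)
  rw [H.IsCyclic] at hle
  have : x ∈ K := hle trivial
  exact inner_self_eq_zero.1 this

theorem projSum_injective {x : E} (h : H.projSum x = 0) : x = 0 := by
  have h1 : (⟪x, H.projSum x⟫).re = 0 := by rw [h]; simp
  rw [projSum_apply, inner_add_right, Complex.add_re, re_inner_realProj_self,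
    re_inner_imagProj_self] at h1
  refine H.eq_zero_of_realProj_eq_zero ?_ ?_
  · have : ‖H.realProj x‖ ^ 2 = 0 := by nlinarith [sq_nonneg ‖H.realProj x‖, sq_nonneg ‖H.imagProj x‖]
    simpa using this
  · have : ‖H.imagProj x‖ ^ 2 = 0 := by nlinarith [sq_nonneg ‖H.realProj x‖, sq_nonneg ‖H.imagProj x‖]
    simpa using this

/-- `ζ = S_H η`. -/
def IsTomitaPair (η ζ : E) : Prop :=
  ∃ h ∈ H.toClosedSubmodule, ∃ k ∈ H.toClosedSubmodule,
    η = h + Complex.I • k ∧ ζ = h - Complex.I • k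

variable {H}

theorem IsTomitaPair.symm {η ζ : E} (h : H.IsTomitaPair η ζ) : H.IsTomitaPair ζ η := by
  obtain ⟨h, hh, k, hk, rfl, rfl⟩ := h
  refine ⟨h, hh, -k, H.toClosedSubmodule.toSubmodule.neg_mem hk, ?_, ?_⟩ <;> simp [sub_eq_add_neg]

theorem IsTomitaPair.eq_zero {η : E} (h : H.IsTomitaPair η 0) : η = 0 := by
  obtain ⟨h, hh, k, hk, rfl, h0⟩ := h
  have := H.eq_of_add_I_smul_eq (p := (h, -k)) (q := (0, 0))
    ⟨hh, H.toClosedSubmodule.toSubmodule.neg_mem hk⟩ ⟨zero_mem _, zero_mem _⟩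
    (by simpa [sub_eq_add_neg] using h0.symm)
  simp only [Prod.mk.injEq, neg_eq_zero] at this
  simp [this.1, this.2]

variable (H)

/-- On the range of `projSum` the unbounded Tomita operator is thus given by a bounded one: `S_H R =
T`. -/
theorem isTomitaPair_projSum_projDiff (x : E) :
    H.IsTomitaPair (H.projSum x) (H.projDiff x) :=
  ⟨H.realProj x, H.realProj_mem x, H.realProj (-(Complex.I • x)), H.realProj_mem _, rfl, rfl⟩

/-- `(2 - R) x = 0` gives `T² x = 0`, so `T x = 0` by symmetry of `T`. As `T x = S_H (R x)`,
injectivity of `S_H` and then of `R` finishes. -/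
theorem two_smul_sub_projSum_injective {x : E} (h : (2 : ℂ) • x - H.projSum x = 0) : x = 0 := by
  have h1 : H.projDiff (H.projDiff x) = 0 := by
    rw [projDiff_projDiff, ← map_smul, ← map_sub, h, map_zero]
  have h2 : ⟪H.projDiff x, H.projDiff x⟫ = 0 := by
    rw [inner_projDiff_left, h1, inner_zero_left]
  have h3 := H.isTomitaPair_projSum_projDiff x
  rw [inner_self_eq_zero.1 h2] at h3
  exact H.projSum_injective h3.eq_zero

/-- In other words `T z` is in the domain of the adjoint and `S_H* T z = (2 - R) z`. It suffices to
test against vectors of `H`, where the orthogonality of `z - p z` to `H` and of `z - q z` to `iH`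
controls real and imaginary parts. -/
theorem inner_tomitaPair {η ζ : E} (h : H.IsTomitaPair η ζ) (z : E) :
    ⟪ζ, H.projDiff z⟫ = ⟪(2 : ℂ) • z - H.projSum z, η⟫ := by
  have key : ∀ k ∈ H.toClosedSubmodule, ⟪k, H.projDiff z⟫ = ⟪(2 : ℂ) • z - H.projSum z, k⟫ := by
    intro k hk
    have h1 := H.re_inner_sub_realProj hk z
    have h2 := H.re_inner_sub_realProj hk (Complex.I • z)
    rw [← I_smul_imagProj, ← smul_sub, inner_smul_right] at h2
    have h2' : (⟪k, z - H.imagProj z⟫).im = 0 := by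
      rw [Complex.mul_re, Complex.I_re, Complex.I_im] at h2
      linarith
    rw [← inner_conj_symm _ k]
    have e1 : H.projDiff z = (z - H.imagProj z) - (z - H.realProj z) := by
      rw [projDiff_apply]; abel
    have e2 : (2 : ℂ) • z - H.projSum z = (z - H.imagProj z) + (z - H.realProj z) := by
      rw [projSum_apply]; module
    rw [e1, e2, inner_sub_right, inner_add_right]
    refine Complex.ext ?_ ?_
    · simp only [Complex.sub_re, map_add, Complex.add_re, Complex.conj_re, h1]
      ring
    · simp only [Complex.sub_im, map_add, Complex.add_im, Complex.conj_im, h2']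
      ring
  obtain ⟨h, hh, k, hk, rfl, rfl⟩ := h
  rw [inner_sub_left, inner_smul_left, inner_add_right, inner_smul_right, key h hh, key k hk,
    Complex.conj_I]
  ring

theorem isTomitaPair_tomita (x : H.tomita.domain) : H.IsTomitaPair x (H.tomita x) := by
  obtain ⟨p, hp, hx⟩ := x.2
  exact ⟨p.1, hp.1, p.2, hp.2, hx, H.tomitaValue_eq x hp.1 hp.2 hx⟩

theorem tomita_projSum (z : E) : ∃ x : H.tomita.domain, (x : E) = H.projSum z ∧
    H.tomita x = H.projDiff z := by
  obtain ⟨h, hh, k, hk, e1, e2⟩ := H.isTomitaPair_projSum_projDiff z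
  refine ⟨⟨H.projSum z, ⟨(h, k), ⟨hh, hk⟩, e1⟩⟩, rfl, ?_⟩
  rw [e2]
  exact H.tomitaValue_eq _ hh hk e1

/-- `S_H R = T` and `S_H* T = 2 - R` give one inclusion. For the other, the two coordinates must add
up to `2 z`, so `z` is half their sum; the error then has the form `(u, -u)` in the graph, whence
`‖S_H u‖² = -‖u‖²` and `u = 0`. -/
theorem mem_modularGraph_iff {x y : E} : (x, y) ∈ H.modularGraph ↔
    ∃ z, H.projSum z = x ∧ (2 : ℂ) • z - H.projSum z = y := by
  have hmem : ∀ z, (H.projSum z, (2 : ℂ) • z - H.projSum z) ∈ H.modularGraph := by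
    intro z
    obtain ⟨x, hx, hSx⟩ := H.tomita_projSum z
    exact ⟨x, hx, fun u => by rw [hSx]; exact H.inner_tomitaPair (H.isTomitaPair_tomita u) z⟩
  constructor
  · intro hxy
    refine ⟨(2⁻¹ : ℂ) • (x + y), ?_⟩
    set z := (2⁻¹ : ℂ) • (x + y)
    have hz : (2 : ℂ) • z = x + y := by simp [z, smul_smul]
    obtain ⟨u, hu, hSu⟩ := H.modularGraph.sub_mem hxy (hmem z)
    have hu' : (u : E) = x - H.projSum z := hu
    have h1 := hSu u
    have h2 : (y - ((2 : ℂ) • z - H.projSum z)) = -(u : E) := by rw [hu', hz]; abel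
    have h3 : ⟪H.tomita u, H.tomita u⟫ = ⟪y - ((2 : ℂ) • z - H.projSum z), (u : E)⟫ := h1
    rw [h2, inner_neg_left] at h3
    have h4 : ‖(u : E)‖ ^ 2 = 0 := by
      have e := congrArg Complex.re h3
      have e1 : (⟪H.tomita u, H.tomita u⟫).re = ‖H.tomita u‖ ^ 2 :=
        inner_self_eq_norm_sq (𝕜 := ℂ) _
      have e2 : (⟪(u : E), (u : E)⟫).re = ‖(u : E)‖ ^ 2 := inner_self_eq_norm_sq (𝕜 := ℂ) _
      rw [Complex.neg_re, e1, e2] at e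
      nlinarith [sq_nonneg ‖(u : E)‖, sq_nonneg ‖H.tomita u‖]
    have h5 : (u : E) = 0 := by simpa using h4
    rw [h5] at hu' h2
    constructor
    · exact (sub_eq_zero.1 hu'.symm).symm
    · rw [neg_zero, sub_eq_zero] at h2
      exact h2.symm
  · rintro ⟨z, rfl, rfl⟩
    exact hmem z

theorem mem_graph_modularOperator_iff {x y : E} : (x, y) ∈ H.modularOperator.graph ↔
    ∃ z, H.projSum z = x ∧ (2 : ℂ) • z - H.projSum z = y := by
  rw [← H.mem_modularGraph_iff, modularOperator, Submodule.toLinearPMap_graph_eq]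
  rintro ⟨a, b⟩ hab (rfl : a = 0)
  obtain ⟨z, h1, h2⟩ := H.mem_modularGraph_iff.1 hab
  rw [H.projSum_injective h1] at h2
  simpa using h2.symm

/-- The modular Hamiltonian is `∫ log f dP` if the sum of the projections onto `H` and `i H` is
`∫ b dP` with `2 - b = f b`. -/
theorem modularHamiltonian_eq {Ω : Type*} [MeasurableSpace Ω] (P : PVMeasure Ω E) {f : Ω → ℝ}
    (hf : Measurable f) {b : Ω → ℂ} (hb : IsBddMeasurable b) (hP : P.integral b = H.projSum)
    (h : ∀ z, ∀ᵐ ω ∂P.scalarMeasure z, 2 - b ω = f ω * b ω) :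
    H.modularHamiltonian = P.operator (Real.log ∘ f) := by
  have hc : IsBddMeasurable fun ω => 2 - b ω := (IsBddMeasurable.const 2).sub hb
  have hPc : P.integral (fun ω => 2 - b ω) = (2 : ℂ) • 1 - H.projSum := by
    rw [P.integral_sub (.const 2) hb, P.integral_const, hP]
  have : H.modularOperator = P.operator f := by
    refine LinearPMap.eq_of_eq_graph (Submodule.ext fun p => ?_)
    obtain ⟨x, y⟩ := p
    rw [P.mem_graph_operator_iff_exists hf hb hc h (d := 2⁻¹) (e := 2⁻¹) (fun ω => by ring), hP,
      hPc, H.mem_graph_modularOperator_iff]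
    rfl
  rw [modularHamiltonian, this, borelCalculus_eq P hf]

/-- The modular Hamiltonian as a spectral integral: `projSum = ∫ 2 / (1 + e^κ) dP` and
`log Δ_H = ∫ κ dP`. -/
theorem exists_spectral_modularHamiltonian : ∃ (Ω : Type) (_ : MeasurableSpace Ω)
    (P : PVMeasure Ω E) (κ : Ω → ℝ), Measurable κ ∧ H.modularHamiltonian = P.operator κ ∧
      P.integral (fun ω => ((2 / (1 + Real.exp (κ ω)) : ℝ) : ℂ)) = H.projSum := by
  have hsa : ContinuousLinearMap.adjoint H.projSum = H.projSum := by
    refine ContinuousLinearMap.ext fun x => ext_inner_left ℂ fun y => ?_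
    rw [ContinuousLinearMap.adjoint_inner_right, inner_projSum_left]
  have hn : IsStarNormal H.projSum := IsSelfAdjoint.isStarNormal (show star _ = _ from hsa)
  obtain ⟨Ω, _, P, b, hb, hP⟩ := exists_integral_eq_of_isStarNormal H.projSum hn
  have hre : ∀ x, ∀ᵐ ω ∂P.scalarMeasure x, b ω = ((b ω).re : ℂ) := by
    intro x
    have h0 : P.integral (fun ω => b ω - starRingEnd ℂ (b ω)) = 0 := by
      rw [P.integral_sub hb hb.conj, P.integral_conj hb, hP, hsa, sub_self]
    filter_upwards [P.ae_eq_zero_of_integral_eq_zero (hb.sub hb.conj) (x := x) (by simp [h0])]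
      with ω hω
    exact (Complex.conj_eq_iff_re.1 (sub_eq_zero.1 hω).symm).symm
  have h0 : ∀ x, ∀ᵐ ω ∂P.scalarMeasure x, b ω ≠ 0 := fun x =>
    P.ae_ne_zero_of_injective hb (fun v hv => H.projSum_injective (by rwa [hP] at hv)) x
  have h2 : ∀ x, ∀ᵐ ω ∂P.scalarMeasure x, 2 - b ω ≠ 0 := fun x =>
    P.ae_ne_zero_of_injective ((IsBddMeasurable.const 2).sub hb) (fun v hv =>
      H.two_smul_sub_projSum_injective (by
        rwa [P.integral_sub (.const 2) hb, P.integral_const, hP] at hv)) x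
  -- The spectral values of `Δ_H = (2 - R) R⁻¹`.
  let f : Ω → ℝ := fun ω => (2 - (b ω).re) / (b ω).re
  have hbre : Measurable fun ω => (b ω).re := Complex.measurable_re.comp hb.1
  have hf : Measurable f := (measurable_const.sub hbre).div hbre
  -- The form of `R (2 - R)` at `v` is `‖T v‖²`. Together with the injectivity of `R` and `2 - R`
  -- this places `b` strictly between `0` and `2`.
  have hmul : ∀ x, ∀ᵐ ω ∂P.scalarMeasure x, 0 ≤ (b ω * (2 - b ω)).re := fun x => by
    refine P.ae_re_nonneg_of_inner_nonneg (hb.mul ((IsBddMeasurable.const 2).sub hb)) (fun v => ?_) x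
    have h := H.inner_projDiff_projDiff v v
    rw [← map_smul, ← map_sub] at h
    rw [P.integral_mul hb ((IsBddMeasurable.const 2).sub hb), P.integral_sub (.const 2) hb,
      P.integral_const, hP]
    refine le_of_le_of_eq (inner_self_nonneg (𝕜 := ℂ)) ((congrArg Complex.re h).trans ?_)
    rw [← inner_conj_symm, Complex.conj_re]
    rfl
  have hpos : ∀ x, ∀ᵐ ω ∂P.scalarMeasure x, 0 < (b ω).re ∧ (b ω).re < 2 := by
    intro x
    filter_upwards [hre x, h0 x, h2 x, hmul x] with ω e1 e2 e3 e4
    rw [e1] at e2 e3 e4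
    have e2' : (b ω).re ≠ 0 := fun h => e2 (by simp [h])
    have e3' : (b ω).re ≠ 2 := fun h => e3 (by simp [h])
    have e4' : 0 ≤ (b ω).re * (2 - (b ω).re) := by simpa using e4
    rcases lt_or_gt_of_ne e2' with h | h
    · nlinarith
    · refine ⟨h, lt_of_le_of_ne ?_ e3'⟩
      by_contra hlt
      nlinarith
  refine ⟨Ω, _, P, Real.log ∘ f, Real.measurable_log.comp hf,
    H.modularHamiltonian_eq P hf hb hP fun x => ?_, ?_⟩
  · filter_upwards [hre x, hpos x] with ω e1 e2
    rw [e1]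
    simp only [f, ← Complex.ofReal_mul, div_mul_cancel₀ _ e2.1.ne']
    push_cast
    rfl
  · rw [← hP]
    refine ContinuousLinearMap.ext fun x => P.integral_congr_ae ?_ hb ?_
    · refine ⟨Complex.measurable_ofReal.comp (measurable_const.div (measurable_const.add
        (Real.measurable_exp.comp (Real.measurable_log.comp hf)))), 2, fun ω => ?_⟩
      rw [Complex.norm_real, Real.norm_of_nonneg (by positivity)]
      refine div_le_self zero_le_two ?_
      linarith [Real.exp_pos ((Real.log ∘ f) ω)]
    · filter_upwards [hre x, hpos x] with ω e1 e2
      conv_rhs => rw [e1]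
      have hf0 : 0 < f ω := div_pos (by linarith [e2.2]) e2.1
      rw [Function.comp_apply, Real.exp_log hf0]
      congr 1
      have := e2.1.ne'
      simp only [f]
      field_simp
      ring

/-! ### Unitaries preserving a standard subspace -/

theorem realProj_unitary {U : E →L[ℂ] E} (hU : U ∈ unitary (E →L[ℂ] E))
    (hUH : U '' (H.toClosedSubmodule : Set E) = H.toClosedSubmodule) (x : E) :
    H.realProj (U x) = U (H.realProj x) := by
  have hin : ∀ a b, ⟪U a, U b⟫ = ⟪a, b⟫ := fun a b => by
    rw [← ContinuousLinearMap.adjoint_inner_left, ← mul_apply_eq_comp,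
      ← ContinuousLinearMap.star_eq_adjoint, (Unitary.mem_iff.1 hU).1]
    rfl
  refine H.realProj_eq_of ?_ fun k hk => ?_
  · have : U (H.realProj x) ∈ (H.toClosedSubmodule : Set E) := by
      rw [← hUH]
      exact ⟨_, H.realProj_mem x, rfl⟩
    exact this
  · have hk' : k ∈ (H.toClosedSubmodule : Set E) := hk
    rw [← hUH] at hk'
    obtain ⟨k', hk', rfl⟩ := hk'
    rw [← map_sub, hin]
    exact H.re_inner_sub_realProj hk' x

theorem projSum_unitary {U : E →L[ℂ] E} (hU : U ∈ unitary (E →L[ℂ] E))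
    (hUH : U '' (H.toClosedSubmodule : Set E) = H.toClosedSubmodule) (x : E) :
    H.projSum (U x) = U (H.projSum x) := by
  simp only [projSum_apply, imagProj, ← map_smul, ← map_neg, H.realProj_unitary hU hUH, map_add]

theorem projDiff_unitary {U : E →L[ℂ] E} (hU : U ∈ unitary (E →L[ℂ] E))
    (hUH : U '' (H.toClosedSubmodule : Set E) = H.toClosedSubmodule) (x : E) :
    H.projDiff (U x) = U (H.projDiff x) := by
  simp only [projDiff_apply, imagProj, ← map_smul, ← map_neg, H.realProj_unitary hU hUH, map_sub]

end StandardSubspace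

/-! ### Tensor powers -/

section TensorPower

variable {E : Type*} [NormedAddCommGroup E] [InnerProductSpace ℂ E]

theorem inner_algMonomial (n : ℕ) (v w : Fin (n + 1) → E) :
    ⟪algMonomial n v, algMonomial n w⟫ = ∏ i, ⟪v i, w i⟫ := by
  induction n with
  | zero =>
    rw [Fin.prod_univ_one]
    rfl
  | succ n ih =>
    rw [Fin.prod_univ_castSucc]
    exact (TensorProduct.inner_tmul ℂ (algMonomial n (Fin.init v)) (algMonomial n (Fin.init w))
      (v (Fin.last (n + 1))) (w (Fin.last (n + 1)))).trans (by rw [ih]; rfl)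

theorem algOperatorPower_algMonomial (T : E →L[ℂ] E) (n : ℕ) (v : Fin (n + 1) → E) :
    algOperatorPower T n (algMonomial n v) = algMonomial n fun i => T (v i) := by
  induction n with
  | zero => rfl
  | succ n ih =>
    refine (TensorProduct.mapL_tmul (algOperatorPower T n) T (algMonomial n (Fin.init v))
      (v (Fin.last (n + 1)))).trans ?_
    rw [ih]
    rfl

theorem span_range_algMonomial (n : ℕ) :
    Submodule.span ℂ (Set.range (algMonomial (E := E) n)) = ⊤ := by
  induction n with
  | zero =>
    refine Submodule.eq_top_iff'.2 fun x => Submodule.subset_span ⟨fun _ => x, rfl⟩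
  | succ n ih =>
    refine Submodule.eq_top_iff'.2 fun x => ?_
    have hx : x ∈ Submodule.span ℂ {t : AlgTensorPower E n ⊗[ℂ] E | ∃ m k, m ⊗ₜ[ℂ] k = t} := by
      rw [TensorProduct.span_tmul_eq_top]
      trivial
    have hle : Submodule.span ℂ {t : AlgTensorPower E n ⊗[ℂ] E | ∃ m k, m ⊗ₜ[ℂ] k = t} ≤
        (Submodule.span ℂ (Set.range (algMonomial (E := E) (n + 1))) :
          Submodule ℂ (AlgTensorPower E n ⊗[ℂ] E)) := by
      refine Submodule.span_le.2 ?_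
      rintro _ ⟨m, k, rfl⟩
      have hm : m ∈ Submodule.span ℂ (Set.range (algMonomial (E := E) n)) := by rw [ih]; trivial
      change m ⊗ₜ[ℂ] k ∈ (Submodule.span ℂ (Set.range (algMonomial (E := E) (n + 1))) :
          Submodule ℂ (AlgTensorPower E n ⊗[ℂ] E))
      induction hm using Submodule.span_induction with
      | mem x hx =>
        obtain ⟨v, rfl⟩ := hx
        refine Submodule.subset_span ⟨Fin.snoc v k, ?_⟩
        change algMonomial n (Fin.init (Fin.snoc v k : Fin (n + 2) → E)) ⊗ₜ[ℂ]
          (Fin.snoc v k : Fin (n + 2) → E) (Fin.last (n + 1)) = _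
        rw [Fin.init_snoc, Fin.snoc_last]
      | zero => rw [TensorProduct.zero_tmul]; exact Submodule.zero_mem _
      | add x y _ _ hx hy => rw [TensorProduct.add_tmul]; exact Submodule.add_mem _ hx hy
      | smul a x _ hx => rw [← TensorProduct.smul_tmul']; exact Submodule.smul_mem _ _ hx
    exact hle hx

/-- Induction on tensors for closed properties. -/
theorem HilbertTensorPower.induction {n : ℕ} {p : HilbertTensorPower E n → Prop}
    (hcl : IsClosed {x | p x}) (h0 : p 0) (hadd : ∀ x y, p x → p y → p (x + y))
    (hsmul : ∀ (c : ℂ) x, p x → p (c • x))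
    (hmono : ∀ v : Fin (n + 1) → E, p (algMonomial n v : HilbertTensorPower E n))
    (x : HilbertTensorPower E n) : p x := by
  refine UniformSpace.Completion.induction_on x hcl fun a => ?_
  have ha : a ∈ Submodule.span ℂ (Set.range (algMonomial (E := E) n)) := by
    rw [span_range_algMonomial]; trivial
  induction ha using Submodule.span_induction with
  | mem x hx =>
    obtain ⟨v, rfl⟩ := hx
    exact hmono v
  | zero => rw [UniformSpace.Completion.coe_zero]; exact h0
  | add x y _ _ hx hy => rw [UniformSpace.Completion.coe_add]; exact hadd _ _ hx hy
  | smul a x _ hx => rw [UniformSpace.Completion.coe_smul]; exact hsmul _ _ hx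

theorem inner_coe_algMonomial (n : ℕ) (v w : Fin (n + 1) → E) :
    ⟪(algMonomial n v : HilbertTensorPower E n), (algMonomial n w : HilbertTensorPower E n)⟫ =
      ∏ i, ⟪v i, w i⟫ := by
  rw [UniformSpace.Completion.inner_coe, inner_algMonomial]

theorem operatorPower_algMonomial (T : E →L[ℂ] E) (n : ℕ) (v : Fin (n + 1) → E) :
    operatorPower T n (algMonomial n v : HilbertTensorPower E n) =
      (algMonomial n fun i => T (v i) : HilbertTensorPower E n) := by
  rw [operatorPower, ContinuousLinearMap.completion_apply_coe, algOperatorPower_algMonomial]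

theorem HilbertTensorPower.clm_ext {n : ℕ} {S T : HilbertTensorPower E n →L[ℂ] HilbertTensorPower E n}
    (h : ∀ v : Fin (n + 1) → E, S (algMonomial n v : HilbertTensorPower E n) =
      T (algMonomial n v : HilbertTensorPower E n)) : S = T := by
  refine ContinuousLinearMap.ext fun x => ?_
  refine HilbertTensorPower.induction (p := fun x => S x = T x)
    (isClosed_eq S.continuous T.continuous) (by simp) (fun x y hx hy => ?_) (fun c x hx => ?_) h x
  · simp only [map_add, hx, hy]
  · simp only [map_smul, hx]

theorem operatorPower_mul (S T : E →L[ℂ] E) (n : ℕ) :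
    operatorPower (S * T) n = operatorPower S n * operatorPower T n := by
  refine HilbertTensorPower.clm_ext fun v => ?_
  rw [mul_apply_eq_comp, operatorPower_algMonomial, operatorPower_algMonomial,
    operatorPower_algMonomial]
  rfl

theorem inner_operatorPower {S T : E →L[ℂ] E} (h : ∀ x y, ⟪S x, y⟫ = ⟪x, T y⟫) (n : ℕ)
    (ξ η : HilbertTensorPower E n) :
    ⟪operatorPower S n ξ, η⟫ = ⟪ξ, operatorPower T n η⟫ := by
  refine HilbertTensorPower.induction
    (p := fun ξ => ⟪operatorPower S n ξ, η⟫ = ⟪ξ, operatorPower T n η⟫)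
    (isClosed_eq (by fun_prop) (by fun_prop)) (by simp) (fun x y hx hy => ?_) (fun c x hx => ?_)
    (fun v => ?_) ξ
  · simp only [map_add, inner_add_left, hx, hy]
  · simp only [map_smul, inner_smul_left, hx]
  refine HilbertTensorPower.induction
    (p := fun η => ⟪operatorPower S n (algMonomial n v : HilbertTensorPower E n), η⟫ =
      ⟪(algMonomial n v : HilbertTensorPower E n), operatorPower T n η⟫)
    (isClosed_eq (by fun_prop) (by fun_prop)) (by simp) (fun x y hx hy => ?_) (fun c x hx => ?_)
    (fun w => ?_) η
  · simp only [map_add, inner_add_right, hx, hy]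
  · simp only [map_smul, inner_smul_right, hx]
  · simp only [operatorPower_algMonomial, inner_coe_algMonomial, h]

theorem ContinuousLinearMap.norm_completion_le {F G : Type*} [NormedAddCommGroup F]
    [NormedSpace ℂ F] [NormedAddCommGroup G] [NormedSpace ℂ G] (T : F →L[ℂ] G) :
    ‖T.completion‖ ≤ ‖T‖ := by
  refine ContinuousLinearMap.opNorm_le_bound _ (norm_nonneg _) fun x => ?_
  refine UniformSpace.Completion.induction_on x (isClosed_le (by fun_prop) (by fun_prop))
    fun a => ?_
  rw [ContinuousLinearMap.completion_apply_coe, UniformSpace.Completion.norm_coe,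
    UniformSpace.Completion.norm_coe]
  exact T.le_opNorm a

theorem ContinuousLinearMap.isBoundedLinearMap_completion (F : Type*) [NormedAddCommGroup F]
    [NormedSpace ℂ F] : IsBoundedLinearMap ℂ fun T : F →L[ℂ] F => T.completion where
  map_add S T := by
    refine ContinuousLinearMap.ext fun x => ?_
    refine UniformSpace.Completion.induction_on x (isClosed_eq (S + T).completion.continuous
      (S.completion + T.completion).continuous) fun a => ?_
    rw [add_apply, ContinuousLinearMap.completion_apply_coe,
      ContinuousLinearMap.completion_apply_coe, ContinuousLinearMap.completion_apply_coe,
      add_apply, UniformSpace.Completion.coe_add]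
  map_smul c T := by
    refine ContinuousLinearMap.ext fun x => ?_
    refine UniformSpace.Completion.induction_on x (isClosed_eq (c • T).completion.continuous
      (c • T.completion).continuous) fun a => ?_
    rw [smul_apply, ContinuousLinearMap.completion_apply_coe,
      ContinuousLinearMap.completion_apply_coe, smul_apply, UniformSpace.Completion.coe_smul]
  bound := ⟨1, one_pos, fun T => by
    rw [one_mul]
    exact T.norm_completion_le⟩

theorem norm_algOperatorPower_le {T : E →L[ℂ] E} (hT : ‖T‖ ≤ 1) (n : ℕ) :
    ‖algOperatorPower T n‖ ≤ 1 := by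
  induction n with
  | zero => exact hT
  | succ n ih =>
    exact (TensorProduct.norm_mapL_le (algOperatorPower T n) T).trans
      (mul_le_one₀ ih (norm_nonneg _) hT)

theorem norm_operatorPower_le {T : E →L[ℂ] E} (hT : ‖T‖ ≤ 1) (n : ℕ) :
    ‖operatorPower T n‖ ≤ 1 :=
  (algOperatorPower T n).norm_completion_le.trans (norm_algOperatorPower_le hT n)

theorem DifferentiableAt.bilinear {X Y Z : Type*} [NormedAddCommGroup X] [NormedSpace ℂ X]
    [NormedAddCommGroup Y] [NormedSpace ℂ Y] [NormedAddCommGroup Z] [NormedSpace ℂ Z]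
    {B : X → Y → Z} (add_left : ∀ x x' y, B (x + x') y = B x y + B x' y)
    (smul_left : ∀ (c : ℂ) x y, B (c • x) y = c • B x y)
    (add_right : ∀ x y y', B x (y + y') = B x y + B x y')
    (smul_right : ∀ (c : ℂ) x y, B x (c • y) = c • B x y) (bound : ∀ x y, ‖B x y‖ ≤ ‖x‖ * ‖y‖)
    {S : ℂ → X} {T : ℂ → Y} {z : ℂ} (hS : DifferentiableAt ℂ S z) (hT : DifferentiableAt ℂ T z) :
    DifferentiableAt ℂ (fun z => B (S z) (T z)) z :=
  ((LinearMap.mkContinuous₂ (LinearMap.mk₂ ℂ B add_left smul_left add_right smul_right) 1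
    (fun x y => by rw [one_mul]; exact bound x y)).differentiableAt.comp z hS).clm_apply hT

/-- The tensor product of operators is a bounded bilinear map, so the product rule applies factor by
factor. -/
theorem DifferentiableAt.algOperatorPower {T : ℂ → E →L[ℂ] E} {z : ℂ}
    (h : DifferentiableAt ℂ T z) (n : ℕ) :
    DifferentiableAt ℂ (fun z => algOperatorPower (T z) n) z := by
  induction n with
  | zero => exact h
  | succ n ih =>
    let B : (AlgTensorPower E n →L[ℂ] AlgTensorPower E n) → (E →L[ℂ] E) →
        AlgTensorPower E (n + 1) →L[ℂ] AlgTensorPower E (n + 1) := fun S T =>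
      (TensorProduct.mapL S T :
        AlgTensorPower E n ⊗[ℂ] E →L[ℂ] AlgTensorPower E n ⊗[ℂ] E)
    exact DifferentiableAt.bilinear (B := B)
      (fun S S' T => TensorProduct.mapL_add_left S S' T)
      (fun c S T => TensorProduct.mapL_smul_left c S T)
      (fun S T T' => TensorProduct.mapL_add_right S T T')
      (fun c S T => TensorProduct.mapL_smul_right c S T)
      (fun S T => TensorProduct.norm_mapL_le S T) ih h

theorem DifferentiableAt.operatorPower {T : ℂ → E →L[ℂ] E} {z : ℂ}
    (h : DifferentiableAt ℂ T z) (n : ℕ) :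
    DifferentiableAt ℂ (fun z => operatorPower (T z) n) z :=
  (ContinuousLinearMap.isBoundedLinearMap_completion (AlgTensorPower E n)).differentiableAt.comp z
    (h.algOperatorPower n)

theorem tendsto_algMonomial {ι : Type*} {l : Filter ι} {n : ℕ} {v : ι → Fin (n + 1) → E}
    {w : Fin (n + 1) → E} (h : ∀ i, Tendsto (fun k => v k i) l (𝓝 (w i))) :
    Tendsto (fun k => algMonomial n (v k)) l (𝓝 (algMonomial n w)) := by
  induction n with
  | zero => exact h 0
  | succ n ih =>
    have h1 := ih (v := fun k => Fin.init (v k)) (w := Fin.init w) fun i => h i.castSucc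
    have h2 := h (Fin.last (n + 1))
    have hc : Continuous fun p : AlgTensorPower E n × E => (p.1 ⊗ₜ[ℂ] p.2 : AlgTensorPower E n ⊗[ℂ] E) :=
      TensorProduct.continuous_tmul
    exact (hc.tendsto (algMonomial n (Fin.init w), w (Fin.last (n + 1)))).comp (h1.prodMk_nhds h2)

/-- The uniform norm bound makes the set of tensors with convergence closed, so that monomials
suffice. -/
theorem tendsto_operatorPower {T : ℕ → E →L[ℂ] E} (hT : ∀ k, ‖T k‖ ≤ 1)
    (h : ∀ x, Tendsto (fun k => T k x) atTop (𝓝 x)) (n : ℕ) (ξ : HilbertTensorPower E n) :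
    Tendsto (fun k => operatorPower (T k) n ξ) atTop (𝓝 ξ) := by
  refine HilbertTensorPower.induction
    (p := fun ξ => Tendsto (fun k => operatorPower (T k) n ξ) atTop (𝓝 ξ))
    ?_ (by simp) (fun x y hx hy => ?_) (fun c x hx => ?_) (fun v => ?_) ξ
  · refine isClosed_of_closure_subset fun x hx => ?_
    rw [Set.mem_ofPred_eq, Metric.tendsto_atTop]
    intro ε hε
    obtain ⟨y, hy, hxy⟩ := Metric.mem_closure_iff.1 hx (ε / 3) (by positivity)
    obtain ⟨N, hN⟩ := Metric.tendsto_atTop.1 hy (ε / 3) (by positivity)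
    refine ⟨N, fun k hk => ?_⟩
    have h1 : dist (operatorPower (T k) n x) (operatorPower (T k) n y) ≤ dist x y := by
      rw [dist_eq_norm, dist_eq_norm, ← map_sub]
      refine (ContinuousLinearMap.le_opNorm _ _).trans ?_
      exact mul_le_of_le_one_left (norm_nonneg _) (norm_operatorPower_le (hT k) n)
    have h2 := hN k hk
    have h3 := dist_triangle4 (operatorPower (T k) n x) (operatorPower (T k) n y) y x
    rw [dist_comm y x] at h3
    linarith
  · simpa using hx.add hy
  · simpa using hx.const_smul c
  · simp only [operatorPower_algMonomial]
    exact (UniformSpace.Completion.continuous_coe _).continuousAt.tendsto.comp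
      (tendsto_algMonomial fun i => h (v i))

end TensorPower

/-! ### Truncated exponentials -/

namespace PVMeasure

variable {Ω : Type*} [MeasurableSpace Ω] {E : Type*} [NormedAddCommGroup E] [InnerProductSpace ℂ E]
  [CompleteSpace E] (P : PVMeasure Ω E) {f : Ω → ℝ}

/-- The function `e^{z f}` truncated to the set on which `|f| ≤ n`. -/
def expTruncation (f : Ω → ℝ) (n : ℕ) (z : ℂ) : Ω → ℂ :=
  (levelSet f n).indicator fun ω => Complex.exp (z * f ω)

theorem isBddMeasurable_expTruncation (hf : Measurable f) (n : ℕ) (z : ℂ) :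
    IsBddMeasurable (expTruncation f n z) := by
  refine ⟨Measurable.indicator (by fun_prop) (measurableSet_levelSet hf n),
    Real.exp (‖z‖ * n), fun ω => ?_⟩
  by_cases h : ω ∈ levelSet f n
  · rw [expTruncation, Set.indicator_of_mem h, Complex.norm_exp, Real.exp_le_exp]
    refine (Complex.re_le_norm _).trans ?_
    rw [norm_mul, Complex.norm_real]
    exact mul_le_mul_of_nonneg_left h (norm_nonneg _)
  · rw [expTruncation, Set.indicator_of_notMem h, norm_zero]
    positivity

theorem integral_expTruncation_zero (hf : Measurable f) (n : ℕ) :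
    P.integral (expTruncation f n 0) = P.proj (levelSet f n) := by
  rw [← P.integral_indicator_one (measurableSet_levelSet hf n)]
  congr 1
  ext ω
  simp [expTruncation]

theorem integral_expTruncation_add (hf : Measurable f) (n : ℕ) (z w : ℂ) :
    P.integral (expTruncation f n (z + w)) =
      P.integral (expTruncation f n z) * P.integral (expTruncation f n w) := by
  rw [← P.integral_mul (isBddMeasurable_expTruncation hf n z) (isBddMeasurable_expTruncation hf n w)]
  congr 1
  ext ω
  by_cases h : ω ∈ levelSet f n
  · simp [expTruncation, h, ← Complex.exp_add, add_mul]
  · simp [expTruncation, h]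

theorem inner_integral_expTruncation (hf : Measurable f) (n : ℕ) (s : ℝ) (x y : E) :
    ⟪P.integral (expTruncation f n s) x, y⟫ = ⟪x, P.integral (expTruncation f n s) y⟫ := by
  rw [← ContinuousLinearMap.adjoint_inner_right, ← P.integral_conj
    (isBddMeasurable_expTruncation hf n s)]
  congr 3
  ext ω
  by_cases h : ω ∈ levelSet f n
  · simp [expTruncation, h, ← Complex.exp_conj]
  · simp [expTruncation, h]

theorem integral_expTruncation_mul_I (hf : Measurable f) (n : ℕ) (t : ℝ) :
    P.integral (expTruncation f n (Complex.I * t)) =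
      P.unitaryGroup f t * P.proj (levelSet f n) := by
  rw [← P.integral_indicator_one (measurableSet_levelSet hf n), unitaryGroup,
    ← P.integral_mul (isBddMeasurable_phase hf t) (.indicator_one (measurableSet_levelSet hf n))]
  congr 1
  ext ω
  by_cases h : ω ∈ levelSet f n
  · simp [expTruncation, h, mul_assoc]
  · simp [expTruncation, h]

theorem differentiableAt_integral_expTruncation (hf : Measurable f) (n : ℕ) :
    DifferentiableAt ℂ (fun z => P.integral (expTruncation f n z)) 0 := by
  have h : HasDerivAt (fun z => P.integral (expTruncation f n z)) (P.integral (truncation f n)) 0 := by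
    rw [hasDerivAt_iff_isLittleO]
    -- The estimate `|e^w - 1 - w| ≤ |w|²` for `|w| ≤ 1`, with `w = z f` and `|f| ≤ n` on the level
    -- set, is uniform in `ω` and gives the constant `n²`.
    have hO : (fun z : ℂ => P.integral (expTruncation f n z) - P.integral (expTruncation f n 0) -
        (z - 0) • P.integral (truncation f n)) =O[𝓝 0] fun z : ℂ => z ^ 2 := by
      refine Asymptotics.IsBigO.of_bound ((n : ℝ) ^ 2) ?_
      have hev : ∀ᶠ z : ℂ in 𝓝 0, ‖z‖ * n < 1 := by
        have : Tendsto (fun z : ℂ => ‖z‖ * n) (𝓝 0) (𝓝 (‖(0 : ℂ)‖ * n)) :=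
          (continuous_norm.mul continuous_const).tendsto 0
        refine this.eventually_lt_const ?_
        simp
      filter_upwards [hev] with z hz
      rw [sub_zero, ← P.integral_const_mul _ (isBddMeasurable_truncation hf n),
        ← P.integral_sub (isBddMeasurable_expTruncation hf n z)
          (isBddMeasurable_expTruncation hf n 0),
        ← P.integral_sub ((isBddMeasurable_expTruncation hf n z).sub
          (isBddMeasurable_expTruncation hf n 0)) ((isBddMeasurable_truncation hf n).const_mul z)]
      refine P.norm_integral_le (by positivity) (((isBddMeasurable_expTruncation hf n z).sub
        (isBddMeasurable_expTruncation hf n 0)).sub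
          ((isBddMeasurable_truncation hf n).const_mul z)).1 fun ω => ?_
      by_cases h : ω ∈ levelSet f n
      · simp only [expTruncation, truncation, Set.indicator_of_mem h, zero_mul, Complex.exp_zero]
        have h1 : ‖z * (f ω : ℂ)‖ ≤ ‖z‖ * n := by
          rw [norm_mul, Complex.norm_real]
          exact mul_le_mul_of_nonneg_left h (norm_nonneg _)
        refine (Complex.norm_exp_sub_one_sub_id_le (h1.trans hz.le)).trans ?_
        rw [norm_pow, mul_comm (_ ^ 2), ← mul_pow]
        exact pow_le_pow_left₀ (norm_nonneg _) h1 2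
      · simp only [expTruncation, truncation, Set.indicator_of_notMem h, mul_zero, sub_zero, norm_zero]
        positivity
    refine hO.trans_isLittleO ?_
    simp only [sub_zero]
    exact Asymptotics.isLittleO_pow_id one_lt_two
  exact h.differentiableAt

end PVMeasure

theorem hasDerivAt_iff_mem_generatorGraph {E : Type*} [NormedAddCommGroup E]
    [InnerProductSpace ℂ E] {V : ℝ → E →L[ℂ] E} (hV : V 0 = 1) {x y : E} :
    HasDerivAt (fun t => V t x) (Complex.I • y) 0 ↔ (x, y) ∈ generatorGraph V := by
  rw [hasDerivAt_iff_tendsto_slope_zero]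
  change _ ↔ Tendsto (fun t : ℝ => (Complex.I * (t : ℂ))⁻¹ • (V t x - x)) (𝓝[≠] 0) (𝓝 y)
  have e : ∀ t : ℝ, t⁻¹ • (V (0 + t) x - V 0 x) =
      Complex.I • (Complex.I * (t : ℂ))⁻¹ • (V t x - x) := fun t => by
    rw [zero_add, hV, one_apply_eq_self, smul_smul, mul_inv, ← mul_assoc, mul_inv_cancel₀
      Complex.I_ne_zero, one_mul, ← Complex.coe_smul, Complex.ofReal_inv]
  simp only [e]
  constructor
  · intro h
    have := h.const_smul (-Complex.I)
    simpa only [smul_smul (-Complex.I) Complex.I, neg_mul, Complex.I_mul_I, neg_neg, one_smul]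
      using this
  · intro h
    exact h.const_smul Complex.I

/-! ### Tensor powers of unitary groups on spectrally bounded vectors -/

section TensorGroup

variable {Ω : Type*} [MeasurableSpace Ω] {E : Type*} [NormedAddCommGroup E] [InnerProductSpace ℂ E]
  [CompleteSpace E] (P : PVMeasure Ω E) {f : Ω → ℝ}

theorem operatorPower_one (n : ℕ) : operatorPower (1 : E →L[ℂ] E) n = 1 :=
  HilbertTensorPower.clm_ext fun v => by rw [operatorPower_algMonomial]; rfl

/-- On such vectors the group is the restriction to the imaginary axis of a family that is complex
differentiable in norm at `0`; the derivative of that family supplies `η`. -/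
theorem PVMeasure.exists_mem_generatorGraph_operatorPower (hf : Measurable f) {n N : ℕ}
    {ξ : HilbertTensorPower E n}
    (hξ : operatorPower (P.proj (PVMeasure.levelSet f N)) n ξ = ξ) :
    ∃ η, (ξ, η) ∈ generatorGraph fun t => operatorPower (P.unitaryGroup f t) n := by
  have h0 : operatorPower (P.unitaryGroup f 0) n = 1 := by
    rw [P.unitaryGroup_zero, operatorPower_one]
  have hd : DifferentiableAt ℂ (fun z =>
      operatorPower (P.integral (PVMeasure.expTruncation f N z)) n ξ) 0 :=
    ((P.differentiableAt_integral_expTruncation hf N).operatorPower n).clm_apply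
      (differentiableAt_const ξ)
  have hl : HasDerivAt (fun t : ℝ => Complex.I * (t : ℂ)) Complex.I 0 := by
    simpa using (Complex.ofRealCLM.hasDerivAt (x := 0)).const_mul Complex.I
  have hd' := hd.hasDerivAt
  have e0 : Complex.I * ((0 : ℝ) : ℂ) = 0 := by simp
  rw [← e0] at hd'
  have h2 := hd'.scomp (0 : ℝ) hl
  refine ⟨deriv (fun z => operatorPower (P.integral (PVMeasure.expTruncation f N z)) n ξ)
    (Complex.I * ((0 : ℝ) : ℂ)), (hasDerivAt_iff_mem_generatorGraph
    (V := fun t => operatorPower (P.unitaryGroup f t) n) h0).1 ?_⟩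
  refine h2.congr_of_eventuallyEq (Eventually.of_forall fun t => ?_)
  simp only [Function.comp_apply]
  rw [P.integral_expTruncation_mul_I hf, operatorPower_mul, mul_apply_eq_comp, hξ]

end TensorGroup

/-! ### Tomita pairs and real tensor powers -/

section RealTensorPower

variable {E : Type*} [NormedAddCommGroup E] [InnerProductSpace ℂ E]

/-- The additive group generated by the monomials with factors in `H`. -/
def algRealTensorPower (H : Submodule ℝ E) (n : ℕ) : AddSubgroup (AlgTensorPower E n) :=
  AddSubgroup.closure {x | ∃ v : Fin (n + 1) → E, (∀ i, v i ∈ H) ∧ x = algMonomial n v}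

theorem tmul_mem_algRealTensorPower {H : Submodule ℝ E} {n : ℕ} {x : AlgTensorPower E n}
    (hx : x ∈ algRealTensorPower H n) {a : E} (ha : a ∈ H) :
    (x ⊗ₜ[ℂ] a : AlgTensorPower E n ⊗[ℂ] E) ∈
      (algRealTensorPower H (n + 1) : AddSubgroup (AlgTensorPower E n ⊗[ℂ] E)) := by
  induction hx using AddSubgroup.closure_induction with
  | mem x hx =>
    obtain ⟨v, hv, rfl⟩ := hx
    refine AddSubgroup.subset_closure ⟨Fin.snoc v a, fun i => ?_, ?_⟩
    · refine Fin.lastCases ?_ (fun j => ?_) i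
      · rwa [Fin.snoc_last]
      · rw [Fin.snoc_castSucc]
        exact hv j
    · change _ = algMonomial n (Fin.init (Fin.snoc v a : Fin (n + 2) → E)) ⊗ₜ[ℂ]
        (Fin.snoc v a : Fin (n + 2) → E) (Fin.last (n + 1))
      rw [Fin.init_snoc, Fin.snoc_last]
  | zero => rw [TensorProduct.zero_tmul]; exact AddSubgroup.zero_mem _
  | add x y _ _ hx hy => rw [TensorProduct.add_tmul]; exact AddSubgroup.add_mem _ hx hy
  | neg x _ hx => rw [TensorProduct.neg_tmul]; exact AddSubgroup.neg_mem _ hx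

theorem coe_mem_realTensorPower {H : Submodule ℝ E} {n : ℕ} {x : AlgTensorPower E n}
    (hx : x ∈ algRealTensorPower H n) :
    (x : HilbertTensorPower E n) ∈ realTensorPower H n := by
  induction hx using AddSubgroup.closure_induction with
  | mem x hx =>
    obtain ⟨v, hv, rfl⟩ := hx
    exact Submodule.le_topologicalClosure _ (Submodule.subset_span ⟨v, hv, rfl⟩)
  | zero => rw [UniformSpace.Completion.coe_zero]; exact Submodule.zero_mem _
  | add x y _ _ hx hy => rw [UniformSpace.Completion.coe_add]; exact Submodule.add_mem _ hx hy
  | neg x _ hx => rw [UniformSpace.Completion.coe_neg]; exact Submodule.neg_mem _ hx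

variable [CompleteSpace E] {H : StandardSubspace E}

/-- Decompositions multiply like complex numbers: `(a + i b) ⊗ (c + i d)` has components `a ⊗ c - b
⊗ d` and `a ⊗ d + b ⊗ c`, and changing the sign of `i` in each factor changes it in the product. -/
theorem StandardSubspace.exists_algMonomial_eq {n : ℕ} {v w : Fin (n + 1) → E}
    (h : ∀ i, H.IsTomitaPair (v i) (w i)) :
    ∃ a ∈ algRealTensorPower H.toClosedSubmodule.toSubmodule n,
    ∃ b ∈ algRealTensorPower H.toClosedSubmodule.toSubmodule n,
      algMonomial n v = a + Complex.I • b ∧ algMonomial n w = a - Complex.I • b := by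
  induction n with
  | zero =>
    obtain ⟨a, ha, b, hb, h1, h2⟩ := h 0
    exact ⟨a, AddSubgroup.subset_closure ⟨fun _ => a, fun _ => ha, rfl⟩, b,
      AddSubgroup.subset_closure ⟨fun _ => b, fun _ => hb, rfl⟩, h1, h2⟩
  | succ n ih =>
    obtain ⟨a, ha, b, hb, h1, h2⟩ := ih (v := Fin.init v) (w := Fin.init w) fun i => h i.castSucc
    obtain ⟨c, hc, d, hd, h3, h4⟩ := h (Fin.last (n + 1))
    refine ⟨(a ⊗ₜ[ℂ] c - b ⊗ₜ[ℂ] d : AlgTensorPower E n ⊗[ℂ] E),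
      AddSubgroup.sub_mem _ (tmul_mem_algRealTensorPower ha hc) (tmul_mem_algRealTensorPower hb hd),
      (a ⊗ₜ[ℂ] d + b ⊗ₜ[ℂ] c : AlgTensorPower E n ⊗[ℂ] E),
      AddSubgroup.add_mem _ (tmul_mem_algRealTensorPower ha hd) (tmul_mem_algRealTensorPower hb hc),
      ?_, ?_⟩
    · change (algMonomial n (Fin.init v) ⊗ₜ[ℂ] v (Fin.last (n + 1)) : AlgTensorPower E n ⊗[ℂ] E) =
        (a ⊗ₜ[ℂ] c - b ⊗ₜ[ℂ] d) + Complex.I • (a ⊗ₜ[ℂ] d + b ⊗ₜ[ℂ] c)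
      rw [h1, h3, TensorProduct.add_tmul, TensorProduct.tmul_add, TensorProduct.tmul_add,
        TensorProduct.tmul_smul, TensorProduct.tmul_smul,
        ← TensorProduct.smul_tmul', ← TensorProduct.smul_tmul', smul_smul, Complex.I_mul_I]
      module
    · change (algMonomial n (Fin.init w) ⊗ₜ[ℂ] w (Fin.last (n + 1)) : AlgTensorPower E n ⊗[ℂ] E) =
        (a ⊗ₜ[ℂ] c - b ⊗ₜ[ℂ] d) - Complex.I • (a ⊗ₜ[ℂ] d + b ⊗ₜ[ℂ] c)
      rw [h2, h4, TensorProduct.sub_tmul, TensorProduct.tmul_sub, TensorProduct.tmul_sub,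
        TensorProduct.tmul_smul, TensorProduct.tmul_smul,
        ← TensorProduct.smul_tmul', ← TensorProduct.smul_tmul', smul_smul, Complex.I_mul_I]
      module

/-- The sum is twice the first component. These are the test vectors for activity. -/
theorem StandardSubspace.algMonomial_add_mem {n : ℕ} {v w : Fin (n + 1) → E}
    (h : ∀ i, H.IsTomitaPair (v i) (w i)) :
    (algMonomial n v + algMonomial n w : HilbertTensorPower E n) ∈
      realTensorPower H.toClosedSubmodule.toSubmodule n := by
  obtain ⟨a, ha, b, -, h1, h2⟩ := StandardSubspace.exists_algMonomial_eq h
  have e : algMonomial n v + algMonomial n w = a + a := by rw [h1, h2]; abel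
  rw [← UniformSpace.Completion.coe_add, e]
  exact coe_mem_realTensorPower (AddSubgroup.add_mem _ ha ha)

end RealTensorPower

/-! ### Consequences of activity -/

theorem IsActive.re_inner_nonneg {E : Type*} [NormedAddCommGroup E] [InnerProductSpace ℂ E]
    {A : E →ₗ.[ℂ] E} {K : Submodule ℝ E} (h : IsActive A K) {x y : E} (hx : x ∈ K)
    (hxy : (x, y) ∈ A.graph) : 0 ≤ (⟪x, y⟫).re := by
  obtain ⟨z, hz, hAz⟩ := A.mem_graph_iff.1 hxy
  have := h z (by rwa [hz])
  rwa [hz, hAz] at this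

section Activity

variable {E : Type*} [NormedAddCommGroup E] [InnerProductSpace ℂ E] [CompleteSpace E]

theorem PVMeasure.hasDerivAt_inner_unitaryGroup {Ω : Type*} [MeasurableSpace Ω] (P : PVMeasure Ω E)
    {f : Ω → ℝ} (hf : Measurable f) {N : ℕ} {x : E}
    (hx : P.proj (PVMeasure.levelSet f N) x = x) :
    HasDerivAt (fun t => ⟪x, P.unitaryGroup f t x⟫)
      (Complex.I * ((∫ ω, f ω ∂P.scalarMeasure x : ℝ) : ℂ)) 0 := by
  have hd := P.proj_levelSet_mem_domain hf x N
  rw [hx, LinearPMap.mem_domain_iff] at hd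
  obtain ⟨y, hy⟩ := hd
  rw [← P.inner_of_mem_graph hf hy, ← inner_smul_right]
  rw [← P.generatorGraph_unitaryGroup hf,
    ← hasDerivAt_iff_mem_generatorGraph P.unitaryGroup_zero] at hy
  simpa using (hasDerivAt_const (0 : ℝ) x).inner ℂ hy

theorem hasDerivAt_prod_inner_unitaryGroup {Ω : Type*} [MeasurableSpace Ω] (P : PVMeasure Ω E)
    {f : Ω → ℝ} (hf : Measurable f) {N n : ℕ} {v : Fin n → E}
    (hv : ∀ i, P.proj (PVMeasure.levelSet f N) (v i) = v i) :
    HasDerivAt (fun t => ∏ i, ⟪v i, P.unitaryGroup f t (v i)⟫)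
      (Complex.I * ((∑ j, (∏ i ∈ Finset.univ.erase j, ‖v i‖ ^ 2) *
        ∫ ω, f ω ∂P.scalarMeasure (v j) : ℝ) : ℂ)) 0 := by
  refine (HasDerivAt.fun_finsetProd fun i _ =>
    P.hasDerivAt_inner_unitaryGroup hf (hv i)).congr_deriv ?_
  push_cast
  rw [Finset.mul_sum]
  refine Finset.sum_congr rfl fun j _ => ?_
  rw [smul_eq_mul, ← mul_assoc, mul_comm _ Complex.I, ← mul_assoc]
  congr 2
  refine Finset.prod_congr rfl fun i _ => ?_
  rw [P.unitaryGroup_zero, one_apply_eq_self, inner_self_eq_norm_sq_to_K]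
  rfl

variable {H : StandardSubspace E}

/-- Activity, tested on `v₀ ⊗ ⋯ ⊗ vₙ + S v₀ ⊗ ⋯ ⊗ S vₙ`. -/
theorem IsSuccActive.sum_mul_prod_le {P : PVMeasure ℝ E} {n N : ℕ}
    (hact : IsSuccActive n (P.operator id) H.toClosedSubmodule.toSubmodule)
    {v w : Fin (n + 1) → E} (hvw : ∀ i, H.IsTomitaPair (v i) (w i))
    (hv : ∀ i, P.proj (PVMeasure.levelSet id N) (v i) = v i)
    (hw : ∀ i, P.proj (PVMeasure.levelSet id N) (w i) = w i)
    (i₀ : Fin (n + 1)) (h0 : ∀ t, ⟪v i₀, P.unitaryGroup id t (w i₀)⟫ = 0)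
    (h0' : ∀ t, ⟪w i₀, P.unitaryGroup id t (v i₀)⟫ = 0) {l r : Fin (n + 1) → ℝ}
    (hr : ∀ i, ∫ a, a ∂P.scalarMeasure (v i) ≤ r i * ‖v i‖ ^ 2)
    (hl : ∀ i, ∫ a, a ∂P.scalarMeasure (w i) ≤ - l i * ‖w i‖ ^ 2) :
    (∑ i, l i) * ∏ i, ‖w i‖ ^ 2 ≤ (∑ i, r i) * ∏ i, ‖v i‖ ^ 2 := by
  rw [IsSuccActive, P.unitaryExp_operator measurable_id] at hact
  set ξ : HilbertTensorPower E n := algMonomial n v + algMonomial n w with hξ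
  have hξN : operatorPower (P.proj (PVMeasure.levelSet id N)) n ξ = ξ := by
    rw [hξ, map_add, operatorPower_algMonomial, operatorPower_algMonomial, funext hv, funext hw]
  obtain ⟨η, hη⟩ := P.exists_mem_generatorGraph_operatorPower measurable_id hξN
  have hnn : 0 ≤ (⟪ξ, η⟫).re := hact.re_inner_nonneg (StandardSubspace.algMonomial_add_mem hvw)
    (by rw [graph_groupGenerator]; exact hη)
  have hU0 : operatorPower (P.unitaryGroup id 0) n = 1 := by
    rw [P.unitaryGroup_zero, operatorPower_one]
  -- The form `⟪ξ, η⟫` is read off from the derivative at `0` of the matrix coefficient, which by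
  -- the product rule is a sum of one-factor expectations.
  have h1 : HasDerivAt (fun t => ⟪ξ, operatorPower (P.unitaryGroup id t) n ξ⟫)
      (Complex.I * ⟪ξ, η⟫) 0 := by
    have := (hasDerivAt_iff_mem_generatorGraph
      (V := fun t => operatorPower (P.unitaryGroup id t) n) hU0).2 hη
    simpa [inner_smul_right] using (hasDerivAt_const (0 : ℝ) ξ).inner ℂ this
  have h2 := (hasDerivAt_prod_inner_unitaryGroup P measurable_id hv).add
    (hasDerivAt_prod_inner_unitaryGroup P measurable_id hw)
  -- The cross terms are products containing the factor at `i₀`, which is zero.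
  have h3 : (fun t => ⟪ξ, operatorPower (P.unitaryGroup id t) n ξ⟫) = fun t =>
      ∏ i, ⟪v i, P.unitaryGroup id t (v i)⟫ + ∏ i, ⟪w i, P.unitaryGroup id t (w i)⟫ := by
    ext t
    rw [hξ, map_add, operatorPower_algMonomial, operatorPower_algMonomial, inner_add_left,
      inner_add_right, inner_add_right, inner_coe_algMonomial, inner_coe_algMonomial,
      inner_coe_algMonomial, inner_coe_algMonomial,
      Finset.prod_eq_zero (f := fun i => ⟪v i, P.unitaryGroup id t (w i)⟫) (Finset.mem_univ i₀)
        (h0 t),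
      Finset.prod_eq_zero (f := fun i => ⟪w i, P.unitaryGroup id t (v i)⟫) (Finset.mem_univ i₀)
        (h0' t), add_zero, zero_add]
  rw [h3] at h1
  have h4 := h1.unique h2
  rw [← mul_add] at h4
  have h5 := mul_left_cancel₀ Complex.I_ne_zero h4
  rw [h5, ← Complex.ofReal_add, Complex.ofReal_re] at hnn
  have key : ∀ (u : Fin (n + 1) → E) (c : Fin (n + 1) → ℝ),
      (∀ i, ∫ a, a ∂P.scalarMeasure (u i) ≤ c i * ‖u i‖ ^ 2) →
      ∑ j, (∏ i ∈ Finset.univ.erase j, ‖u i‖ ^ 2) * ∫ a, id a ∂P.scalarMeasure (u j) ≤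
        (∑ i, c i) * ∏ i, ‖u i‖ ^ 2 := fun u c hc => by
    rw [Finset.sum_mul]
    refine Finset.sum_le_sum fun j _ => ?_
    rw [← Finset.mul_prod_erase _ _ (Finset.mem_univ j), ← mul_assoc, mul_comm]
    exact mul_le_mul_of_nonneg_right (hc j) (Finset.prod_nonneg fun i _ => sq_nonneg _)
  have h6 := key v r hr
  have h7 := key w (fun i => - l i) hl
  rw [Finset.sum_neg_distrib] at h7
  linarith

theorem PVMeasure.ae_mem_of_proj_eq {Ω : Type*} [MeasurableSpace Ω] (P : PVMeasure Ω E)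
    {B : Set Ω} (hB : MeasurableSet B) {x : E} (hx : P.proj B x = x) :
    ∀ᵐ ω ∂P.scalarMeasure x, ω ∈ B := by
  have h := P.scalarMeasure_proj hB x
  rw [hx] at h
  rw [h]
  exact ae_restrict_mem hB

theorem PVMeasure.proj_eq_self_of_subset {Ω : Type*} [MeasurableSpace Ω] (P : PVMeasure Ω E)
    {B C : Set Ω} (hB : MeasurableSet B) (hC : MeasurableSet C) (h : B ⊆ C) {x : E}
    (hx : P.proj B x = x) : P.proj C x = x := by
  rw [← hx, P.proj_proj_inter hC hB, Set.inter_eq_right.2 h]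

theorem PVMeasure.integral_id_le (P : PVMeasure ℝ E) {l r : ℝ} {x : E}
    (hx : P.proj (Set.Icc l r) x = x) : ∫ a, a ∂P.scalarMeasure x ≤ r * ‖x‖ ^ 2 := by
  have hae := P.ae_mem_of_proj_eq measurableSet_Icc hx
  have hinteg : Integrable (fun a : ℝ => a) (P.scalarMeasure x) := by
    refine Integrable.of_bound measurable_id.aestronglyMeasurable (max |l| |r|) ?_
    filter_upwards [hae] with a ha
    exact abs_le_max_abs_abs ha.1 ha.2
  calc ∫ a, a ∂P.scalarMeasure x ≤ ∫ _, r ∂P.scalarMeasure x := by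
        refine integral_mono_ae hinteg (integrable_const r) ?_
        filter_upwards [hae] with a ha
        exact ha.2
    _ = r * ‖x‖ ^ 2 := by
        rw [MeasureTheory.integral_const, P.scalarMeasure_real_univ, smul_eq_mul, mul_comm]

theorem PVMeasure.inner_unitaryGroup_eq_zero (P : PVMeasure ℝ E) {B C : Set ℝ}
    (hB : MeasurableSet B) (hC : MeasurableSet C) (h : Disjoint B C) {x y : E}
    (hx : P.proj B x = x) (hy : P.proj C y = y) (t : ℝ) :
    ⟪x, P.unitaryGroup id t y⟫ = 0 := by
  rw [← hx, P.inner_proj_left hB, unitaryGroup,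
    P.proj_integral_comm hB (isBddMeasurable_phase measurable_id t), ← hy,
    P.proj_proj_inter hB hC, h.inter_eq]
  have : P.proj ∅ = 0 := by
    have := P.proj_mul_of_disjoint (B := ∅) (C := ∅) MeasurableSet.empty MeasurableSet.empty
      (by simp)
    rwa [(P.isStarProjection ∅ MeasurableSet.empty).isIdempotentElem] at this
  rw [this]
  simp

/-- A Tomita pair `(η, ζ)` with `η` in the spectral subspace of `[l, r]` and `ζ` in the spectral
subspace of `[-r, -l]`. -/
structure IsSpectralPair (H : StandardSubspace E) (P : PVMeasure ℝ E) (l r : ℝ) (η ζ : E) :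
    Prop where
  isTomitaPair : H.IsTomitaPair η ζ
  proj_fst : P.proj (Set.Icc l r) η = η
  proj_snd : P.proj (Set.Icc (-r) (-l)) ζ = ζ

theorem IsSpectralPair.symm {P : PVMeasure ℝ E} {l r : ℝ} {η ζ : E}
    (h : IsSpectralPair H P l r η ζ) : IsSpectralPair H P (-r) (-l) ζ η :=
  ⟨h.1.symm, h.3, by rw [neg_neg, neg_neg]; exact h.2⟩

/-- As `l i₀ > 0`, the intervals `[l, r]` and `[-r, -l]` at `i₀` are disjoint, and this one factor
kills both cross terms. The other pairs may lie anywhere in the spectrum. -/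
theorem IsCompletelyActive.sum_mul_prod_le {P : PVMeasure ℝ E}
    (hact : IsCompletelyActive (P.operator id) H.toClosedSubmodule.toSubmodule)
    {ι : Type*} [Fintype ι] {v w : ι → E} {l r : ι → ℝ}
    (h : ∀ i, IsSpectralPair H P (l i) (r i) (v i) (w i)) (i₀ : ι) (h0 : 0 < l i₀) :
    (∑ i, l i) * ∏ i, ‖w i‖ ^ 2 ≤ (∑ i, r i) * ∏ i, ‖v i‖ ^ 2 := by
  -- The tensor power with parameter `n` has `n + 1` factors; `i₀` guarantees at least one.
  obtain ⟨n, hn⟩ : ∃ n, Fintype.card ι = n + 1 :=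
    Nat.exists_eq_succ_of_ne_zero (Fintype.card_pos_iff.2 ⟨i₀⟩).ne'
  let e : Fin (n + 1) ≃ ι := ((Fintype.equivFin ι).trans (finCongr hn)).symm
  rw [← e.sum_comp, ← e.sum_comp, ← e.prod_comp, ← e.prod_comp]
  obtain ⟨N, hN⟩ := exists_nat_ge (∑ i, (|l i| + |r i|))
  have hN' : ∀ i, |l i| ≤ N ∧ |r i| ≤ N := fun i => by
    have := Finset.single_le_sum (f := fun i => |l i| + |r i|) (fun j _ => by positivity)
      (Finset.mem_univ i)
    constructor <;> linarith [abs_nonneg (l i), abs_nonneg (r i)]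
  have hsub : ∀ i, Set.Icc (l i) (r i) ⊆ PVMeasure.levelSet id N := fun i a ha =>
    (abs_le_max_abs_abs ha.1 ha.2).trans (max_le (hN' i).1 (hN' i).2)
  have hsub' : ∀ i, Set.Icc (-r i) (-l i) ⊆ PVMeasure.levelSet id N := fun i a ha =>
    (abs_le_max_abs_abs ha.1 ha.2).trans (by
      rw [abs_neg, abs_neg]
      exact max_le (hN' i).2 (hN' i).1)
  have hm := PVMeasure.measurableSet_levelSet (f := (id : ℝ → ℝ)) measurable_id N
  have hd : Disjoint (Set.Icc (l i₀) (r i₀)) (Set.Icc (-r i₀) (-l i₀)) := by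
    rw [Set.disjoint_left]
    intro a h1 h2
    linarith [h1.1, h2.2]
  refine (hact n).sum_mul_prod_le (N := N) (fun i => (h (e i)).1)
    (fun i => P.proj_eq_self_of_subset measurableSet_Icc hm (hsub (e i)) (h (e i)).2)
    (fun i => P.proj_eq_self_of_subset measurableSet_Icc hm (hsub' (e i)) (h (e i)).3)
    (e.symm i₀) ?_ ?_ (fun i => P.integral_id_le (h (e i)).2) (fun i => P.integral_id_le (h (e i)).3)
  · rw [e.apply_symm_apply]
    exact P.inner_unitaryGroup_eq_zero measurableSet_Icc measurableSet_Icc hd (h i₀).2 (h i₀).3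
  · rw [e.apply_symm_apply]
    exact P.inner_unitaryGroup_eq_zero measurableSet_Icc measurableSet_Icc hd.symm (h i₀).3 (h i₀).2

/-- Fixed constants cannot compensate the growth of `(a / b) ^ m`. -/
theorem le_of_forall_mul_pow_le {a b c d : ℝ} (hc : 0 < c) (hb : 0 ≤ b)
    (h : ∀ m : ℕ, 0 < m → c * a ^ m ≤ d * b ^ m) : a ≤ b := by
  by_contra! hab
  have ha : 0 < a := hb.trans_lt hab
  have hlim : Tendsto (fun m : ℕ => d * (b / a) ^ m) atTop (𝓝 (d * 0)) :=
    (tendsto_pow_atTop_nhds_zero_of_lt_one (by positivity) ((div_lt_one ha).2 hab)).const_mul d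
  have hle : c ≤ d * 0 := by
    refine ge_of_tendsto hlim ?_
    filter_upwards [eventually_gt_atTop 0] with m hm
    rw [div_pow, mul_div_assoc', le_div_iff₀ (by positivity)]
    exact h m hm
  rw [mul_zero] at hle
  exact hle.not_gt hc

/-- The two pairs are repeated `p m` and `q m` times. After division by `m` the weights `p l + q l'`
and `p r + q r'` do not depend on `m`, and letting `m` grow removes them. -/
theorem IsCompletelyActive.pow_mul_pow_le {P : PVMeasure ℝ E}
    (hact : IsCompletelyActive (P.operator id) H.toClosedSubmodule.toSubmodule)
    {l r l' r' : ℝ} {η ζ η' ζ' : E} (h : IsSpectralPair H P l r η ζ)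
    (h' : IsSpectralPair H P l' r' η' ζ') {p q : ℕ} (hpos : 0 < p * l + q * l') :
    (‖ζ‖ ^ 2) ^ p * (‖ζ'‖ ^ 2) ^ q ≤ (‖η‖ ^ 2) ^ p * (‖η'‖ ^ 2) ^ q := by
  refine le_of_forall_mul_pow_le (d := p * r + q * r') hpos (by positivity) fun m hm => ?_
  have hm' : (0 : ℝ) < m := Nat.cast_pos.2 hm
  let ι := Fin (p * m) ⊕ Fin (q * m)
  have hS : ∀ i : ι, IsSpectralPair H P (Sum.elim (fun _ => l) (fun _ => l') i)
      (Sum.elim (fun _ => r) (fun _ => r') i) (Sum.elim (fun _ => η) (fun _ => η') i)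
      (Sum.elim (fun _ => ζ) (fun _ => ζ') i) := by
    rintro (i | i)
    · exact h
    · exact h'
  -- If no occurring lower bound were positive, `p l + q l'` could not be either.
  obtain ⟨i₀, hi₀⟩ : ∃ i : ι, 0 < Sum.elim (fun _ => l) (fun _ => l') i := by
    by_contra! hcon
    have h1 : (p : ℝ) * l ≤ 0 := by
      rcases Nat.eq_zero_or_pos p with rfl | hp
      · simp
      · have := hcon (Sum.inl ⟨0, Nat.mul_pos hp hm⟩)
        exact mul_nonpos_of_nonneg_of_nonpos (Nat.cast_nonneg _) this
    have h2 : (q : ℝ) * l' ≤ 0 := by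
      rcases Nat.eq_zero_or_pos q with rfl | hp
      · simp
      · have := hcon (Sum.inr ⟨0, Nat.mul_pos hp hm⟩)
        exact mul_nonpos_of_nonneg_of_nonpos (Nat.cast_nonneg _) this
    linarith
  have key := hact.sum_mul_prod_le hS i₀ hi₀
  simp only [ι, Fintype.sum_sum_type, Fintype.prod_sum_type, Sum.elim_inl, Sum.elim_inr,
    Finset.sum_const, Finset.prod_const, Finset.card_univ, Fintype.card_fin, nsmul_eq_mul,
    Nat.cast_mul] at key
  rw [mul_pow, mul_pow, ← pow_mul, ← pow_mul, ← pow_mul, ← pow_mul, ← pow_mul, ← pow_mul,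
    ← pow_mul, ← pow_mul]
  rw [← pow_mul, ← pow_mul, ← pow_mul, ← pow_mul] at key
  simp only [mul_assoc] at key ⊢
  nlinarith [key]

end Activity

/-- The bounds for a symmetric family of triples `(l, r, k)` such that `p k + q k' ≤ 0` whenever
`p l + q l' > 0`. -/
theorem exists_slope {S : ℝ → ℝ → ℝ → Prop} (hsymm : ∀ l r k, S l r k → S (-r) (-l) (-k))
    (hS : ∀ l r k l' r' k', S l r k → S l' r' k' → ∀ p q : ℕ, 0 < p * l + q * l' →
      p * k + q * k' ≤ 0)
    (hne : ∃ l r k, S l r k ∧ 0 < l) :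
    ∃ c ≤ 0, ∀ l r k, S l r k → c * r ≤ k ∧ k ≤ c * l := by
  -- Every upper constraint on the slope is compatible with every lower one. The hypothesis is used
  -- with the reflected second triple, so that `q r' < p l` yields `p k ≤ q k'`.
  have hle : ∀ l r k l' r' k', S l r k → S l' r' k' → 0 < l → 0 < r' → k / l ≤ k' / r' := by
    intro l r k l' r' k' h h' hl hr'
    have hrat : ∀ p q : ℕ, (q : ℝ) * r' < p * l → (p : ℝ) * k ≤ q * k' := fun p q hpq => by
      have := hS _ _ _ _ _ _ h (hsymm _ _ _ h') p q (by linarith)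
      linarith
    by_contra! hcon
    rw [div_lt_div_iff₀ hr' hl] at hcon
    have hk : k ≤ 0 := by
      have := hrat 1 0 (by simpa using hl)
      simpa using this
    have hk' : k' < 0 := by
      by_contra! h0
      nlinarith
    have hlt : k / k' < l / r' := by
      rw [div_lt_iff_of_neg hk', div_mul_eq_mul_div, div_lt_iff₀ hr']
      linarith
    -- The rational `θ = q / p` satisfies `θ r' < l`, hence `k ≤ θ k'`, which contradicts `k / k' <
    -- θ` because `k' < 0`.
    obtain ⟨θ, h1, h2⟩ := exists_rat_btwn hlt
    have hθ : 0 < θ := by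
      have : (0 : ℝ) < θ := (div_nonneg_of_nonpos hk hk'.le).trans_lt h1
      exact_mod_cast this
    have hnum : ((θ.num.toNat : ℕ) : ℝ) = θ * θ.den := by
      have e1 : ((θ.num.toNat : ℕ) : ℤ) = θ.num := Int.toNat_of_nonneg (Rat.num_pos.2 hθ).le
      have e2 : (θ : ℚ) * θ.den = θ.num := Rat.mul_den_eq_num θ
      have e3 : ((θ.num.toNat : ℕ) : ℚ) = θ * θ.den := by
        rw [e2]
        exact (Int.cast_natCast _).symm.trans (congrArg (Int.cast : ℤ → ℚ) e1)
      exact_mod_cast e3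
    have hden : (0 : ℝ) < θ.den := by exact_mod_cast θ.den_pos
    have h3 := hrat θ.den θ.num.toNat (by
      rw [hnum]
      rw [lt_div_iff₀ hr'] at h2
      nlinarith)
    rw [hnum] at h3
    rw [div_lt_iff_of_neg hk'] at h1
    nlinarith
  obtain ⟨l₀, r₀, k₀, h₀, hl₀⟩ := hne
  have hlr : ∀ l r k, S l r k → 0 < l → k ≤ 0 := fun l r k h hl => by
    have := hS _ _ _ _ _ _ h h 1 0 (by simpa using hl)
    simpa using this
  -- The slope is the supremum of `k / l` over triples with `l > 0`, the least number respecting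
  -- these constraints; `hle` says that it respects the lower ones `c r ≤ k`.
  let T : Set ℝ := {x | ∃ l r k, S l r k ∧ 0 < l ∧ x = k / l}
  have hT : T.Nonempty := ⟨_, l₀, r₀, k₀, h₀, hl₀, rfl⟩
  have hT0 : ∀ x ∈ T, x ≤ 0 := by
    rintro _ ⟨l, r, k, h, hl, rfl⟩
    exact div_nonpos_of_nonpos_of_nonneg (hlr l r k h hl) hl.le
  have hup : ∀ l r k, S l r k → 0 < l → k ≤ sSup T * l := fun l r k h hl => by
    rw [← div_le_iff₀ hl]
    exact le_csSup ⟨0, hT0⟩ ⟨l, r, k, h, hl, rfl⟩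
  have hlow : ∀ l r k, S l r k → 0 < r → sSup T * r ≤ k := fun l r k h hr => by
    rw [← le_div_iff₀ hr]
    refine csSup_le hT ?_
    rintro _ ⟨l', r', k', h', hl', rfl⟩
    exact hle _ _ _ _ _ _ h' h hl' hr
  -- One copy of a triple with positive `l₀` keeps the weight positive, while many copies of a
  -- triple with `l = 0` and `k > 0` would make the sum positive.
  have hzero : ∀ r k, S 0 r k → k ≤ 0 := fun r k h => by
    by_contra! hk
    obtain ⟨q, hq⟩ := exists_nat_gt (-k₀ / k)
    have := hS _ _ _ _ _ _ h₀ h 1 q (by simpa using hl₀)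
    rw [div_lt_iff₀ hk] at hq
    push_cast at this
    linarith
  have hall : ∀ l r k, S l r k → k ≤ sSup T * l := fun l r k h => by
    rcases lt_trichotomy l 0 with hl | rfl | hl
    · have := hlow _ _ _ (hsymm _ _ _ h) (by linarith)
      linarith
    · simpa using hzero r k h
    · exact hup l r k h hl
  refine ⟨sSup T, csSup_le hT hT0, fun l r k h => ⟨?_, hall l r k h⟩⟩
  have := hall _ _ _ (hsymm _ _ _ h)
  linarith

/-! ### Images of projection-valued measures -/

namespace PVMeasure

variable {Ω : Type*} [MeasurableSpace Ω] {E : Type*} [NormedAddCommGroup E] [InnerProductSpace ℂ E]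
  [CompleteSpace E] (P : PVMeasure Ω E) {f : Ω → ℝ}

/-- The image of a projection-valued measure under a real function. -/
def map (f : Ω → ℝ) (hf : Measurable f) : PVMeasure ℝ E where
  proj B := P.proj (f ⁻¹' B)
  isStarProjection B hB := P.isStarProjection _ (hf hB)
  proj_univ := P.proj_univ
  hasSum_iUnion B hB hd x := by
    rw [Set.preimage_iUnion]
    exact P.hasSum_iUnion _ (fun i => hf (hB i)) (fun i j hij => (hd hij).preimage f) x

theorem scalarMeasure_map (hf : Measurable f) (x : E) :
    (P.map f hf).scalarMeasure x = (P.scalarMeasure x).map f := by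
  refine Measure.ext fun B hB => ?_
  rw [Measure.map_apply hf hB, scalarMeasure_apply _ _ hB, scalarMeasure_apply _ _ (hf hB)]
  rfl

theorem integral_map (hf : Measurable f) {g : ℝ → ℂ} (hg : IsBddMeasurable g) :
    (P.map f hf).integral g = P.integral (g ∘ f) := by
  refine integral_eq_of_inner _ hg fun x => ?_
  have hgf : IsBddMeasurable (g ∘ f) := ⟨hg.1.comp hf, hg.bdd.imp fun C hC ω => hC (f ω)⟩
  rw [P.inner_integral_self hgf, P.scalarMeasure_map hf,
    MeasureTheory.integral_map hf.aemeasurable hg.1.aestronglyMeasurable]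
  rfl

theorem operator_map (hf : Measurable f) {g : ℝ → ℝ} (hg : Measurable g) :
    (P.map f hf).operator g = P.operator (g ∘ f) := by
  refine LinearPMap.eq_of_eq_graph (Submodule.ext fun ⟨x, y⟩ => ?_)
  rw [mem_graph_operator _ hg, mem_graph_operator _ (hg.comp hf)]
  simp only [P.integral_map hf (isBddMeasurable_truncation hg _)]
  rfl

theorem unitaryGroup_map (hf : Measurable f) (t : ℝ) :
    (P.map f hf).unitaryGroup id t = P.unitaryGroup f t := by
  rw [unitaryGroup, P.integral_map hf (isBddMeasurable_phase measurable_id t)]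
  rfl

theorem isClosed_graph_operator (hf : Measurable f) :
    IsClosed ((P.operator f).graph : Set (E × E)) := by
  have : ((P.operator f).graph : Set (E × E)) =
      ⋂ n, {p | P.proj (levelSet f n) p.2 = P.integral (truncation f n) p.1} := by
    ext ⟨x, y⟩
    rw [SetLike.mem_coe, P.mem_graph_operator hf, Set.mem_iInter]
    rfl
  rw [this]
  exact isClosed_iInter fun n => isClosed_eq (by fun_prop) (by fun_prop)

/-- The closure of `c ∫ f dP` is `∫ c f dP`. -/
theorem closure_smul_operator (hf : Measurable f) (c : ℝ) :
    ((c : ℂ) • P.operator f).closure = P.operator fun ω => c * f ω := by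
  have hcf : Measurable fun ω => c * f ω := hf.const_mul c
  have hg : ((c : ℂ) • P.operator f).graph.topologicalClosure =
      (P.operator fun ω => c * f ω).graph := by
    refine le_antisymm (Submodule.topologicalClosure_minimal _ ?_
      (P.isClosed_graph_operator hcf)) ?_
    · rintro ⟨x, y⟩ hxy
      obtain ⟨z, hz, hAz⟩ := (LinearPMap.mem_graph_iff _).1 hxy
      simp only at hz hAz
      have hz' : (x, P.operator f ⟨z, z.2⟩) ∈ (P.operator f).graph :=
        (LinearPMap.mem_graph_iff _).2 ⟨⟨z, z.2⟩, hz, rfl⟩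
      have hy : y = (c : ℂ) • P.operator f ⟨z, z.2⟩ := hAz.symm
      rw [hy]
      refine (P.mem_graph_operator hcf).2 fun n => ?_
      have hB := measurableSet_levelSet hcf n
      rw [← P.integral_indicator_one hB, map_smul]
      have hgb : IsBddMeasurable ((levelSet (fun ω => c * f ω) n).indicator fun _ => (1 : ℂ)) :=
        .indicator_one hB
      rcases eq_or_ne c 0 with rfl | hc
      · have : truncation (fun ω => (0 : ℝ) * f ω) n = fun _ => 0 := by
          ext ω
          simp [truncation]
        rw [this, P.integral_const]
        simp
      · have hk := (isBddMeasurable_truncation hcf n).const_mul ((c : ℂ)⁻¹)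
        rw [P.integral_of_mem_graph hf hz' hgb hk, P.integral_const_mul _
          (isBddMeasurable_truncation hcf n), smul_apply, smul_smul,
          mul_inv_cancel₀ (by exact_mod_cast hc), one_smul]
        refine Eventually.of_forall fun ω => ?_
        have hc' : (c : ℂ) ≠ 0 := by exact_mod_cast hc
        by_cases h : ω ∈ levelSet (fun ω => c * f ω) n
        · simp [truncation, h, hc']
        · simp [truncation, h]
    -- Truncated vectors form a core. The level sets of `f` are used and not those of `c f`: for `c
    -- = 0` the latter are everything and do not lead into the domain of `∫ f dP`.
    · rintro ⟨x, y⟩ hxy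
      have hlim : Tendsto (fun n => (P.proj (levelSet f n) x, P.proj (levelSet f n) y)) atTop
          (𝓝 (x, y)) :=
        (P.tendsto_proj_levelSet hf x).prodMk_nhds (P.tendsto_proj_levelSet hf y)
      refine mem_closure_of_tendsto hlim (Eventually.of_forall fun n => ?_)
      have hB := measurableSet_levelSet hf n
      have hgb : IsBddMeasurable ((levelSet f n).indicator fun _ => (1 : ℂ)) := .indicator_one hB
      have ht := isBddMeasurable_truncation hf n
      have h1 : P.proj (levelSet f n) y = (c : ℂ) • P.integral (truncation f n) x := by
        rw [← P.integral_indicator_one hB, P.integral_of_mem_graph hcf hxy hgb (ht.const_mul (c : ℂ)),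
          P.integral_const_mul _ ht]
        · rfl
        · refine Eventually.of_forall fun ω => ?_
          by_cases h : ω ∈ levelSet f n
          · simp [truncation, h]
          · simp [truncation, h]
      have h2 : (P.proj (levelSet f n) x, P.integral (truncation f n) x) ∈
          (P.operator f).graph := by
        rw [← P.integral_indicator_one hB]
        refine P.mem_graph_integral hf hgb ht (Eventually.of_forall fun ω => ?_)
        by_cases h : ω ∈ levelSet f n
        · simp [truncation, h]
        · simp [truncation, h]
      obtain ⟨z, hz, hAz⟩ := (LinearPMap.mem_graph_iff _).1 h2
      refine (LinearPMap.mem_graph_iff _).2 ⟨⟨z, z.2⟩, hz, ?_⟩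
      change (c : ℂ) • P.operator f z = _
      rw [hAz, h1]
  refine LinearPMap.eq_of_eq_graph ?_
  rw [← hg, LinearPMap.IsClosable.graph_closure_eq_closure_graph ⟨_, hg⟩]

/-- `∫ 0 dP = 0`. -/
theorem operator_eq_zero (h : ∀ x, ∀ᵐ ω ∂P.scalarMeasure x, f ω = 0) (hf : Measurable f) :
    P.operator f = 0 := by
  have ht : ∀ n x, P.integral (truncation f n) x = 0 := fun n x => by
    have h1 : P.integral (truncation f n) x = P.integral (fun _ => 0) x := by
      refine P.integral_congr_ae (isBddMeasurable_truncation hf n) (.const 0) ?_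
      filter_upwards [h x] with ω hω
      simp [truncation, Set.indicator, hω]
    rw [h1, P.integral_const, zero_smul]
    rfl
  refine LinearPMap.eq_of_eq_graph (Submodule.ext fun ⟨x, y⟩ => ?_)
  rw [P.mem_graph_operator hf, LinearPMap.mem_graph_iff]
  constructor
  · intro hxy
    refine ⟨⟨x, trivial⟩, rfl, ?_⟩
    refine (P.eq_of_proj_levelSet hf fun n => ?_ : y = 0).symm
    rw [hxy n, ht, map_zero]
  · rintro ⟨z, rfl, rfl⟩ n
    rw [ht]
    exact map_zero _

end PVMeasure

/-! ### Reflection of the spectrum by the antilinear difference of projections -/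

section Reflection

variable {E : Type*} [NormedAddCommGroup E] [InnerProductSpace ℂ E] [CompleteSpace E]
  {H : StandardSubspace E}

/-- Being antilinear, `T` conjugates phases, so commuting with `e^{itA}` means intertwining `A` with
`-A`. The symmetry of `T` expresses this by matrix coefficients of the groups generated by `A` and
`-A`, which determine the projections. -/
theorem StandardSubspace.projDiff_proj {P : PVMeasure ℝ E}
    (hT : ∀ t x, H.projDiff (P.unitaryGroup id t x) = P.unitaryGroup id t (H.projDiff x))
    {B : Set ℝ} (hB : MeasurableSet B) (x : E) :
    H.projDiff (P.proj B x) = P.proj (Neg.neg ⁻¹' B) (H.projDiff x) := by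
  refine ext_inner_left ℂ fun y => ?_
  have hB' : MeasurableSet (Neg.neg ⁻¹' B) := measurable_neg hB
  rw [← inner_conj_symm, H.inner_projDiff_left, ← P.inner_proj_left hB',
    ← inner_conj_symm _ (H.projDiff x)]
  refine congrArg _ ?_
  refine P.inner_proj_eq_of_inner_unitaryGroup_eq (P.map Neg.neg measurable_neg) (fun t => ?_) hB
  have h1 : P.unitaryGroup Neg.neg t = P.unitaryGroup id (-t) := by
    simp [PVMeasure.unitaryGroup]
  rw [P.unitaryGroup_map measurable_neg, h1, ← H.inner_projDiff_left, hT,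
    ← P.adjoint_unitaryGroup measurable_id, ContinuousLinearMap.adjoint_inner_right]

theorem StandardSubspace.projDiff_injective {x : E} (h : H.projDiff x = 0) : x = 0 := by
  have h1 := H.isTomitaPair_projSum_projDiff x
  rw [h] at h1
  exact H.projSum_injective h1.eq_zero

end Reflection

/-! ### Complete activity implies proportionality -/

section Proportional

variable {E : Type*} [NormedAddCommGroup E] [InnerProductSpace ℂ E] [CompleteSpace E]
  {H : StandardSubspace E} {P : PVMeasure ℝ E}

theorem isSpectralPair_of_proj_eq
    (hR : ∀ t x, H.projSum (P.unitaryGroup id t x) = P.unitaryGroup id t (H.projSum x))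
    (hT : ∀ t x, H.projDiff (P.unitaryGroup id t x) = P.unitaryGroup id t (H.projDiff x))
    {l r : ℝ} {x : E} (hx : P.proj (Set.Icc l r) x = x) :
    IsSpectralPair H P l r (H.projSum x) (H.projDiff x) := by
  refine ⟨H.isTomitaPair_projSum_projDiff x, ?_, ?_⟩
  · rw [P.proj_comm_of_unitaryGroup_comm (fun t x => (hR t x).symm) measurableSet_Icc, hx]
  · have h := StandardSubspace.projDiff_proj hT measurableSet_Icc (B := Set.Icc l r) x
    have e : Neg.neg ⁻¹' Set.Icc l r = Set.Icc (-r) (-l) := by simp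
    rw [hx, e] at h
    exact h.symm

/-- On logarithms of norms, `pow_mul_pow_le` is the hypothesis of `exists_slope`. The required
symmetry is the exchange of `η` and `ζ`, which reverses the interval and the sign of `k`. -/
theorem IsCompletelyActive.exists_exp_bounds
    (hact : IsCompletelyActive (P.operator id) H.toClosedSubmodule.toSubmodule)
    (hne : ∃ l r η ζ, IsSpectralPair H P l r η ζ ∧ 0 < l ∧ η ≠ 0) :
    ∃ c ≤ 0, ∀ l r η ζ, IsSpectralPair H P l r η ζ →
      Real.exp (c * r) * ‖η‖ ^ 2 ≤ ‖ζ‖ ^ 2 ∧ ‖ζ‖ ^ 2 ≤ Real.exp (c * l) * ‖η‖ ^ 2 := by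
  have hnz : ∀ {l r η ζ}, IsSpectralPair H P l r η ζ → η ≠ 0 → ζ ≠ 0 := by
    rintro l r η ζ h hη rfl
    exact hη h.1.eq_zero
  let S : ℝ → ℝ → ℝ → Prop := fun l r k => ∃ η ζ, IsSpectralPair H P l r η ζ ∧ η ≠ 0 ∧
    k = Real.log (‖ζ‖ ^ 2) - Real.log (‖η‖ ^ 2)
  suffices h : ∃ c ≤ 0, ∀ l r k, S l r k → c * r ≤ k ∧ k ≤ c * l by
    obtain ⟨c, hc, hcS⟩ := h
    refine ⟨c, hc, fun l r η ζ h => ?_⟩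
    rcases eq_or_ne η 0 with rfl | hη
    · rw [h.1.symm.eq_zero]
      simp
    · have h1 : 0 < ‖η‖ ^ 2 := by positivity
      have h2 : 0 < ‖ζ‖ ^ 2 := by
        have := norm_pos_iff.2 (hnz h hη)
        positivity
      obtain ⟨h3, h4⟩ := hcS l r _ ⟨η, ζ, h, hη, rfl⟩
      constructor
      · rw [← Real.exp_log h1, ← Real.exp_log h2, ← Real.exp_add, Real.exp_le_exp]
        linarith
      · rw [← Real.exp_log h1, ← Real.exp_log h2, ← Real.exp_add, Real.exp_le_exp]
        linarith
  refine exists_slope ?_ ?_ ?_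
  · rintro l r k ⟨η, ζ, h, hη, rfl⟩
    exact ⟨ζ, η, h.symm, hnz h hη, by ring⟩
  · rintro l r k l' r' k' ⟨η, ζ, h, hη, rfl⟩ ⟨η', ζ', h', hη', rfl⟩ p q hpq
    have key := hact.pow_mul_pow_le h h' hpq
    have h1 : 0 < ‖η‖ ^ 2 := by positivity
    have h2 : 0 < ‖ζ‖ ^ 2 := by
      have := norm_pos_iff.2 (hnz h hη)
      positivity
    have h3 : 0 < ‖η'‖ ^ 2 := by positivity
    have h4 : 0 < ‖ζ'‖ ^ 2 := by
      have := norm_pos_iff.2 (hnz h' hη')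
      positivity
    have key' := Real.log_le_log (by positivity) key
    rw [Real.log_mul (by positivity) (by positivity), Real.log_mul (by positivity) (by positivity),
      Real.log_pow (‖ζ‖ ^ 2) p, Real.log_pow (‖ζ'‖ ^ 2) q, Real.log_pow (‖η‖ ^ 2) p,
      Real.log_pow (‖η'‖ ^ 2) q] at key'
    linarith
  · obtain ⟨l, r, η, ζ, h, hl, hη⟩ := hne
    exact ⟨l, r, _, ⟨η, ζ, h, hη, rfl⟩, hl⟩

/-- Otherwise injectivity of `R` would leave no spectrum of `A` on the positive half line, and
reflection by `T` none on the negative one, so that `A = 0`. -/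
theorem exists_isSpectralPair_of_ne_zero
    (hR : ∀ t x, H.projSum (P.unitaryGroup id t x) = P.unitaryGroup id t (H.projSum x))
    (hT : ∀ t x, H.projDiff (P.unitaryGroup id t x) = P.unitaryGroup id t (H.projDiff x))
    (hA : P.operator id ≠ 0) : ∃ l r η ζ, IsSpectralPair H P l r η ζ ∧ 0 < l ∧ η ≠ 0 := by
  by_contra! hcon
  have h1 : ∀ l r, 0 < l → ∀ x, P.proj (Set.Icc l r) x = 0 := fun l r hl x => by
    have hx : P.proj (Set.Icc l r) (P.proj (Set.Icc l r) x) = P.proj (Set.Icc l r) x := by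
      rw [P.proj_proj_inter measurableSet_Icc measurableSet_Icc, Set.inter_self]
    exact H.projSum_injective (hcon _ _ _ _ (isSpectralPair_of_proj_eq hR hT hx) hl)
  have h2 : ∀ l r, 0 < l → ∀ x, P.proj (Set.Icc (-r) (-l)) x = 0 := fun l r hl x => by
    refine StandardSubspace.projDiff_injective (H := H) ?_
    rw [StandardSubspace.projDiff_proj hT measurableSet_Icc]
    have e : Neg.neg ⁻¹' Set.Icc (-r) (-l) = Set.Icc l r := by simp
    rw [e, h1 l r hl]
  refine hA (P.operator_eq_zero (fun x => ?_) measurable_id)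
  -- The countably many intervals `[1 / (n + 1), n]` and their reflections cover every nonzero real
  -- number.
  have h3 : ∀ᵐ a ∂P.scalarMeasure x, ∀ n : ℕ, a ∉ Set.Icc (1 / ((n : ℝ) + 1)) n ∧
      a ∉ Set.Icc (-(n : ℝ)) (-(1 / ((n : ℝ) + 1))) := by
    rw [ae_all_iff]
    intro n
    have hn : 0 < 1 / ((n : ℝ) + 1) := by positivity
    have e1 := (P.proj_apply_eq_zero_iff x measurableSet_Icc).1 (h1 _ n hn x)
    have e2 := (P.proj_apply_eq_zero_iff x measurableSet_Icc).1 (h2 _ n hn x)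
    rw [measure_eq_zero_iff_ae_notMem] at e1 e2
    exact e1.and e2
  filter_upwards [h3] with a ha
  by_contra h0
  have hpos : 0 < |a| := abs_pos.2 h0
  obtain ⟨n, hn⟩ := exists_nat_ge |a|
  obtain ⟨m, hm⟩ := exists_nat_one_div_lt hpos
  have hk1 : 1 / (((max m n : ℕ) : ℝ) + 1) ≤ |a| := by
    refine le_trans ?_ hm.le
    refine one_div_le_one_div_of_le (by positivity) ?_
    have : (m : ℝ) ≤ ((max m n : ℕ) : ℝ) := by exact_mod_cast le_max_left m n
    linarith
  have hk2 : |a| ≤ ((max m n : ℕ) : ℝ) := hn.trans (by exact_mod_cast le_max_right m n)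
  rcases le_total 0 a with h | h
  · rw [abs_of_nonneg h] at hk1 hk2
    exact (ha (max m n)).1 ⟨hk1, hk2⟩
  · rw [abs_of_nonpos h] at hk1 hk2
    exact (ha (max m n)).2 ⟨by linarith, by linarith⟩

end Proportional

/-! ### Vanishing of a form by subdividing the spectrum -/

section Bisection

variable {E : Type*} [NormedAddCommGroup E] [InnerProductSpace ℂ E] [CompleteSpace E]

/-- An operator commuting with a projection-valued measure vanishes on the spectral subspace of
`(a, b]` if its quadratic form is `O(r - l)` on the spectral subspaces of `(l, r] ⊆ (a, b]`. -/
theorem PVMeasure.inner_eq_zero_of_bisection {P : PVMeasure ℝ E} {X : E →L[ℂ] E}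
    (hX : ∀ B, MeasurableSet B → ∀ x, P.proj B (X x) = X (P.proj B x)) {a b C : ℝ}
    (h : ∀ l r, a ≤ l → l ≤ r → r ≤ b → ∀ x, P.proj (Set.Ioc l r) x = x →
      ‖⟪x, X x⟫‖ ≤ C * (r - l) * ‖x‖ ^ 2) {x : E} (hx : P.proj (Set.Ioc a b) x = x) :
    ⟪x, X x⟫ = 0 := by
  rcases lt_or_ge b a with hab | hab
  · have h0 : Set.Ioc a b = ∅ := Set.Ioc_eq_empty (by linarith)
    have h1 := P.ae_mem_of_proj_eq measurableSet_Ioc hx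
    rw [h0] at h1
    have h2 : (P.scalarMeasure x).real Set.univ = 0 := by
      rw [measureReal_def]
      have : P.scalarMeasure x Set.univ = 0 := by
        rw [Measure.measure_univ_eq_zero, ← ae_eq_bot]
        exact Filter.eventually_false_iff_eq_bot.1 h1
      rw [this]
      rfl
    rw [P.scalarMeasure_real_univ] at h2
    have : x = 0 := by simpa using h2
    simp [this]
  -- The two halves of `x` are orthogonal and not coupled by `X`, so their forms and squared norms
  -- add up. Each half satisfies the bound with half the length, which gains a factor `2` per step.
  have key : ∀ m : ℕ, ∀ l r, a ≤ l → l ≤ r → r ≤ b → ∀ x, P.proj (Set.Ioc l r) x = x →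
      ‖⟪x, X x⟫‖ ≤ C * ((r - l) / 2 ^ m) * ‖x‖ ^ 2 := by
    intro m
    induction m with
    | zero => simpa using h
    | succ m ih =>
      intro l r hal hlr hrb x hx
      set c := (l + r) / 2 with hc
      have hlc : l ≤ c := by linarith
      have hcr : c ≤ r := by linarith
      have hm1 : MeasurableSet (Set.Ioc l c) := measurableSet_Ioc
      have hm2 : MeasurableSet (Set.Ioc c r) := measurableSet_Ioc
      have hd : Disjoint (Set.Ioc l c) (Set.Ioc c r) := by
        rw [Set.disjoint_left]
        intro t h1 h2
        linarith [h1.2, h2.1]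
      set y := P.proj (Set.Ioc l c) x with hy
      set z := P.proj (Set.Ioc c r) x with hz
      have hyy : P.proj (Set.Ioc l c) y = y := by
        rw [hy, P.proj_proj_inter hm1 hm1, Set.inter_self]
      have hzz : P.proj (Set.Ioc c r) z = z := by
        rw [hz, P.proj_proj_inter hm2 hm2, Set.inter_self]
      have hyz : x = y + z := by
        have := P.proj_union hm1 hm2 hd
        rw [Set.Ioc_union_Ioc_eq_Ioc hlc hcr] at this
        rw [← hx, this]
        rfl
      have h0 : ∀ w, P.proj (Set.Ioc l c) (P.proj (Set.Ioc c r) w) = 0 := fun w => by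
        have := congrArg (fun T : E →L[ℂ] E => T w) (P.proj_mul_of_disjoint hm1 hm2 hd)
        exact this
      have h0' : ∀ w, P.proj (Set.Ioc c r) (P.proj (Set.Ioc l c) w) = 0 := fun w => by
        have := congrArg (fun T : E →L[ℂ] E => T w) (P.proj_mul_of_disjoint hm2 hm1 hd.symm)
        exact this
      have o1 : ⟪y, X z⟫ = 0 := by
        rw [← hyy, P.inner_proj_left hm1, hX _ hm1, ← hzz, h0, map_zero, inner_zero_right]
      have o2 : ⟪z, X y⟫ = 0 := by
        rw [← hzz, P.inner_proj_left hm2, hX _ hm2, ← hyy, h0', map_zero, inner_zero_right]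
      have o3 : ⟪y, z⟫ = 0 := by
        rw [← hyy, P.inner_proj_left hm1, ← hzz, h0, inner_zero_right]
      have e1 : ⟪x, X x⟫ = ⟪y, X y⟫ + ⟪z, X z⟫ := by
        rw [hyz, map_add, inner_add_left, inner_add_right, inner_add_right, o1, o2]
        ring
      have e2 : ‖x‖ ^ 2 = ‖y‖ ^ 2 + ‖z‖ ^ 2 := by
        rw [hyz, sq, sq, sq]
        exact norm_add_sq_eq_norm_sq_add_norm_sq_of_inner_eq_zero y z o3
      have i1 := ih l c hal hlc (hcr.trans hrb) y hyy
      have i2 := ih c r (hal.trans hlc) hcr hrb z hzz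
      have e3 : c - l = (r - l) / 2 := by rw [hc]; ring
      have e4 : r - c = (r - l) / 2 := by rw [hc]; ring
      rw [e3, div_div, ← pow_succ'] at i1
      rw [e4, div_div, ← pow_succ'] at i2
      rw [e1, e2, mul_add]
      exact (norm_add_le _ _).trans (add_le_add i1 i2)
  have hlim : Tendsto (fun m : ℕ => C * ((b - a) / 2 ^ m) * ‖x‖ ^ 2) atTop
      (𝓝 (C * 0 * ‖x‖ ^ 2)) := by
    refine (Tendsto.const_mul C ?_).mul_const _
    exact tendsto_const_nhds.div_atTop (tendsto_pow_atTop_atTop_of_one_lt one_lt_two)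
  have := ge_of_tendsto' hlim fun m => key m a b le_rfl hab le_rfl x hx
  rw [mul_zero, zero_mul] at this
  exact norm_le_zero_iff.1 this

end Bisection

/-! ### From exponential bounds to the modular Hamiltonian -/

section Proportional

variable {E : Type*} [NormedAddCommGroup E] [InnerProductSpace ℂ E] [CompleteSpace E]
  {H : StandardSubspace E} {P : PVMeasure ℝ E}

theorem isBddMeasurable_two_div_one_add_exp {Ω : Type*} [MeasurableSpace Ω] {f : Ω → ℝ}
    (hf : Measurable f) : IsBddMeasurable fun ω => ((2 / (1 + Real.exp (f ω)) : ℝ) : ℂ) := by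
  refine ⟨by fun_prop, 2, fun ω => ?_⟩
  rw [Complex.norm_real, Real.norm_of_nonneg (by positivity)]
  refine div_le_self zero_le_two ?_
  linarith [Real.exp_pos (f ω)]

/-- The form of `X = R (2 - R) - e^{cA} R²` at `x` is `‖T x‖² - ⟪R x, e^{cA} R x⟫`. Over `[l, r]`
both terms lie between `e^{cr} ‖R x‖²` and `e^{cl} ‖R x‖²`, so the form is `O(r - l)` and bisection
annihilates it on bounded parts of the spectrum. Cancelling `R` leaves `2 - R = e^{cA} R`. -/
theorem projSum_eq_integral
    (hR : ∀ t x, H.projSum (P.unitaryGroup id t x) = P.unitaryGroup id t (H.projSum x))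
    (hT : ∀ t x, H.projDiff (P.unitaryGroup id t x) = P.unitaryGroup id t (H.projDiff x))
    {c : ℝ} (hc : c ≤ 0) (hS : ∀ l r η ζ, IsSpectralPair H P l r η ζ →
      Real.exp (c * r) * ‖η‖ ^ 2 ≤ ‖ζ‖ ^ 2 ∧ ‖ζ‖ ^ 2 ≤ Real.exp (c * l) * ‖η‖ ^ 2) :
    P.integral (fun a => ((2 / (1 + Real.exp (c * a)) : ℝ) : ℂ)) = H.projSum := by
  have hRP : ∀ B, MeasurableSet B → ∀ x, P.proj B (H.projSum x) = H.projSum (P.proj B x) :=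
    fun B hB x => P.proj_comm_of_unitaryGroup_comm (fun t x => (hR t x).symm) hB x
  have hid : Measurable (id : ℝ → ℝ) := measurable_id
  have hRI : ∀ {g : ℝ → ℂ}, IsBddMeasurable g → ∀ x,
      P.integral g (H.projSum x) = H.projSum (P.integral g x) := fun hg x =>
    (P.integral_intertwine P H.projSum hg (fun B hB x => (hRP B hB x).symm) x).symm
  have hmain : ∀ N : ℕ, ∀ x, P.proj (Set.Ioc (-(N : ℝ)) N) x = x →
      P.integral (fun a => ((2 / (1 + Real.exp (c * a)) : ℝ) : ℂ)) x = H.projSum x := by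
    intro N x hx
    set M := P.integral (PVMeasure.expTruncation id N c) with hM
    have hMb := PVMeasure.isBddMeasurable_expTruncation hid N (c : ℂ)
    set R := H.projSum with hRdef
    set X : E →L[ℂ] E := R * ((2 : ℂ) • 1 - R) - M * R * R with hXdef
    have hXP : ∀ B, MeasurableSet B → ∀ x, P.proj B (X x) = X (P.proj B x) := by
      intro B hB x
      simp only [hXdef, sub_apply, mul_apply_eq_comp, smul_apply, one_apply_eq_self, map_sub,
        map_smul, hRP B hB, hM, P.proj_integral_comm hB hMb]
    have hquad : ∀ x, ⟪x, X x⟫ = ((‖H.projDiff x‖ ^ 2 : ℝ) : ℂ) - ⟪R x, M (R x)⟫ := by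
      intro x
      have e1 : ⟪x, R ((2 : ℂ) • x - R x)⟫ = ((‖H.projDiff x‖ ^ 2 : ℝ) : ℂ) := by
        have := H.inner_projDiff_projDiff x x
        rw [← map_smul, ← map_sub, inner_self_eq_norm_sq_to_K, ← inner_conj_symm] at this
        have h2 := congrArg (starRingEnd ℂ) this
        rw [Complex.conj_conj] at h2
        rw [← h2]
        simp
      have e2 : ⟪x, M (R (R x))⟫ = ⟪R x, M (R x)⟫ := by
        rw [hM, hRI hMb, ← H.inner_projSum_left]
      rw [← e1, ← e2, ← inner_sub_right]
      rfl
    -- For `c ≤ 0` and `-N ≤ l ≤ r` the convexity of the exponential gives `e^{cl} - e^{cr} ≤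
    -- e^{-cN} (-c) (r - l)`; the remaining factor bounds `‖R x‖²`.
    set C := Real.exp (-c * N) * (-c) * ‖R‖ ^ 2 with hC
    have hbound : ∀ l r, -(N : ℝ) ≤ l → l ≤ r → r ≤ N → ∀ x, P.proj (Set.Ioc l r) x = x →
        ‖⟪x, X x⟫‖ ≤ C * (r - l) * ‖x‖ ^ 2 := by
      intro l r hl hlr hr x hx
      have hx' : P.proj (Set.Icc l r) x = x := P.proj_eq_self_of_subset measurableSet_Ioc
        measurableSet_Icc Set.Ioc_subset_Icc_self hx
      have hpair := isSpectralPair_of_proj_eq hR hT hx'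
      obtain ⟨h1, h2⟩ := hS _ _ _ _ hpair
      have hRx := P.ae_mem_of_proj_eq measurableSet_Icc hpair.proj_fst
      have h3 : ⟪R x, M (R x)⟫ = ((∫ a, Real.exp (c * a) ∂P.scalarMeasure (R x) : ℝ) : ℂ) := by
        rw [hM, P.inner_integral_self hMb, ← integral_complex_ofReal]
        refine MeasureTheory.integral_congr_ae ?_
        filter_upwards [hRx] with a ha
        have : a ∈ PVMeasure.levelSet id N :=
          abs_le.2 ⟨hl.trans ha.1, ha.2.trans hr⟩
        simp [PVMeasure.expTruncation, this]
      have hexp : ∀ᵐ a ∂P.scalarMeasure (R x), Real.exp (c * r) ≤ Real.exp (c * a) ∧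
          Real.exp (c * a) ≤ Real.exp (c * l) := by
        filter_upwards [hRx] with a ha
        exact ⟨Real.exp_le_exp.2 (mul_le_mul_of_nonpos_left ha.2 hc),
          Real.exp_le_exp.2 (mul_le_mul_of_nonpos_left ha.1 hc)⟩
      have hinteg : Integrable (fun a => Real.exp (c * a)) (P.scalarMeasure (R x)) := by
        refine Integrable.of_bound (by fun_prop) (Real.exp (c * l)) ?_
        filter_upwards [hexp] with a ha
        rw [Real.norm_of_nonneg (Real.exp_pos _).le]
        exact ha.2
      have hconst : ∀ d : ℝ, ∫ _, d ∂P.scalarMeasure (R x) = d * ‖R x‖ ^ 2 := fun d => by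
        rw [MeasureTheory.integral_const, P.scalarMeasure_real_univ, smul_eq_mul, mul_comm]
      have h4 : Real.exp (c * r) * ‖R x‖ ^ 2 ≤ ∫ a, Real.exp (c * a) ∂P.scalarMeasure (R x) := by
        rw [← hconst]
        exact integral_mono_ae (integrable_const _) hinteg (hexp.mono fun a ha => ha.1)
      have h5 : ∫ a, Real.exp (c * a) ∂P.scalarMeasure (R x) ≤ Real.exp (c * l) * ‖R x‖ ^ 2 := by
        rw [← hconst]
        exact integral_mono_ae hinteg (integrable_const _) (hexp.mono fun a ha => ha.2)
      have h6 : ‖⟪x, X x⟫‖ ≤ (Real.exp (c * l) - Real.exp (c * r)) * ‖R x‖ ^ 2 := by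
        rw [hquad, h3, ← Complex.ofReal_sub, Complex.norm_real, Real.norm_eq_abs, abs_le]
        constructor <;> nlinarith
      have h7 : Real.exp (c * l) - Real.exp (c * r) ≤ Real.exp (-c * N) * (-c) * (r - l) := by
        have e1 : Real.exp (c * r) = Real.exp (c * l) * Real.exp (c * (r - l)) := by
          rw [← Real.exp_add]; ring_nf
        have e2 := Real.add_one_le_exp (c * (r - l))
        have e3 : Real.exp (c * l) ≤ Real.exp (-c * N) := Real.exp_le_exp.2 (by nlinarith)
        have e4 : 0 ≤ (-c) * (r - l) := mul_nonneg (by linarith) (by linarith)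
        have e5 := Real.exp_pos (c * l)
        calc Real.exp (c * l) - Real.exp (c * r)
            = Real.exp (c * l) * (1 - Real.exp (c * (r - l))) := by rw [e1]; ring
          _ ≤ Real.exp (c * l) * ((-c) * (r - l)) :=
              mul_le_mul_of_nonneg_left (by linarith) e5.le
          _ ≤ Real.exp (-c * N) * ((-c) * (r - l)) := mul_le_mul_of_nonneg_right e3 e4
          _ = _ := by ring
      have h8 : ‖R x‖ ^ 2 ≤ ‖R‖ ^ 2 * ‖x‖ ^ 2 := by
        rw [← mul_pow]
        exact pow_le_pow_left₀ (norm_nonneg _) (R.le_opNorm x) 2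
      have h9 : 0 ≤ Real.exp (-c * N) * (-c) * (r - l) :=
        mul_nonneg (mul_nonneg (Real.exp_pos _).le (by linarith)) (by linarith)
      calc ‖⟪x, X x⟫‖ ≤ (Real.exp (c * l) - Real.exp (c * r)) * ‖R x‖ ^ 2 := h6
        _ ≤ (Real.exp (-c * N) * (-c) * (r - l)) * ‖R x‖ ^ 2 :=
            mul_le_mul_of_nonneg_right h7 (sq_nonneg _)
        _ ≤ (Real.exp (-c * N) * (-c) * (r - l)) * (‖R‖ ^ 2 * ‖x‖ ^ 2) :=
            mul_le_mul_of_nonneg_left h8 h9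
        _ = C * (r - l) * ‖x‖ ^ 2 := by rw [hC]; ring
    have hmI : MeasurableSet (Set.Ioc (-(N : ℝ)) N) := measurableSet_Ioc
    have hXzero : X * P.proj (Set.Ioc (-(N : ℝ)) N) = 0 := by
      refine clm_ext_inner_self fun y => ?_
      have hyy : P.proj (Set.Ioc (-(N : ℝ)) N) (P.proj (Set.Ioc (-(N : ℝ)) N) y) =
          P.proj (Set.Ioc (-(N : ℝ)) N) y := by
        rw [P.proj_proj_inter hmI hmI, Set.inter_self]
      have h0 := PVMeasure.inner_eq_zero_of_bisection hXP hbound hyy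
      rw [mul_apply_eq_comp, zero_apply, inner_zero_right, ← h0, P.inner_proj_left hmI, hXP _ hmI,
        hyy]
    have hXx : X x = 0 := by
      rw [← hx]
      exact congrArg (fun T : E →L[ℂ] E => T x) hXzero
    have h1 : R ((2 : ℂ) • x - R x - M (R x)) = 0 := by
      rw [← hXx]
      simp only [hXdef, sub_apply, mul_apply_eq_comp, smul_apply, one_apply_eq_self, map_sub,
        map_smul, hM, hRI hMb]
    have h2 := H.projSum_injective h1
    set G := P.integral (fun a => ((2 / (1 + Real.exp (c * a)) : ℝ) : ℂ)) with hG
    have hGb := isBddMeasurable_two_div_one_add_exp (f := fun a : ℝ => c * a)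
      (measurable_id.const_mul c)
    -- Applying `G = 2 / (1 + e^{cA})` to `2 x = R x + M R x` gives `2 G x = 2 R x`, since `G (1 +
    -- M) = 2` on the spectral subspace considered.
    have h3 : (2 : ℂ) • G x = G (R x) + G (M (R x)) := by
      rw [← map_smul, ← map_add, ← sub_eq_zero, ← map_sub, ← sub_sub, h2, map_zero]
    have hRx : P.proj (Set.Ioc (-(N : ℝ)) N) (R x) = R x := by rw [hRP _ hmI, hx]
    have h4 : G (R x) + G (M (R x)) = (2 : ℂ) • R x := by
      rw [hG, hM, P.integral_integral hGb hMb, ← add_apply, ← P.integral_add hGb (hGb.mul hMb)]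
      have : P.integral (fun ω => ((2 / (1 + Real.exp (c * ω)) : ℝ) : ℂ) +
          ((2 / (1 + Real.exp (c * ω)) : ℝ) : ℂ) * PVMeasure.expTruncation id N c ω) (R x) =
          P.integral (fun _ => 2) (R x) := by
        refine P.integral_congr_ae (hGb.add (hGb.mul hMb)) (.const 2) ?_
        filter_upwards [P.ae_mem_of_proj_eq hmI hRx] with a ha
        have ha' : a ∈ PVMeasure.levelSet id N := abs_le.2 ⟨ha.1.le, ha.2⟩
        have e : PVMeasure.expTruncation id N c a = ((Real.exp (c * a) : ℝ) : ℂ) := by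
          simp [PVMeasure.expTruncation, ha']
        rw [e, ← Complex.ofReal_mul, ← Complex.ofReal_add]
        have : 1 + Real.exp (c * a) ≠ 0 := by positivity
        have e' : 2 / (1 + Real.exp (c * a)) + 2 / (1 + Real.exp (c * a)) * Real.exp (c * a) = 2 := by
          field_simp
        rw [e']
        simp
      rw [this, P.integral_const]
      rfl
    have h5 : (2 : ℂ) • G x = (2 : ℂ) • R x := h3.trans h4
    exact smul_right_injective E (two_ne_zero (α := ℂ)) h5
  refine ContinuousLinearMap.ext fun x => ?_
  have hlim := P.tendsto_proj (s := fun N : ℕ => Set.Ioc (-(N : ℝ)) N) (fun N => measurableSet_Ioc)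
    (fun a => ?_) x
  · have l1 := ((P.integral (fun a => ((2 / (1 + Real.exp (c * a)) : ℝ) : ℂ))).continuous.tendsto
      x).comp hlim
    have l2 := (H.projSum.continuous.tendsto x).comp hlim
    refine tendsto_nhds_unique l1 (l2.congr fun N => (hmain N _ ?_).symm)
    rw [P.proj_proj_inter measurableSet_Ioc measurableSet_Ioc, Set.inter_self]
  · obtain ⟨n, hn⟩ := exists_nat_gt |a|
    filter_upwards [eventually_ge_atTop n] with m hm
    have : (n : ℝ) ≤ m := by exact_mod_cast hm
    have := abs_lt.1 (hn.trans_le this)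
    exact ⟨this.1, this.2.le⟩

/-- If `A = ∫ a dP` is completely active then `log Δ_H` is a nonpositive multiple of `A`. -/
theorem IsCompletelyActive.exists_modularHamiltonian_eq
    (hact : IsCompletelyActive (P.operator id) H.toClosedSubmodule.toSubmodule)
    (hR : ∀ t x, H.projSum (P.unitaryGroup id t x) = P.unitaryGroup id t (H.projSum x))
    (hT : ∀ t x, H.projDiff (P.unitaryGroup id t x) = P.unitaryGroup id t (H.projDiff x))
    (hA : P.operator id ≠ 0) :
    ∃ c : ℝ, c ≤ 0 ∧ H.modularHamiltonian = ((c : ℂ) • P.operator id).closure := by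
  obtain ⟨c, hc, hS⟩ := hact.exists_exp_bounds (exists_isSpectralPair_of_ne_zero hR hT hA)
  refine ⟨c, hc, ?_⟩
  have hb := isBddMeasurable_two_div_one_add_exp (f := fun a : ℝ => c * a)
    (measurable_id.const_mul c)
  rw [P.closure_smul_operator measurable_id, H.modularHamiltonian_eq P (f := fun a => Real.exp (c * a))
    (by fun_prop) hb (projSum_eq_integral hR hT hc hS)]
  · congr 1
    ext a
    simp
  · refine fun z => Eventually.of_forall fun a => ?_
    have : 1 + Real.exp (c * a) ≠ 0 := by positivity
    rw [← Complex.ofReal_mul]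
    have e : (2 : ℂ) = ((2 : ℝ) : ℂ) := by simp
    rw [e, ← Complex.ofReal_sub]
    congr 1
    field_simp
    ring

end Proportional

/-! ### Proportionality implies complete activity -/

section RealTensorPower

variable {E : Type*} [NormedAddCommGroup E] [InnerProductSpace ℂ E]

theorem realTensorPower_induction {K : Submodule ℝ E} {n : ℕ} {p : HilbertTensorPower E n → Prop}
    (hcl : IsClosed {x | p x}) (h0 : p 0) (hadd : ∀ x y, p x → p y → p (x + y))
    (hsmul : ∀ (c : ℝ) x, p x → p ((c : ℂ) • x))
    (hmono : ∀ v : Fin (n + 1) → E, (∀ i, v i ∈ K) → p (algMonomial n v : HilbertTensorPower E n))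
    {ξ : HilbertTensorPower E n} (hξ : ξ ∈ realTensorPower K n) : p ξ := by
  refine closure_minimal (fun x hx => ?_) hcl hξ
  change x ∈ Submodule.span ℝ _ at hx
  induction hx using Submodule.span_induction with
  | mem x hx =>
    obtain ⟨v, hv, rfl⟩ := hx
    exact hmono v hv
  | zero => exact h0
  | add x y _ _ hx hy => exact hadd x y hx hy
  | smul c x _ hx =>
    have := hsmul c x hx
    rw [Complex.coe_smul] at this
    exact this

/-- For monomials the relation holds factor by factor. Exchanging the arguments conjugates scalars,
so it extends to real but not to complex combinations, and then to limits. -/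
theorem inner_operatorPower_of_mem_realTensorPower {K : Submodule ℝ E} {S T : E →L[ℂ] E}
    (h : ∀ a ∈ K, ∀ b ∈ K, ⟪a, S b⟫ = ⟪b, T a⟫) {n : ℕ} {ξ ξ' : HilbertTensorPower E n}
    (hξ : ξ ∈ realTensorPower K n) (hξ' : ξ' ∈ realTensorPower K n) :
    ⟪ξ, operatorPower S n ξ'⟫ = ⟪ξ', operatorPower T n ξ⟫ := by
  refine realTensorPower_induction
    (p := fun ξ => ⟪ξ, operatorPower S n ξ'⟫ = ⟪ξ', operatorPower T n ξ⟫)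
    (isClosed_eq (by fun_prop) (by fun_prop)) (by simp) (fun x y hx hy => ?_) (fun c x hx => ?_)
    (fun v hv => ?_) hξ
  · simp only [map_add, inner_add_left, inner_add_right, hx, hy]
  · simp only [map_smul, inner_smul_left, inner_smul_right, hx, Complex.conj_ofReal]
  refine realTensorPower_induction
    (p := fun ξ' => ⟪(algMonomial n v : HilbertTensorPower E n), operatorPower S n ξ'⟫ =
      ⟪ξ', operatorPower T n (algMonomial n v : HilbertTensorPower E n)⟫)
    (isClosed_eq (by fun_prop) (by fun_prop)) (by simp) (fun x y hx hy => ?_) (fun c x hx => ?_)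
    (fun w hw => ?_) hξ'
  · simp only [map_add, inner_add_left, inner_add_right, hx, hy]
  · simp only [map_smul, inner_smul_left, inner_smul_right, hx, Complex.conj_ofReal]
  · simp only [operatorPower_algMonomial, inner_coe_algMonomial]
    exact Finset.prod_congr rfl fun i _ => h _ (hv i) _ (hw i)

end RealTensorPower

section Converse

variable {E : Type*} [NormedAddCommGroup E] [InnerProductSpace ℂ E] [CompleteSpace E]
  {H : StandardSubspace E} {P : PVMeasure ℝ E}

theorem StandardSubspace.projDiff_of_mem {b : E} (hb : b ∈ H.toClosedSubmodule) :
    H.projDiff b = (2 : ℂ) • b - H.projSum b := by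
  have h := H.two_smul_realProj b
  rw [H.realProj_eq_self hb] at h
  rw [h]
  abel

theorem StandardSubspace.isTomitaPair_self {b : E} (hb : b ∈ H.toClosedSubmodule) :
    H.IsTomitaPair b b :=
  ⟨b, hb, 0, H.toClosedSubmodule.toSubmodule.zero_mem, by simp, by simp⟩

/-- The KMS condition for a standard subspace. -/
theorem inner_expTruncation_of_mem
    (hT : ∀ t x, H.projDiff (P.unitaryGroup id t x) = P.unitaryGroup id t (H.projDiff x)) {c : ℝ}
    (hP : P.integral (fun a => ((2 / (1 + Real.exp (c * a)) : ℝ) : ℂ)) = H.projSum) (N : ℕ) {a b : E}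
    (ha : a ∈ H.toClosedSubmodule) (hb : b ∈ H.toClosedSubmodule) :
    ⟪a, P.integral (PVMeasure.expTruncation id N c) b⟫ =
      ⟪b, P.proj (PVMeasure.levelSet id N) a⟫ := by
  have hid : Measurable (id : ℝ → ℝ) := measurable_id
  have hB := PVMeasure.measurableSet_levelSet hid N
  have hM := PVMeasure.isBddMeasurable_expTruncation hid N (c : ℂ)
  have hG := isBddMeasurable_two_div_one_add_exp (f := fun a : ℝ => c * a) (hid.const_mul c)
  -- Since `R = 2 / (1 + e^{cA})`, this `z` is the solution of `R z = P_N b`, with `P_N` the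
  -- spectral truncation; then `(2 - R) z` is the truncated `e^{cA} b`, and `inner_tomitaPair`
  -- applied to the pair `(a, a)` compares the two.
  set z := (2⁻¹ : ℂ) • (P.proj (PVMeasure.levelSet id N) b +
    P.integral (PVMeasure.expTruncation id N c) b) with hz
  have hRz : H.projSum z = P.proj (PVMeasure.levelSet id N) b := by
    have hI := IsBddMeasurable.indicator_one hB
    rw [hz, map_smul, map_add, ← hP, ← P.integral_indicator_one hB, P.integral_integral hG hI,
      P.integral_integral hG hM, ← add_apply, ← P.integral_add (hG.mul hI) (hG.mul hM),
      ← smul_apply, ← P.integral_const_mul _ ((hG.mul hI).add (hG.mul hM))]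
    congr 2
    ext t
    by_cases ht : t ∈ PVMeasure.levelSet id N
    · have e1 : PVMeasure.expTruncation id N c t = ((Real.exp (c * t) : ℝ) : ℂ) := by
        simp [PVMeasure.expTruncation, ht]
      rw [e1, Set.indicator_of_mem ht, mul_one, ← Complex.ofReal_mul, ← Complex.ofReal_add]
      have e2 : 2 / (1 + Real.exp (c * t)) + 2 / (1 + Real.exp (c * t)) * Real.exp (c * t) = 2 := by
        have : 1 + Real.exp (c * t) ≠ 0 := by positivity
        field_simp
      rw [e2]
      simp
    · simp [PVMeasure.expTruncation, ht]
  have hRP : ∀ x, H.projSum (P.proj (PVMeasure.levelSet id N) x) =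
      P.proj (PVMeasure.levelSet id N) (H.projSum x) := fun x => by
    rw [← hP, P.proj_integral_comm hB hG]
  have hTP : H.projDiff (P.proj (PVMeasure.levelSet id N) b) =
      P.proj (PVMeasure.levelSet id N) (H.projDiff b) := by
    have e : Neg.neg ⁻¹' PVMeasure.levelSet (id : ℝ → ℝ) N = PVMeasure.levelSet id N := by
      ext t
      simp [PVMeasure.levelSet]
    rw [StandardSubspace.projDiff_proj hT hB, e]
  -- `T R = (2 - R) T` at `z`, together with `T b = (2 - R) b` for `b` in `H`, gives `(2 - R)(T z -
  -- P_N b) = 0`.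
  have hTz : H.projDiff z = P.proj (PVMeasure.levelSet id N) b := by
    have h1 := H.projDiff_projSum z
    rw [hRz, hTP, StandardSubspace.projDiff_of_mem hb, map_sub, map_smul, ← hRP] at h1
    have h2 : (2 : ℂ) • (H.projDiff z - P.proj (PVMeasure.levelSet id N) b) -
        H.projSum (H.projDiff z - P.proj (PVMeasure.levelSet id N) b) = 0 := by
      rw [smul_sub, map_sub, sub_sub_sub_comm, ← h1, sub_self]
    exact sub_eq_zero.1 (H.two_smul_sub_projSum_injective h2)
  have h3 := H.inner_tomitaPair (StandardSubspace.isTomitaPair_self ha) z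
  have h4 : (2 : ℂ) • z - H.projSum z = P.integral (PVMeasure.expTruncation id N c) b := by
    rw [hRz, hz, smul_smul, mul_inv_cancel₀ two_ne_zero, one_smul]
    abel
  rw [hTz, h4] at h3
  rw [← inner_conj_symm, ← h3, inner_conj_symm, P.inner_proj_left hB]

/-- The midpoint inequality passes the bound `f ≤ f 0` from `1` to every `2⁻ᵏ`, so the difference
quotients along these points are nonpositive. -/
theorem deriv_nonpos_of_midpoint {f : ℝ → ℝ} {d : ℝ} (hf : HasDerivAt f d 0)
    (h0 : ∀ s, 0 ≤ f s) (h1 : f 1 ≤ f 0) (hmid : ∀ s, f (s / 2) ^ 2 ≤ f 0 * f s) : d ≤ 0 := by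
  have hk : ∀ k : ℕ, f ((1 / 2) ^ k) ≤ f 0 := by
    intro k
    induction k with
    | zero => simpa using h1
    | succ k ih =>
      have := hmid ((1 / 2) ^ k)
      have e : ((1 : ℝ) / 2) ^ k / 2 = (1 / 2) ^ (k + 1) := by rw [pow_succ]; ring
      rw [e] at this
      refine abs_le_of_sq_le_sq' ?_ (h0 0) |>.2
      nlinarith [h0 0]
  have hlim : Tendsto (fun k : ℕ => ((1 : ℝ) / 2) ^ k) atTop (𝓝[≠] 0) := by
    refine tendsto_nhdsWithin_iff.2 ⟨tendsto_pow_atTop_nhds_zero_of_lt_one (by norm_num)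
      (by norm_num), Eventually.of_forall fun k => ?_⟩
    simp
  rw [hasDerivAt_iff_tendsto_slope_zero] at hf
  refine le_of_tendsto' (hf.comp hlim) fun k => ?_
  simp only [Function.comp_apply, zero_add, smul_eq_mul]
  exact mul_nonpos_of_nonneg_of_nonpos (by positivity) (by linarith [hk k])

/-- The function `f(s)`, the form of the truncated `e^{csA} ⊗ ⋯ ⊗ e^{csA}` at `ξ`, is a squared
norm. The KMS relation gives `f 1 = f 0` and Cauchy-Schwarz the midpoint inequality, so `f' 0 ≤ 0`;
dividing by `c < 0` gives the sign of the generator. -/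
theorem isSuccActive_of_neg
    (hT : ∀ t x, H.projDiff (P.unitaryGroup id t x) = P.unitaryGroup id t (H.projDiff x)) {c : ℝ}
    (hc : c < 0)
    (hP : P.integral (fun a => ((2 / (1 + Real.exp (c * a)) : ℝ) : ℂ)) = H.projSum) (n : ℕ) :
    IsSuccActive n (P.operator id) H.toClosedSubmodule.toSubmodule := by
  have hid : Measurable (id : ℝ → ℝ) := measurable_id
  rw [IsSuccActive, P.unitaryExp_operator hid]
  intro x hx
  set ξ : HilbertTensorPower E n := x.1 with hξ
  set η := groupGenerator (fun t => operatorPower (P.unitaryGroup id t) n) x with hη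
  have hg : (ξ, η) ∈ generatorGraph fun t => operatorPower (P.unitaryGroup id t) n := by
    rw [← graph_groupGenerator]
    exact LinearPMap.mem_graph _ x
  -- The vector `ξ` need not be spectrally bounded. The sign is proved for the truncated form, which
  -- converges to `⟪ξ, η⟫`.
  have hlim : Tendsto (fun N : ℕ => (⟪operatorPower (P.proj (PVMeasure.levelSet id N)) n ξ, η⟫).re)
      atTop (𝓝 (⟪ξ, η⟫).re) := by
    refine (Complex.continuous_re.tendsto _).comp (Tendsto.inner ?_ tendsto_const_nhds)
    refine tendsto_operatorPower (fun N => ?_) (fun y => P.tendsto_proj_levelSet hid y) n ξ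
    rw [← P.integral_indicator_one (PVMeasure.measurableSet_levelSet hid N)]
    exact P.norm_integral_le zero_le_one
      (IsBddMeasurable.indicator_one (PVMeasure.measurableSet_levelSet hid N)).1
      fun t => (norm_indicator_le_norm_self _ _).trans (by simp)
  refine ge_of_tendsto' hlim fun N => ?_
  have hB := PVMeasure.measurableSet_levelSet hid N
  set Q := P.proj (PVMeasure.levelSet id N) with hQ
  let T : ℂ → E →L[ℂ] E := fun z => P.integral (PVMeasure.expTruncation id N z)
  have hT0 : T 0 = Q := P.integral_expTruncation_zero hid N
  have hTadd : ∀ z w, T (z + w) = T z * T w := P.integral_expTruncation_add hid N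
  let g : ℂ → ℂ := fun z => ⟪ξ, operatorPower (T z) n ξ⟫
  have hgd : DifferentiableAt ℂ g 0 := by
    have h1 : DifferentiableAt ℂ (fun z => operatorPower (T z) n ξ) 0 :=
      ((P.differentiableAt_integral_expTruncation hid N).operatorPower n).clm_apply
        (differentiableAt_const ξ)
    exact (innerSL ℂ ξ).differentiableAt.comp 0 h1
  obtain ⟨g', hg'⟩ : ∃ g', HasDerivAt g g' 0 := ⟨_, hgd.hasDerivAt⟩
  have hline : ∀ d : ℂ, HasDerivAt (fun t : ℝ => g (d * t)) (d * g') 0 := by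
    intro d
    have hl : HasDerivAt (fun t : ℝ => d * (t : ℂ)) d 0 := by
      simpa using (Complex.ofRealCLM.hasDerivAt (x := 0)).const_mul d
    have e0 : d * ((0 : ℝ) : ℂ) = 0 := by simp
    have hg'' := hg'
    rw [← e0] at hg''
    have := hg''.scomp (0 : ℝ) hl
    simpa [Function.comp_def, smul_eq_mul] using this
  have hadj : ∀ ζ ζ' : HilbertTensorPower E n,
      ⟪operatorPower Q n ζ, ζ'⟫ = ⟪ζ, operatorPower Q n ζ'⟫ :=
    inner_operatorPower (P.inner_proj_left hB) n
  -- The complex derivative is evaluated along the imaginary axis, where the generator gives it, and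
  -- used below along the real direction `c`.
  have hval : g' = ⟪operatorPower Q n ξ, η⟫ := by
    have hU0 : operatorPower (P.unitaryGroup id 0) n = 1 := by
      rw [P.unitaryGroup_zero, operatorPower_one]
    have h1 := (hasDerivAt_iff_mem_generatorGraph
      (V := fun t => operatorPower (P.unitaryGroup id t) n) hU0).2 hg
    have h2 : HasDerivAt (fun t : ℝ => ⟪operatorPower Q n ξ, operatorPower (P.unitaryGroup id t) n ξ⟫)
        (Complex.I * ⟪operatorPower Q n ξ, η⟫) 0 := by
      simpa [inner_smul_right] using (hasDerivAt_const (0 : ℝ) (operatorPower Q n ξ)).inner ℂ h1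
    have h3 : (fun t : ℝ => g (Complex.I * t)) = fun t : ℝ =>
        ⟪operatorPower Q n ξ, operatorPower (P.unitaryGroup id t) n ξ⟫ := by
      ext t
      have hcomm : P.unitaryGroup id t * Q = Q * P.unitaryGroup id t := by
        refine ContinuousLinearMap.ext fun y => ?_
        exact (P.proj_integral_comm hB (PVMeasure.isBddMeasurable_phase hid t) y).symm
      simp only [g, T]
      rw [P.integral_expTruncation_mul_I hid, ← hQ, hcomm, operatorPower_mul, mul_apply_eq_comp,
        hadj]
    have h4 := hline Complex.I
    rw [h3] at h4
    exact mul_left_cancel₀ Complex.I_ne_zero (h4.unique h2)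
  rw [← hval]
  let f : ℝ → ℝ := fun s => (g (c * s)).re
  have hfd : HasDerivAt f ((c : ℂ) * g').re 0 :=
    Complex.reCLM.hasFDerivAt.comp_hasDerivAt (0 : ℝ) (hline c)
  have hsq : ∀ s : ℝ, f s = ‖operatorPower (T ((c * (s / 2) : ℝ) : ℂ)) n ξ‖ ^ 2 := by
    intro s
    have e : (c : ℂ) * s = ((c * (s / 2) : ℝ) : ℂ) + ((c * (s / 2) : ℝ) : ℂ) := by
      push_cast
      ring
    simp only [f, g]
    rw [e, hTadd, operatorPower_mul, mul_apply_eq_comp,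
      ← inner_operatorPower (P.inner_integral_expTruncation hid N _)]
    exact inner_self_eq_norm_sq (𝕜 := ℂ) _
  have hf0 : f 0 = ‖operatorPower Q n ξ‖ ^ 2 := by
    rw [hsq]
    simp [hT0]
  have hQQ : Q * Q = Q := (P.isStarProjection _ hB).isIdempotentElem
  have hd : ((c : ℂ) * g').re ≤ 0 := by
    refine deriv_nonpos_of_midpoint hfd (fun s => ?_) ?_ fun s => ?_
    · rw [hsq]
      positivity
    · refine le_of_eq ?_
      have h1 := inner_operatorPower_of_mem_realTensorPower (S := T c) (T := Q)
        (fun a ha b hb => inner_expTruncation_of_mem hT hP N ha hb) hx hx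
      simp only [f, g]
      rw [Complex.ofReal_one, mul_one, Complex.ofReal_zero, mul_zero, hT0, h1]
    · rw [hf0, hsq s, ← mul_pow]
      have h1 : f (s / 2) = (⟪operatorPower Q n ξ,
          operatorPower (T ((c * (s / 2) : ℝ) : ℂ)) n ξ⟫).re := by
        simp only [f, g]
        have e : T ((c * (s / 2) : ℝ) : ℂ) = Q * T ((c * (s / 2) : ℝ) : ℂ) := by
          rw [← hT0, ← hTadd, zero_add]
        rw [hadj, ← mul_apply_eq_comp, ← operatorPower_mul, ← e]
        push_cast
        rfl
      rw [h1, sq_le_sq, abs_of_nonneg (a := ‖_‖ * ‖_‖) (by positivity)]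
      exact (Complex.abs_re_le_norm _).trans (norm_inner_le_norm _ _)
  rw [Complex.re_ofReal_mul] at hd
  by_contra! hneg
  nlinarith

/-- For `R = 1` the map `T` fixes `H` pointwise, so its symmetry makes the inner product real on
`H`. The coefficient `t ↦ ⟪ξ, U(t) ⊗ ⋯ ⊗ U(t) ξ⟫` is then even, and its derivative `i ⟪ξ, η⟫` at `0`
vanishes. -/
theorem isSuccActive_of_projSum_eq_one (hR : H.projSum = 1)
    (hV : ∀ t, ∀ a ∈ H.toClosedSubmodule, P.unitaryGroup id t a ∈ H.toClosedSubmodule) (n : ℕ) :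
    IsSuccActive n (P.operator id) H.toClosedSubmodule.toSubmodule := by
  have hid : Measurable (id : ℝ → ℝ) := measurable_id
  rw [IsSuccActive, P.unitaryExp_operator hid]
  intro x hx
  set ξ : HilbertTensorPower E n := x.1 with hξ
  set η := groupGenerator (fun t => operatorPower (P.unitaryGroup id t) n) x with hη
  have hg : (ξ, η) ∈ generatorGraph fun t => operatorPower (P.unitaryGroup id t) n := by
    rw [← graph_groupGenerator]
    exact LinearPMap.mem_graph _ x
  have hself : ∀ a ∈ H.toClosedSubmodule, H.projDiff a = a := fun a ha => by
    rw [StandardSubspace.projDiff_of_mem ha, hR, one_apply_eq_self]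
    module
  have hreal : ∀ a ∈ H.toClosedSubmodule, ∀ b ∈ H.toClosedSubmodule, ⟪a, b⟫ = ⟪b, a⟫ :=
    fun a ha b hb => by
      have := H.inner_projDiff_left a b
      rwa [hself a ha, hself b hb] at this
  have hU0 : operatorPower (P.unitaryGroup id 0) n = 1 := by
    rw [P.unitaryGroup_zero, operatorPower_one]
  have h1 := (hasDerivAt_iff_mem_generatorGraph
    (V := fun t => operatorPower (P.unitaryGroup id t) n) hU0).2 hg
  have h2 : HasDerivAt (fun t : ℝ => ⟪ξ, operatorPower (P.unitaryGroup id t) n ξ⟫)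
      (Complex.I * ⟪ξ, η⟫) 0 := by
    simpa [inner_smul_right] using (hasDerivAt_const (0 : ℝ) ξ).inner ℂ h1
  have h3 : ∀ t, ⟪ξ, operatorPower (P.unitaryGroup id t) n ξ⟫ =
      ⟪ξ, operatorPower (P.unitaryGroup id (-t)) n ξ⟫ := fun t => by
    refine inner_operatorPower_of_mem_realTensorPower (fun a ha b hb => ?_) hx hx
    rw [hreal a ha _ (hV t b hb), ← P.adjoint_unitaryGroup hid,
      ContinuousLinearMap.adjoint_inner_right]
  have h4 : HasDerivAt (fun t : ℝ => ⟪ξ, operatorPower (P.unitaryGroup id t) n ξ⟫)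
      (-(Complex.I * ⟪ξ, η⟫)) 0 := by
    have h5 : HasDerivAt (fun t : ℝ => ⟪ξ, operatorPower (P.unitaryGroup id t) n ξ⟫)
      (Complex.I * ⟪ξ, η⟫) (-0) := by rwa [neg_zero]
    have h6 := h5.scomp (0 : ℝ) (hasDerivAt_neg 0)
    rw [neg_one_smul] at h6
    exact h6.congr_of_eventuallyEq (Eventually.of_forall fun t => h3 t)
  have h7 := h2.unique h4
  have h8 : ⟪ξ, η⟫ = 0 := by
    have : Complex.I * ⟪ξ, η⟫ = 0 := by
      linear_combination (1 / 2 : ℂ) * h7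
    exact (mul_eq_zero.1 this).resolve_left Complex.I_ne_zero
  rw [h8]
  simp

end Converse

/-! ### Assembly of the converse implication -/

section Main

variable {E : Type*} [NormedAddCommGroup E] [InnerProductSpace ℂ E] [CompleteSpace E]

theorem PVMeasure.ae_eq_zero_of_operator_eq_zero {Ω : Type*} [MeasurableSpace Ω]
    {P : PVMeasure Ω E} {f : Ω → ℝ} (hf : Measurable f) (h : P.operator f = 0) (x : E) :
    ∀ᵐ ω ∂P.scalarMeasure x, f ω = 0 := by
  have hx : (x, (0 : E)) ∈ (P.operator f).graph := by
    rw [h]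
    exact (LinearPMap.mem_graph_iff _).2 ⟨⟨x, trivial⟩, rfl, rfl⟩
  have h1 := P.norm_integral_sub_sq hf hx (IsBddMeasurable.const 0)
  rw [P.integral_const, zero_smul, zero_apply, sub_zero, norm_zero, zero_pow two_ne_zero] at h1
  have e : (fun ω => ‖(0 : ℂ) - (f ω : ℂ)‖ ^ 2) = fun ω => f ω ^ 2 := by
    ext ω
    simp
  rw [e, eq_comm, integral_eq_zero_iff_of_nonneg (fun ω => sq_nonneg _)
    (P.integrable_sq_of_mem hf hx)] at h1
  filter_upwards [h1] with ω hω
  simpa using hω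

theorem isCompletelyActive_of_modularHamiltonian_eq {H : StandardSubspace E} {A : E →ₗ.[ℂ] E}
    (hA : IsSelfAdjoint A)
    (hAH : ∀ s : ℝ, unitaryExp A s '' (H.toClosedSubmodule : Set E) = H.toClosedSubmodule)
    {c : ℝ} (hc : c ≤ 0) (hK : H.modularHamiltonian = ((c : ℂ) • A).closure) :
    IsCompletelyActive A H.toClosedSubmodule.toSubmodule := by
  obtain ⟨P, rfl⟩ := hA.exists_eq_operator
  obtain ⟨Ω, _, Q, κ, hκ, hQ, hQR⟩ := H.exists_spectral_modularHamiltonian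
  rw [P.closure_smul_operator measurable_id, hQ] at hK
  rcases hc.lt_or_eq with hc | rfl
  · have hκ' : Measurable fun ω => c⁻¹ * κ ω := hκ.const_mul _
    -- Pushing the spectral measure of `log Δ_H` forward by `κ / c` gives one of `A`, so `R` becomes
    -- a function of `A`.
    have hAQ : P.operator id = (Q.map _ hκ').operator id := by
      rw [Q.operator_map hκ' measurable_id, Function.id_comp, ← Q.closure_smul_operator hκ, hK,
        P.closure_smul_operator (measurable_id.const_mul c)]
      congr 1
      ext a
      rw [← mul_assoc, inv_mul_cancel₀ hc.ne, one_mul]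
    rw [hAQ] at hAH ⊢
    rw [PVMeasure.unitaryExp_operator _ measurable_id] at hAH
    refine fun n => isSuccActive_of_neg (fun t x => H.projDiff_unitary
      ((PVMeasure.isUnitaryGroup _ measurable_id).unitary_mem t) (hAH t) x) hc ?_ n
    rw [Q.integral_map hκ' (isBddMeasurable_two_div_one_add_exp (f := fun a : ℝ => c * a)
      (measurable_id.const_mul c)), ← hQR]
    congr 1
    ext ω
    simp only [Function.comp_apply]
    rw [← mul_assoc, mul_inv_cancel₀ hc.ne, one_mul]
  -- For `c = 0` the closure of `0 • A` is the everywhere defined zero operator, so `κ = 0` almost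
  -- everywhere and `2 / (1 + e^κ) = 1`.
  · have h0 : Q.operator κ = 0 := by
      rw [hK]
      exact P.operator_eq_zero (fun x => Eventually.of_forall fun a => zero_mul _)
        (measurable_id.const_mul 0)
    have hR : H.projSum = 1 := by
      rw [← hQR]
      refine ContinuousLinearMap.ext fun x => ?_
      have h1 : Q.integral (fun ω => ((2 / (1 + Real.exp (κ ω)) : ℝ) : ℂ)) x =
          Q.integral (fun _ => 1) x := by
        refine Q.integral_congr_ae (isBddMeasurable_two_div_one_add_exp hκ) (.const 1) ?_
        filter_upwards [PVMeasure.ae_eq_zero_of_operator_eq_zero hκ h0 x] with ω hω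
        rw [hω]
        norm_num
      rw [h1, Q.integral_const, one_smul]
    rw [P.unitaryExp_operator measurable_id] at hAH
    refine fun n => isSuccActive_of_projSum_eq_one hR (fun t a ha => ?_) n
    have : P.unitaryGroup id t a ∈ (H.toClosedSubmodule : Set E) := by
      rw [← hAH t]
      exact ⟨a, ha, rfl⟩
    exact this

end Main

end

theorem theorem2p9 {E : Type*} [NormedAddCommGroup E] [InnerProductSpace ℂ E] [CompleteSpace E]
    (H : StandardSubspace E) (A : E →ₗ.[ℂ] E) (hA : IsSelfAdjoint A)
    (hAH : ∀ s : ℝ, unitaryExp A s '' (H.toClosedSubmodule : Set E) = H.toClosedSubmodule)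
    (hne : A ≠ 0 ∨ H.modularHamiltonian = 0) :
    IsCompletelyActive A H.toClosedSubmodule.toSubmodule ↔
      ∃ c : ℝ, c ≤ 0 ∧ H.modularHamiltonian = ((c : ℂ) • A).closure := by
  refine ⟨fun hact => ?_, fun ⟨c, hc, hK⟩ =>
    isCompletelyActive_of_modularHamiltonian_eq hA hAH hc hK⟩
  obtain ⟨P, rfl⟩ := hA.exists_eq_operator
  -- For `A = 0` activity carries no information about a slope. The assumption then gives `log Δ_H =
  -- 0`, and `c = 0` works.
  by_cases h0 : P.operator id = 0
  · refine ⟨0, le_rfl, ?_⟩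
    rw [hne.resolve_left (not_not.2 h0), P.closure_smul_operator measurable_id]
    exact (P.operator_eq_zero (fun x => Eventually.of_forall fun a => zero_mul _)
      (measurable_id.const_mul 0)).symm
  · rw [P.unitaryExp_operator measurable_id] at hAH
    exact hact.exists_modularHamiltonian_eq
      (fun t x => H.projSum_unitary ((P.isUnitaryGroup measurable_id).unitary_mem t) (hAH t) x)
      (fun t x => H.projDiff_unitary ((P.isUnitaryGroup measurable_id).unitary_mem t) (hAH t) x) h0
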